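/- **Theorem 2 (fast fixed-point iteration for QSP phase factors).** *Setting.* For $x\in[-1,1]$ let $W(x)=\begin{pmatrix}x& i\sqrt{1-x^2}\\ i\sqrt{1-x^2}&x\end{pmatrix}$, $\sigma_z=\mathrm{diag}(1,-1)$. For $\Psi=(\psi_0,\dots,\psi_d)\in\mathbb R^{d+1}$ let $\Phi=(\psi_d,\dots,\psi_1,\psi_0,\psi_1,\dots,\psi_d)=(\phi_0,\dots,\phi_{2d})$, let $U(x,\Psi)=e^{i\phi_0\sigma_z}W(x)e^{i\phi_1\sigma_z}W(x)\cdots W(x)e^{i\phi_{2d}\sigma_z}$, and let $g(x,\Psi)$ be the imaginary part of its upper left entry. $F(\Psi)=(q_0,\dots,q_d)$ denotes the Chebyshev coefficients of $g$: $g(x,\Psi)=\sum_{j=0}^d q_jT_{2j}(x)$. Given an even real polynomial $f=\sum_{j=0}^d\hat f_jT_{2j}$ of degree at most $2d$, a *maximal solution* for $f$ is a $\Psi\in(-\pi/2,\pi/2)^{d+1}$ with $g(\cdot,\Psi)=f$ on $[-1,1]$ such that the function $a$ in $$\begin{pmatrix}a(z)&b(z)\\-b^*(z)&a^*(z)\end{pmatrix}=\prod_{n=-d}^{d}\frac1{\sqrt{1+|F_n|^2}}\begin{pmatrix}1&F_nz^n\\-\overline{F_n}z^{-n}&1\end{pmatrix},\qquad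 F_n=i\tan\psi_{|n|}$$ (factors ordered from left to right; $a$ is a polynomial in $z^{-1}$) is outer, i.e. has no zero with $|z|>1$. The fixed-point iteration is $\Psi^{(0)}=0$, $\Psi^{(k+1)}=\Psi^{(k)}-\frac12\bigl(F(\Psi^{(k)})-\hat f\bigr)$. Algorithms are programs for a real random access machine: natural-number registers with addition, truncated subtraction, halving and comparison; arrays of reals with indirect addressing, conversion of natural numbers to reals, the constant $\pi$, and $+,-,\times,/,\sin,\cos,<$. The cost is the number of elementary operations. The program may be run in any arithmetic with machine precision $u\ge0$, meaning that each real operation, the conversion of natural numbers to reals and the constant $\pi$ are exact up to a relative error of at most $u$ ($u=0$ is exact arithmetic). Write $D=\max(d,2)$ and $\|v\|_1=\sum_{j=0}^d|v_j|$. *Claim.* There are two fixed programs, a constant $C>0$ and an exponent $p\in\mathbb N$ such that for every $d\ge 0$ and every arithmetic of machine precision $u\ge 0$ with $C D^{p}u\le1$: 1. (Evaluation of $F$.) For every $\Psi\in\mathbb R^{d+1}$, the first program, on input $(d,\Psi)$, halts after at most $C\,D\log^2 D$ operations with an output $\hat q$ satisfying $\|\hat q-F(\Psi)\|_1\le C D^{p}u$.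 2. (Phase factors.) Let $f=\sum_{j=0}^d\hat f_jT_{2j}$ with $\|\hat f\|_1=\sum_{j=0}^d|\hat f_j|<0.861$. Then $f$ has exactly one maximal solution $\Psi$. For every $0<\varepsilon\le\frac12$ there is a number of iterations $k\le C\log(1/\varepsilon)$ with $\|\Psi^{(k)}-\Psi\|_1\le\varepsilon$ such that the second program, on input $(d,\hat f,\varepsilon)$, halts after at most $C\,D\log^2D\,\log(1/\varepsilon)$ operations with an output $\hat\Psi$ satisfying $\|\hat\Psi-\Psi^{(k)}\|_1\le C D^{p}u$. In particular $\|\hat\Psi-\Psi\|_1\le\varepsilon+CD^{p}u$. -/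

import Mathlib

open Polynomial

noncomputable section

namespace QSP

/-! ### Quantum signal processing -/

/-- The signal matrix `W(x)`, for `x ∈ [-1, 1]`. -/
def W (x : ℝ) : Matrix (Fin 2) (Fin 2) ℂ :=
  !![(x : ℂ), Complex.I * (Real.sqrt (1 - x ^ 2) : ℂ);
     Complex.I * (Real.sqrt (1 - x ^ 2) : ℂ), (x : ℂ)]

/-- The matrix `e^{i φ σ_z}`. -/
def expZ (φ : ℝ) : Matrix (Fin 2) (Fin 2) ℂ :=
  !![Complex.exp (Complex.I * φ), 0; 0, Complex.exp (-(Complex.I * φ))]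

/-- `U(x, Φ) = e^{i φ₀ σ_z} W(x) e^{i φ₁ σ_z} W(x) ⋯ W(x) e^{i φₙ σ_z}`. -/
def U {n : ℕ} (x : ℝ) (Φ : Fin (n + 1) → ℝ) : Matrix (Fin 2) (Fin 2) ℂ :=
  expZ (Φ 0) * (List.ofFn fun j : Fin n => W x * expZ (Φ j.succ)).prod

/-- `g(x, Φ)`, the imaginary part of the upper left entry of `U(x, Φ)`. -/
def g {n : ℕ} (x : ℝ) (Φ : Fin (n + 1) → ℝ) : ℝ := (U x Φ 0 0).im

/-- The symmetric full sequence `(ψ_d, …, ψ_1, ψ_0, ψ_1, …, ψ_d)` of the reduced phase factors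
`Ψ = (ψ_0, …, ψ_d)`. -/
def full {d : ℕ} (Ψ : Fin (d + 1) → ℝ) : Fin (2 * d + 1) → ℝ :=
  fun j => Ψ ⟨((j : ℤ) - d).natAbs, by omega⟩

/-- The function with Chebyshev coefficients `q`: `x ↦ ∑_{j ≤ d} q_j T_{2j}(x)`. -/
def chebSum {d : ℕ} (q : Fin (d + 1) → ℝ) : ℝ[X] :=
  ∑ j : Fin (d + 1), Polynomial.C (q j) * Polynomial.Chebyshev.T ℝ (2 * (j : ℤ))

/-- Laurent polynomials in `e^{iθ}` spanned by `e^{i (n - 2k) θ}`, `0 ≤ k ≤ n`; used only to show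
that `g(·, Φ)` has a Chebyshev expansion. -/
def eSpan (n : ℕ) : Submodule ℂ (ℝ → ℂ) :=
  Submodule.span ℂ
    {h | ∃ k : ℕ, k ≤ n ∧ h = fun θ : ℝ => Complex.exp (Complex.I * (((n : ℂ) - 2 * k) * θ))}

theorem eSpan_step {n : ℕ} {h : ℝ → ℂ} (hh : h ∈ eSpan n) (a b : ℂ) :
    (fun θ : ℝ => (a * Complex.exp (Complex.I * θ) + b * Complex.exp (-(Complex.I * θ))) * h θ)
      ∈ eSpan (n + 1) := by
  induction hh using Submodule.span_induction with
  | mem h hm =>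
    obtain ⟨k, hk, rfl⟩ := hm
    have e : (fun θ : ℝ => (a * Complex.exp (Complex.I * θ) + b * Complex.exp (-(Complex.I * θ))) *
          Complex.exp (Complex.I * (((n : ℂ) - 2 * k) * θ))) =
        a • (fun θ : ℝ => Complex.exp (Complex.I * ((((n + 1 : ℕ) : ℂ) - 2 * (k : ℕ)) * θ))) +
        b • (fun θ : ℝ =>
          Complex.exp (Complex.I * ((((n + 1 : ℕ) : ℂ) - 2 * ((k + 1 : ℕ) : ℂ)) * θ))) := by
      funext θ
      simp only [Pi.add_apply, Pi.smul_apply, smul_eq_mul, add_mul, mul_assoc, ← Complex.exp_add]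
      push_cast
      ring_nf
    rw [e]
    exact add_mem (Submodule.smul_mem _ _ (Submodule.subset_span ⟨k, by omega, rfl⟩))
      (Submodule.smul_mem _ _ (Submodule.subset_span ⟨k + 1, by omega, rfl⟩))
  | zero =>
    convert (eSpan (n + 1)).zero_mem using 1
    funext θ; simp
  | add x y _ _ hx hy =>
    convert add_mem hx hy using 1
    funext θ; simp [mul_add]
  | smul c x _ hx =>
    convert Submodule.smul_mem _ c hx using 1
    funext θ; simp; ring

/-- `W(cos θ)`, continued to all real `θ`. -/
def Wang (θ : ℝ) : Matrix (Fin 2) (Fin 2) ℂ :=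
  !![Complex.cos θ, Complex.I * Complex.sin θ; Complex.I * Complex.sin θ, Complex.cos θ]

theorem W_arccos {x : ℝ} (hx : x ∈ Set.Icc (-1 : ℝ) 1) : W x = Wang (Real.arccos x) := by
  unfold W Wang
  rw [← Complex.ofReal_cos, ← Complex.ofReal_sin, Real.cos_arccos hx.1 hx.2, Real.sin_arccos]

def Uang {n : ℕ} (θ : ℝ) (Φ : Fin (n + 1) → ℝ) : Matrix (Fin 2) (Fin 2) ℂ :=
  expZ (Φ 0) * (List.ofFn fun j : Fin n => Wang θ * expZ (Φ j.succ)).prod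

theorem Uang_succ {n : ℕ} (θ : ℝ) (Φ : Fin (n + 2) → ℝ) :
    Uang θ Φ = expZ (Φ 0) * (Wang θ * Uang θ (fun j : Fin (n + 1) => Φ j.succ)) := by
  simp [Uang, List.ofFn_succ, mul_assoc]

theorem Uang_mem {n : ℕ} (Φ : Fin (n + 1) → ℝ) (i j : Fin 2) :
    (fun θ : ℝ => Uang θ Φ i j) ∈ eSpan n := by
  induction n generalizing i j with
  | zero =>
    have e : (fun θ : ℝ => Uang θ Φ i j) = (expZ (Φ 0) i j) •
        (fun θ : ℝ => Complex.exp (Complex.I * ((((0 : ℕ) : ℂ) - 2 * ((0 : ℕ) : ℂ)) * θ))) := by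
      funext θ; simp [Uang]
    rw [e]
    exact Submodule.smul_mem _ _ (Submodule.subset_span ⟨0, le_rfl, rfl⟩)
  | succ n ih =>
    have hc : ∀ i j, (fun θ : ℝ => Complex.cos θ *
        Uang θ (fun j : Fin (n + 1) => Φ j.succ) i j) ∈ eSpan (n + 1) := by
      intro i j
      convert eSpan_step (ih (fun j : Fin (n + 1) => Φ j.succ) i j) (1 / 2) (1 / 2) using 1
      funext θ
      rw [Complex.cos]; ring_nf
    have hs : ∀ i j, (fun θ : ℝ => (Complex.I * Complex.sin θ) *
        Uang θ (fun j : Fin (n + 1) => Φ j.succ) i j) ∈ eSpan (n + 1) := by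
      intro i j
      convert eSpan_step (ih (fun j : Fin (n + 1) => Φ j.succ) i j) (1 / 2) (-1 / 2) using 1
      funext θ
      rw [Complex.sin]; ring_nf; simp only [Complex.I_sq]; ring_nf
    fin_cases i
    · convert Submodule.smul_mem _ (Complex.exp (Complex.I * Φ 0)) (add_mem (hc 0 j) (hs 1 j))
        using 1
      funext θ
      rw [Uang_succ]
      simp only [Matrix.mul_apply, Fin.sum_univ_two]
      simp [expZ, Wang]
    · convert Submodule.smul_mem _ (Complex.exp (-(Complex.I * Φ 0))) (add_mem (hs 0 j) (hc 1 j))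
        using 1
      funext θ
      rw [Uang_succ]
      simp only [Matrix.mul_apply, Fin.sum_univ_two]
      simp [expZ, Wang]

theorem Uang_neg {n : ℕ} (Φ : Fin (n + 1) → ℝ) (θ : ℝ) :
    Uang (-θ) Φ = !![1, 0; 0, -1] * Uang θ Φ * !![1, 0; 0, -1] := by
  induction n with
  | zero => simp [Uang, expZ]
  | succ n ih =>
    rw [Uang_succ, Uang_succ, ih]
    ext i j
    simp only [Matrix.mul_apply, Fin.sum_univ_two]
    fin_cases i <;> fin_cases j <;> simp [expZ, Wang] <;> ring

theorem exists_chebSum {d : ℕ} (Φ : Fin (2 * d + 1) → ℝ) :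
    ∃ q : Fin (d + 1) → ℝ, ∀ x ∈ Set.Icc (-1 : ℝ) 1, g x Φ = (chebSum q).eval x := by
  have key : ∀ h ∈ eSpan (2 * d), ∃ q : Fin (d + 1) → ℂ, ∀ θ : ℝ,
      h θ + h (-θ) = ∑ j : Fin (d + 1), q j * (Real.cos (2 * (j : ℕ) * θ) : ℂ) := by
    intro h hh
    induction hh using Submodule.span_induction with
    | mem h hm =>
      obtain ⟨k, hk, rfl⟩ := hm
      have hlt : ((d : ℤ) - k).natAbs < d + 1 := by omega
      refine ⟨Pi.single ⟨((d : ℤ) - k).natAbs, hlt⟩ 2, fun θ => ?_⟩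
      rw [Finset.sum_eq_single ⟨((d : ℤ) - k).natAbs, hlt⟩]
      · have hcos : Real.cos (2 * ((((d : ℤ) - k).natAbs : ℕ) : ℝ) * θ) =
            Real.cos (2 * ((d : ℝ) - k) * θ) := by
          have : ((((d : ℤ) - k).natAbs : ℕ) : ℝ) = |(d : ℝ) - k| := by
            rw [Nat.cast_natAbs]; push_cast; rfl
          rw [this]
          rcases abs_choice ((d : ℝ) - k) with h | h <;> rw [h]
          rw [← Real.cos_neg]; ring_nf
        simp only [Pi.single_eq_same, hcos]
        push_cast
        rw [Complex.cos]
        ring_nf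
      · intro b _ hb
        simp [Pi.single_eq_of_ne hb]
      · simp
    | zero => exact ⟨0, by simp⟩
    | add x y _ _ hx hy =>
      obtain ⟨q, hq⟩ := hx
      obtain ⟨r, hr⟩ := hy
      refine ⟨q + r, fun θ => ?_⟩
      simp only [Pi.add_apply, add_mul, Finset.sum_add_distrib, ← hq, ← hr]
      ring
    | smul a x _ hx =>
      obtain ⟨q, hq⟩ := hx
      refine ⟨a • q, fun θ => ?_⟩
      simp only [Pi.smul_apply, smul_eq_mul, ← mul_add, hq, Finset.mul_sum]
      exact Finset.sum_congr rfl fun j _ => by ring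
  obtain ⟨q, hq⟩ := key _ (Uang_mem Φ 0 0)
  refine ⟨fun j => (q j).im / 2, fun x hx => ?_⟩
  have hU : U x Φ = Uang (Real.arccos x) Φ := by simp [U, Uang, W_arccos hx]
  have h1 := hq (Real.arccos x)
  have h2 : Uang (-Real.arccos x) Φ 0 0 = Uang (Real.arccos x) Φ 0 0 := by
    rw [Uang_neg]; simp only [Matrix.mul_apply, Fin.sum_univ_two]; simp
  simp only [h2] at h1
  have h3 := congrArg Complex.im h1
  simp only [Complex.add_im, Complex.im_sum, Complex.im_mul_ofReal] at h3
  have h4 : ∀ j : Fin (d + 1), (Polynomial.Chebyshev.T ℝ (2 * (j : ℤ))).eval x =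
      Real.cos (2 * (j : ℕ) * Real.arccos x) := by
    intro j
    have := Polynomial.Chebyshev.T_real_cos (Real.arccos x) (2 * (j : ℤ))
    rw [Real.cos_arccos hx.1 hx.2] at this
    rw [this]; push_cast; rfl
  unfold g chebSum
  rw [hU, Polynomial.eval_finsetSum]
  simp only [Polynomial.eval_mul, Polynomial.eval_C, h4]
  simp only [div_mul_eq_mul_div, ← Finset.sum_div]
  linarith

/-- The map `F : ℝ^{d+1} → ℝ^{d+1}`, taking the reduced phase factors `Ψ` to the (unique) vector
`q` of Chebyshev coefficients, `g(x, Ψ) = ∑_{j ≤ d} q_j T_{2j}(x)` on `[-1, 1]`. -/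
def F {d : ℕ} (Ψ : Fin (d + 1) → ℝ) : Fin (d + 1) → ℝ :=
  Classical.choose (exists_chebSum (full Ψ))

/-- The fixed-point iteration `Ψ⁽⁰⁾ = 0`, `Ψ⁽ᵏ⁺¹⁾ = Ψ⁽ᵏ⁾ - ½ (F(Ψ⁽ᵏ⁾) - f̂)`. -/
def fpi {d : ℕ} (fhat : Fin (d + 1) → ℝ) : ℕ → Fin (d + 1) → ℝ
  | 0 => 0
  | k + 1 => fpi fhat k - (1 / 2 : ℝ) • (F (fpi fhat k) - fhat)

/-- The `ℓ¹` norm on `ℝ^{d+1}`. -/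
def l1 {d : ℕ} (v : Fin (d + 1) → ℝ) : ℝ := ∑ j, |v j|

/-! ### The maximal solution -/

/-- The nonlinear Fourier transform, at `z ≠ 0`, of a complex sequence supported on
`{-d, …, d}`, whose value at `n` is `c (n + d)`: the ordered product over `n = -d, …, d` of the
matrices `(1 + |c_n|²)^{-1/2} [[1, c_n zⁿ], [-conj c_n z⁻ⁿ, 1]]`. It has the form
`[[a(z), b(z)], [-b*(z), a*(z)]]`. -/
def nlft {d : ℕ} (c : Fin (2 * d + 1) → ℂ) (z : ℂ) : Matrix (Fin 2) (Fin 2) ℂ :=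
  (List.ofFn fun k : Fin (2 * d + 1) =>
    ((1 / Real.sqrt (1 + ‖c k‖ ^ 2) : ℝ) : ℂ) •
      !![1, c k * z ^ ((k : ℤ) - d);
         -(starRingEnd ℂ) (c k) * z ^ (-((k : ℤ) - d)), 1]).prod

/-- `Ψ` is the maximal solution for `f`: its entries lie in `(-π/2, π/2)`, it solves
`g(x, Ψ) = f(x)` on `[-1, 1]`, and the component `a` of the nonlinear Fourier transform of the
sequence `i tan ψ_{|n|}`, `-d ≤ n ≤ d`, is outer. Here `a` is a polynomial in `z⁻¹` with
`a(∞) = ∏ cos ψ_{|n|} > 0`, so being outer means having no zero in `|z| > 1`. -/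
def IsMaximalSolution {d : ℕ} (f : ℝ[X]) (Ψ : Fin (d + 1) → ℝ) : Prop :=
  (∀ j, |Ψ j| < Real.pi / 2) ∧
  (∀ x ∈ Set.Icc (-1 : ℝ) 1, g x (full Ψ) = f.eval x) ∧
  ∀ z : ℂ, 1 < ‖z‖ → nlft (fun k => Complex.I * (Real.tan (full Ψ k) : ℂ)) z 0 0 ≠ 0

/-! ### Real random access machines with rounded arithmetic

Programs of a structured language with natural-number registers, used for control and indexing,
and arrays of reals. -/

/-- The standard model of floating point arithmetic with unit roundoff (machine precision) `u`:
each operation returns the exact result up to a relative error of at most `u`. For `u = 0` this is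
exact real arithmetic. -/
structure Arith (u : ℝ) where
  ofNat : ℕ → ℝ
  pi : ℝ
  add : ℝ → ℝ → ℝ
  sub : ℝ → ℝ → ℝ
  mul : ℝ → ℝ → ℝ
  div : ℝ → ℝ → ℝ
  sin : ℝ → ℝ
  cos : ℝ → ℝ
  ofNat_err : ∀ n : ℕ, |ofNat n - n| ≤ u * |(n : ℝ)|
  pi_err : |pi - Real.pi| ≤ u * |Real.pi|
  add_err : ∀ x y, |add x y - (x + y)| ≤ u * |x + y|
  sub_err : ∀ x y, |sub x y - (x - y)| ≤ u * |x - y|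
  mul_err : ∀ x y, |mul x y - x * y| ≤ u * |x * y|
  div_err : ∀ x y, y ≠ 0 → |div x y - x / y| ≤ u * |x / y|
  sin_err : ∀ x, |sin x - Real.sin x| ≤ u * |Real.sin x|
  cos_err : ∀ x, |cos x - Real.cos x| ≤ u * |Real.cos x|

/-- Memory: natural-number registers and arrays of reals. -/
structure State where
  reg : ℕ → ℕ
  mem : ℕ → ℕ → ℝ

/-- Natural-number expressions; `half` is `⌊·/2⌋` and `sub` is truncated. -/
inductive NExpr where
  | lit : ℕ → NExpr
  | reg : ℕ → NExpr
  | add : NExpr → NExpr → NExpr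
  | sub : NExpr → NExpr → NExpr
  | half : NExpr → NExpr

/-- Real expressions; `load a i` reads entry `i` of array `a`. -/
inductive RExpr where
  | load : ℕ → NExpr → RExpr
  | ofNat : NExpr → RExpr
  | pi : RExpr
  | add : RExpr → RExpr → RExpr
  | sub : RExpr → RExpr → RExpr
  | mul : RExpr → RExpr → RExpr
  | div : RExpr → RExpr → RExpr
  | sin : RExpr → RExpr
  | cos : RExpr → RExpr

/-- Tests. -/
inductive Test where
  | nlt : NExpr → NExpr → Test
  | rlt : RExpr → RExpr → Test

/-- Programs. -/
inductive Prog where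
  | skip : Prog
  | setReg : ℕ → NExpr → Prog
  | store : ℕ → NExpr → RExpr → Prog
  | seq : Prog → Prog → Prog
  | ite : Test → Prog → Prog → Prog
  | while : Test → Prog → Prog

def NExpr.eval (s : State) : NExpr → ℕ
  | .lit n => n
  | .reg r => s.reg r
  | .add e₁ e₂ => e₁.eval s + e₂.eval s
  | .sub e₁ e₂ => e₁.eval s - e₂.eval s
  | .half e => e.eval s / 2

def RExpr.eval {u : ℝ} (A : Arith u) (s : State) : RExpr → ℝ
  | .load a i => s.mem a (i.eval s)
  | .ofNat e => A.ofNat (e.eval s)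
  | .pi => A.pi
  | .add e₁ e₂ => A.add (e₁.eval A s) (e₂.eval A s)
  | .sub e₁ e₂ => A.sub (e₁.eval A s) (e₂.eval A s)
  | .mul e₁ e₂ => A.mul (e₁.eval A s) (e₂.eval A s)
  | .div e₁ e₂ => A.div (e₁.eval A s) (e₂.eval A s)
  | .sin e => A.sin (e.eval A s)
  | .cos e => A.cos (e.eval A s)

def Test.holds {u : ℝ} (A : Arith u) (s : State) : Test → Prop
  | .nlt e₁ e₂ => e₁.eval s < e₂.eval s
  | .rlt e₁ e₂ => e₁.eval A s < e₂.eval A s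

/-- The cost of evaluating an expression is the number of its operations and memory accesses. -/
def NExpr.cost : NExpr → ℕ
  | .lit _ => 1
  | .reg _ => 1
  | .add e₁ e₂ => e₁.cost + e₂.cost + 1
  | .sub e₁ e₂ => e₁.cost + e₂.cost + 1
  | .half e => e.cost + 1

def RExpr.cost : RExpr → ℕ
  | .load _ i => i.cost + 1
  | .ofNat e => e.cost + 1
  | .pi => 1
  | .add e₁ e₂ => e₁.cost + e₂.cost + 1
  | .sub e₁ e₂ => e₁.cost + e₂.cost + 1
  | .mul e₁ e₂ => e₁.cost + e₂.cost + 1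
  | .div e₁ e₂ => e₁.cost + e₂.cost + 1
  | .sin e => e.cost + 1
  | .cos e => e.cost + 1

def Test.cost : Test → ℕ
  | .nlt e₁ e₂ => e₁.cost + e₂.cost + 1
  | .rlt e₁ e₂ => e₁.cost + e₂.cost + 1

def State.setReg (s : State) (r n : ℕ) : State :=
  { s with reg := Function.update s.reg r n }

def State.store (s : State) (a i : ℕ) (x : ℝ) : State :=
  { s with mem := Function.update s.mem a (Function.update (s.mem a) i x) }

/-- `Exec A P s s' t`: in the arithmetic `A`, the program `P` started in `s` halts in `s'` after
`t` elementary operations. -/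
inductive Exec {u : ℝ} (A : Arith u) : Prog → State → State → ℕ → Prop where
  | skip (s : State) : Exec A .skip s s 1
  | setReg (s : State) (r : ℕ) (e : NExpr) :
      Exec A (.setReg r e) s (s.setReg r (e.eval s)) (e.cost + 1)
  | store (s : State) (a : ℕ) (i : NExpr) (e : RExpr) :
      Exec A (.store a i e) s (s.store a (i.eval s) (e.eval A s)) (i.cost + e.cost + 1)
  | seq {P Q : Prog} {s s' s'' : State} {t t' : ℕ} :
      Exec A P s s' t → Exec A Q s' s'' t' → Exec A (.seq P Q) s s'' (t + t')
  | ite_true {b : Test} {P Q : Prog} {s s' : State} {t : ℕ} :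
      b.holds A s → Exec A P s s' t → Exec A (.ite b P Q) s s' (b.cost + t)
  | ite_false {b : Test} {P Q : Prog} {s s' : State} {t : ℕ} :
      ¬ b.holds A s → Exec A Q s s' t → Exec A (.ite b P Q) s s' (b.cost + t)
  | while_true {b : Test} {P : Prog} {s s' s'' : State} {t t' : ℕ} :
      b.holds A s → Exec A P s s' t → Exec A (.while b P) s' s'' t' →
      Exec A (.while b P) s s'' (b.cost + t + t')
  | while_false {b : Test} {P : Prog} {s : State} :
      ¬ b.holds A s → Exec A (.while b P) s s b.cost

/-- Execution is deterministic: final state and cost are determined by the initial state. -/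
theorem Exec.det {u : ℝ} {A : Arith u} {P : Prog} {s s₁ s₂ : State} {t₁ t₂ : ℕ}
    (h₁ : Exec A P s s₁ t₁) (h₂ : Exec A P s s₂ t₂) : s₁ = s₂ ∧ t₁ = t₂ := by
  induction h₁ generalizing s₂ t₂ with
  | skip s => cases h₂; exact ⟨rfl, rfl⟩
  | setReg s r e => cases h₂; exact ⟨rfl, rfl⟩
  | store s a i e => cases h₂; exact ⟨rfl, rfl⟩
  | seq _ _ ih ih' =>
    cases h₂ with
    | seq k k' =>
      obtain ⟨rfl, rfl⟩ := ih k
      obtain ⟨rfl, rfl⟩ := ih' k'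
      exact ⟨rfl, rfl⟩
  | ite_true hb _ ih =>
    cases h₂ with
    | ite_true _ k => obtain ⟨rfl, rfl⟩ := ih k; exact ⟨rfl, rfl⟩
    | ite_false hn _ => exact absurd hb hn
  | ite_false hb _ ih =>
    cases h₂ with
    | ite_true hn _ => exact absurd hn hb
    | ite_false _ k => obtain ⟨rfl, rfl⟩ := ih k; exact ⟨rfl, rfl⟩
  | while_true hb _ _ ih ih' =>
    cases h₂ with
    | while_true _ k k' =>
      obtain ⟨rfl, rfl⟩ := ih k
      obtain ⟨rfl, rfl⟩ := ih' k'
      exact ⟨rfl, rfl⟩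
    | while_false hn => exact absurd hb hn
  | while_false hb =>
    cases h₂ with
    | while_true hn _ _ => exact absurd hn hb
    | while_false _ => exact ⟨rfl, rfl⟩

/-- The initial memory for input size `d`, input vector `v` and tolerance `ε`: register `0` holds
`d`, array `0` holds `v`, entry `0` of array `1` holds `ε`, and all else is zero. -/
def input {d : ℕ} (v : Fin (d + 1) → ℝ) (ε : ℝ) : State where
  reg := fun r => if r = 0 then d else 0
  mem := fun a i =>
    if a = 0 then (if h : i < d + 1 then v ⟨i, h⟩ else 0)
    else if a = 1 ∧ i = 0 then ε else 0

/-- The output vector is read from array `2`. -/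
def output (d : ℕ) (s : State) : Fin (d + 1) → ℝ := fun j => s.mem 2 j

/-- The size `d`, replaced by `2` where `d log² d` vanishes. -/
def size (d : ℕ) : ℝ := max (d : ℝ) 2

end QSP

end

open Polynomial

noncomputable section

namespace QSP

/-! ### Elementary bounds for hyperbolic functions -/

/-! In the Hadamard basis `W (cos θ)` is diagonal with entries `e^{±iθ}` and the phase factors act
as plane rotations. So `U` is encoded by the first column `(P₁, P₂)` of a product of rotations and
copies of `diag(1, X)` (`Uang_eq`), and `F Ψ` is `P₂` folded about degree `d` (`F_eq`).

Existence and convergence. The middle angle `ψ₀` is kept exactly. Then `P₁` is `cos ψ₀`, and `P₂` is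
`sin ψ₀ X^d` plus `cos ψ₀` times the polynomial whose coefficients are the other angles, up to
errors whose `ℓ¹` coefficient norms are majorized by replacing the sines and cosines of those angles
by `sinh` and `cosh` (`majorized_colPoly_center`). With `p = |ψ₀|` and `y = 2 ∑_{j ≥ 1} |ψ_j|`, a
step of the iteration is thus controlled by inequalities in the plane. A polygon in `(p, y)`,
depending on `|f̂₀|`, is invariant (`InRegion.step`), and on it the derivative of the step has `ℓ¹`
norm at most `0.985` (`sum_abs_dF_le`, `InRegion.margin_ge`). This gives a fixed point and geometric
convergence. The same margin makes `P₁` nonzero on the closed unit disc, so the fixed point is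
maximal (`isMaximalSolution_of_fixedPoint`).

Uniqueness. For a symmetric sequence, `f` determines `P₂` on the unit circle (`aeval_snd_eq`), hence
also `|P₁|² = 1 - |P₂|²`. A polynomial without zeros in the closed disc and positive at `0` is
determined by its modulus on the circle (`eq_of_norm_eq_on_sphere`), and the angles are stripped off
`(P₁, P₂)` one by one (`colPoly_injective`).

Algorithm. The rotations, padded with zero angles to a power of two, are multiplied in a binary
tree, and the polynomial entries are multiplied by fast Fourier transforms. There are `O(log d)`
levels of `O(d log d)` operations each. All nodes of the tree are unitary on the unit circle, so
errors measured there grow by a bounded factor per level, which is polynomial in `d`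
(`TreeClose.step`, `ends_treeProg`); Parseval transfers them to coefficients
(`abs_coeff_le_of_circle`). In the iteration, the slack of the invariant region and the contraction
absorb the rounding errors (`perturbed_step`). The number of iterations is fixed by a counter that
grows geometrically from `ε` to `1` (`exists_iterations`). -/

theorem add_cube_le_sinh {x : ℝ} (hx : 0 ≤ x) : x + x ^ 3 / 6 ≤ Real.sinh x := by
  have h := sum_le_hasSum (Finset.range 2) (fun i _ => by positivity) (Real.hasSum_sinh x)
  norm_num [Finset.sum_range_succ, Nat.factorial] at h
  exact h

theorem one_add_sq_le_cosh (x : ℝ) : 1 + x ^ 2 / 2 ≤ Real.cosh x := by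
  have h := sum_le_hasSum (Finset.range 2) (fun i _ => by
    rw [pow_mul]; positivity) (Real.hasSum_cosh x)
  simpa [Finset.sum_range_succ, Nat.factorial] using h

/-- This and the next three bounds turn trigonometric factors into hyperbolic ones in the majorants
below. -/
theorem abs_sin_le_sinh (x : ℝ) : |Real.sin x| ≤ Real.sinh |x| :=
  Real.abs_sin_le_abs.trans (Real.self_le_sinh_iff.2 (abs_nonneg x))

theorem abs_cos_le_cosh (x : ℝ) : |Real.cos x| ≤ Real.cosh |x| :=
  (Real.abs_cos_le_one x).trans (Real.one_le_cosh _)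

theorem abs_cos_sub_one_le (x : ℝ) : |Real.cos x - 1| ≤ Real.cosh |x| - 1 := by
  have h1 := one_add_sq_le_cosh |x|
  have h2 := Real.one_sub_sq_div_two_le_cos (x := x)
  rw [sq_abs] at h1
  rw [abs_sub_comm, abs_of_nonneg (by linarith [Real.cos_le_one x])]
  linarith

theorem abs_sin_sub_le (x : ℝ) : |Real.sin x - x| ≤ Real.sinh |x| - |x| := by
  have h1 := add_cube_le_sinh (abs_nonneg x)
  have h2 := Real.abs_sub_sin_le x
  rw [abs_sub_comm]
  linarith

/-! ### The `ℓ¹` norm of the coefficients of a polynomial -/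

/-- The sum of the absolute values of the coefficients. -/
def cnorm (P : ℝ[X]) : ℝ := ∑ i ∈ P.support, |P.coeff i|

theorem cnorm_eq {P : ℝ[X]} {s : Finset ℕ} (h : P.support ⊆ s) :
    cnorm P = ∑ i ∈ s, |P.coeff i| :=
  Finset.sum_subset h fun i _ hi => by simp [notMem_support_iff.1 hi]

theorem cnorm_nonneg (P : ℝ[X]) : 0 ≤ cnorm P := Finset.sum_nonneg fun _ _ => abs_nonneg _

theorem sum_abs_coeff_le (P : ℝ[X]) (s : Finset ℕ) : ∑ i ∈ s, |P.coeff i| ≤ cnorm P := by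
  rw [cnorm_eq (s := P.support ∪ s) Finset.subset_union_left]
  exact Finset.sum_le_sum_of_subset_of_nonneg Finset.subset_union_right fun _ _ _ => abs_nonneg _

theorem cnorm_add_le (P Q : ℝ[X]) : cnorm (P + Q) ≤ cnorm P + cnorm Q := by
  have h := support_add (p := P) (q := Q)
  rw [cnorm_eq h, cnorm_eq (P := P) (s := P.support ∪ Q.support) Finset.subset_union_left,
    cnorm_eq (P := Q) (s := P.support ∪ Q.support) Finset.subset_union_right,
    ← Finset.sum_add_distrib]
  exact Finset.sum_le_sum fun i _ => by rw [coeff_add]; exact abs_add_le _ _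

theorem cnorm_C_mul (a : ℝ) (P : ℝ[X]) : cnorm (C a * P) = |a| * cnorm P := by
  rw [cnorm_eq (s := P.support), cnorm, Finset.mul_sum]
  · simp [abs_mul]
  · intro i hi
    rw [mem_support_iff] at *
    rw [coeff_C_mul] at hi
    exact right_ne_zero_of_mul hi

theorem cnorm_X_mul (P : ℝ[X]) : cnorm (X * P) = cnorm P := by
  have h1 : P.support ⊆ Finset.range (P.natDegree + 1) := supp_subset_range (Nat.lt_succ_self _)
  have h2 : (X * P).support ⊆ Finset.range (P.natDegree + 2) :=
    supp_subset_range (by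
      have := natDegree_mul_le (p := (X : ℝ[X])) (q := P)
      have := natDegree_X_le (R := ℝ)
      omega)
  rw [cnorm_eq h1, cnorm_eq h2, Finset.sum_range_succ']
  simp [coeff_X_mul]

theorem cnorm_C (a : ℝ) : cnorm (C a) = |a| := by
  rw [cnorm_eq (s := {0}) (support_C_subset a)]
  simp

theorem cnorm_zero : cnorm 0 = 0 := by simp [cnorm]

theorem abs_aeval_le_cnorm (P : ℝ[X]) {z : ℂ} (hz : ‖z‖ ≤ 1) : ‖aeval z P‖ ≤ cnorm P := by
  rw [aeval_eq_sum_range, cnorm_eq (supp_subset_range (Nat.lt_succ_self _))]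
  refine (norm_sum_le _ _).trans (Finset.sum_le_sum fun i _ => ?_)
  rw [norm_smul, norm_pow, Real.norm_eq_abs]
  exact mul_le_of_le_one_right (abs_nonneg _) (pow_le_one₀ (norm_nonneg _) hz)

/-! ### The polynomials attached to a list of angles -/

/-- The first column of `R(φ₀) D R(φ₁) D ⋯`, where `R(φ)` is the rotation by `φ` and
`D = diag(1, X)`. -/
def colPoly : List ℝ → ℝ[X] × ℝ[X]
  | [] => (1, 0)
  | φ :: l =>
    (C (Real.cos φ) * (colPoly l).1 - C (Real.sin φ) * (X * (colPoly l).2),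
      C (Real.sin φ) * (colPoly l).1 + C (Real.cos φ) * (X * (colPoly l).2))

/-- The derivative of `colPoly` at the angles `φ` in the direction `v`, for a list of pairs
`(φ, v)`. -/
def dcolPoly : List (ℝ × ℝ) → ℝ[X] × ℝ[X]
  | [] => (0, 0)
  | (φ, v) :: l =>
    (C (Real.cos φ) * (dcolPoly l).1 - C (Real.sin φ) * (X * (dcolPoly l).2) -
        C v * (C (Real.sin φ) * (colPoly (l.map Prod.fst)).1 +
          C (Real.cos φ) * (X * (colPoly (l.map Prod.fst)).2)),
      C (Real.sin φ) * (dcolPoly l).1 + C (Real.cos φ) * (X * (dcolPoly l).2) +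
        C v * (C (Real.cos φ) * (colPoly (l.map Prod.fst)).1 -
          C (Real.sin φ) * (X * (colPoly (l.map Prod.fst)).2)))

/-- The polynomial with the given list of coefficients. -/
def linPoly : List ℝ → ℝ[X]
  | [] => 0
  | φ :: l => C φ + X * linPoly l

/-- The sum of the absolute values. -/
def absSum (l : List ℝ) : ℝ := (l.map fun a => |a|).sum

@[simp] theorem absSum_nil : absSum [] = 0 := rfl
@[simp] theorem absSum_cons (a : ℝ) (l : List ℝ) : absSum (a :: l) = |a| + absSum l := rfl
theorem absSum_append (l l' : List ℝ) : absSum (l ++ l') = absSum l + absSum l' := by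
  simp [absSum]

theorem coeff_linPoly (l : List ℝ) (i : ℕ) : (linPoly l).coeff i = l.getD i 0 := by
  induction l generalizing i with
  | nil => simp [linPoly]
  | cons a l ih => cases i <;> simp [linPoly, coeff_X_mul, coeff_C, ih]

theorem cnorm_linPoly_le (l : List ℝ) : cnorm (linPoly l) ≤ absSum l := by
  induction l with
  | nil => simp [linPoly, cnorm_zero]
  | cons a l ih =>
    refine (cnorm_add_le _ _).trans ?_
    rw [cnorm_C, cnorm_X_mul, absSum_cons]
    linarith

/-- The product rule along the recursion. Working coefficient by coefficient avoids a topology on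
polynomials. -/
theorem hasDerivAt_colPoly (l : List (ℝ × ℝ)) (t : ℝ) (k : ℕ) :
    HasDerivAt (fun t => (colPoly (l.map fun q => q.1 + t * q.2)).1.coeff k)
      ((dcolPoly (l.map fun q => (q.1 + t * q.2, q.2))).1.coeff k) t ∧
    HasDerivAt (fun t => (colPoly (l.map fun q => q.1 + t * q.2)).2.coeff k)
      ((dcolPoly (l.map fun q => (q.1 + t * q.2, q.2))).2.coeff k) t := by
  induction l generalizing k with
  | nil => simpa [colPoly, dcolPoly] using ⟨hasDerivAt_const t _, hasDerivAt_const t _⟩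
  | cons q l ih =>
    have hX : HasDerivAt (fun t => (X * (colPoly (l.map fun q : ℝ × ℝ => q.1 + t * q.2)).2).coeff k)
        ((X * (dcolPoly (l.map fun q : ℝ × ℝ => (q.1 + t * q.2, q.2))).2).coeff k) t := by
      cases k with
      | zero => simpa using hasDerivAt_const t (0 : ℝ)
      | succ k => simpa [coeff_X_mul] using (ih k).2
    have ha : HasDerivAt (fun t : ℝ => q.1 + t * q.2) q.2 t := by
      simpa using ((hasDerivAt_id t).mul_const q.2).const_add q.1
    have hc := ha.cos
    have hs := ha.sin
    have hm : (l.map fun q => (q.1 + t * q.2, q.2)).map Prod.fst =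
        l.map fun q => q.1 + t * q.2 := by simp [Function.comp_def]
    constructor
    · simp only [List.map_cons, colPoly, dcolPoly, hm, coeff_sub, coeff_add, coeff_C_mul]
      exact ((hc.mul (ih k).1).sub (hs.mul hX)).congr_deriv (by ring)
    · simp only [List.map_cons, colPoly, dcolPoly, hm, coeff_sub, coeff_add, coeff_C_mul]
      exact ((hs.mul (ih k).1).add (hc.mul hX)).congr_deriv (by ring)

/-! ### Majorants -/

theorem cnorm_neg (P : ℝ[X]) : cnorm (-P) = cnorm P := by simp [cnorm]

theorem cnorm_sub_le (P Q : ℝ[X]) : cnorm (P - Q) ≤ cnorm P + cnorm Q := by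
  rw [sub_eq_add_neg]
  simpa [cnorm_neg] using cnorm_add_le P (-Q)

theorem cnorm_le_add (P Q : ℝ[X]) : cnorm P ≤ cnorm (P - Q) + cnorm Q := by
  simpa using cnorm_add_le (P - Q) Q

/-- The majorant of `colPoly` around its constant and linear part. -/
structure Majorized (γ σ x : ℝ) (T : ℝ[X]) (P : ℝ[X] × ℝ[X]) : Prop where
  nonneg : 0 ≤ x
  target : cnorm T ≤ |σ| + |γ| * x
  fst : cnorm (P.1 - C γ) ≤ |γ| * (Real.cosh x - 1) + |σ| * Real.sinh x
  snd : cnorm (P.2 - T) ≤ |γ| * (Real.sinh x - x) + |σ| * (Real.cosh x - 1)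

theorem Majorized.norm_fst {γ σ x : ℝ} {T : ℝ[X]} {P : ℝ[X] × ℝ[X]} (h : Majorized γ σ x T P) :
    cnorm P.1 ≤ |γ| * Real.cosh x + |σ| * Real.sinh x := by
  have h1 := cnorm_le_add P.1 (C γ)
  rw [cnorm_C] at h1
  linarith [h.fst]

theorem Majorized.norm_snd {γ σ x : ℝ} {T : ℝ[X]} {P : ℝ[X] × ℝ[X]} (h : Majorized γ σ x T P) :
    cnorm P.2 ≤ |γ| * Real.sinh x + |σ| * Real.cosh x := by
  have h1 := cnorm_le_add P.2 T
  linarith [h.snd, h.target]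

/-- Once the constant and linear parts are split off, the triangle inequality yields precisely the
terms of the addition formulas for `cosh (|φ| + x)` and `sinh (|φ| + x)`. -/
theorem Majorized.cons {γ σ x : ℝ} {T : ℝ[X]} {l : List ℝ} (h : Majorized γ σ x T (colPoly l))
    (φ : ℝ) : Majorized γ σ (|φ| + x) (C (γ * φ) + X * T) (colPoly (φ :: l)) := by
  have hs := abs_sin_le_sinh φ
  have hc := abs_cos_le_cosh φ
  have hc1 := abs_cos_sub_one_le φ
  have hs1 := abs_sin_sub_le φ
  have hsx : 0 ≤ Real.sinh x := Real.sinh_nonneg_iff.2 h.nonneg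
  have hcx := Real.one_le_cosh x
  have hφ := Real.one_le_cosh |φ|
  have hφs := (abs_nonneg _).trans hs
  have hγ := abs_nonneg γ
  have hσ := abs_nonneg σ
  have hx1 : x ≤ Real.sinh x := Real.self_le_sinh_iff.2 h.nonneg
  refine ⟨by have := h.nonneg; positivity, ?_, ?_, ?_⟩
  · refine (cnorm_add_le _ _).trans ?_
    rw [cnorm_C, cnorm_X_mul, abs_mul]
    nlinarith [h.target]
  · have e : (colPoly (φ :: l)).1 - C γ = C (Real.cos φ) * ((colPoly l).1 - C γ) +
        C (γ * (Real.cos φ - 1)) - C (Real.sin φ) * (X * (colPoly l).2) := by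
      simp only [colPoly, map_sub, map_mul, map_one]; ring
    rw [e]
    refine (cnorm_sub_le _ _).trans ((add_le_add_left (cnorm_add_le _ _) _).trans ?_)
    rw [cnorm_C_mul, cnorm_C_mul, cnorm_X_mul, cnorm_C, abs_mul, Real.cosh_add, Real.sinh_add]
    have h1 := mul_le_mul hc h.fst (cnorm_nonneg _) (by linarith)
    have h2 := mul_le_mul hs h.norm_snd (cnorm_nonneg _) hφs
    have h3 := mul_le_mul_of_nonneg_left hc1 hγ
    linarith
  · have e : (colPoly (φ :: l)).2 - (C (γ * φ) + X * T) =
        C (Real.sin φ) * ((colPoly l).1 - C γ) + C (γ * (Real.sin φ - φ)) +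
          (C (Real.cos φ) * (X * ((colPoly l).2 - T)) + C (Real.cos φ - 1) * (X * T)) := by
      simp only [colPoly, map_sub, map_mul, map_one]; ring
    rw [e]
    refine (cnorm_add_le _ _).trans ((add_le_add (cnorm_add_le _ _) (cnorm_add_le _ _)).trans ?_)
    rw [cnorm_C_mul, cnorm_C_mul, cnorm_C_mul, cnorm_X_mul, cnorm_X_mul, cnorm_C, abs_mul,
      Real.cosh_add, Real.sinh_add]
    have h1 := mul_le_mul hs h.fst (cnorm_nonneg _) hφs
    have h2 := mul_le_mul hc h.snd (cnorm_nonneg _) (by linarith)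
    have h3 := mul_le_mul_of_nonneg_left hs1 hγ
    have h4 := mul_le_mul hc1 h.target (cnorm_nonneg _) (by linarith)
    linarith

/-- The middle angle need not be small, so its sine and cosine are not majorized but become the
weights `σ` and `γ`, which are `0` and `1` to the right of it. -/
theorem Majorized.center {x : ℝ} {T : ℝ[X]} {l : List ℝ} (h : Majorized 1 0 x T (colPoly l))
    (ψ : ℝ) : Majorized (Real.cos ψ) (Real.sin ψ) x
      (C (Real.sin ψ) + X * (C (Real.cos ψ) * T)) (colPoly (ψ :: l)) := by
  have hc := abs_nonneg (Real.cos ψ)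
  have hs := abs_nonneg (Real.sin ψ)
  have f := h.fst
  have g := h.snd
  have n1 := h.norm_snd
  have t := h.target
  simp only [abs_one, abs_zero, zero_mul, add_zero, one_mul, zero_add] at f g n1 t
  refine ⟨h.nonneg, ?_, ?_, ?_⟩
  · refine (cnorm_add_le _ _).trans ?_
    rw [cnorm_C, cnorm_X_mul, cnorm_C_mul]
    nlinarith
  · have e : (colPoly (ψ :: l)).1 - C (Real.cos ψ) = C (Real.cos ψ) * ((colPoly l).1 - C 1) -
        C (Real.sin ψ) * (X * (colPoly l).2) := by
      simp only [colPoly, map_one]; ring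
    rw [e]
    refine (cnorm_sub_le _ _).trans ?_
    rw [cnorm_C_mul, cnorm_C_mul, cnorm_X_mul]
    gcongr
  · have e : (colPoly (ψ :: l)).2 - (C (Real.sin ψ) + X * (C (Real.cos ψ) * T)) =
        C (Real.sin ψ) * ((colPoly l).1 - C 1) + C (Real.cos ψ) * (X * ((colPoly l).2 - T)) := by
      simp only [colPoly, map_one]; ring
    rw [e]
    refine (cnorm_add_le _ _).trans ?_
    rw [cnorm_C_mul, cnorm_C_mul, cnorm_X_mul]
    nlinarith

theorem majorized_colPoly (l : List ℝ) : Majorized 1 0 (absSum l) (linPoly l) (colPoly l) := by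
  induction l with
  | nil => constructor <;> simp [linPoly, colPoly, cnorm_zero]
  | cons a l ih => simpa [linPoly] using ih.cons a

/-- Built from the right: the right half with weights `1, 0`, then the middle angle, then the left
half by `Majorized.cons`. -/
theorem majorized_colPoly_center (l r : List ℝ) (ψ : ℝ) :
    Majorized (Real.cos ψ) (Real.sin ψ) (absSum l + absSum r)
      (C (Real.sin ψ) * X ^ l.length + C (Real.cos ψ) * linPoly (l ++ 0 :: r))
      (colPoly (l ++ ψ :: r)) := by
  induction l with
  | nil =>
    convert (majorized_colPoly r).center ψ using 1
    · simp
    · simp [linPoly]; ring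
    · rfl
  | cons a l ih =>
    convert ih.cons a using 1
    · simp [add_assoc]
    · simp [linPoly, pow_succ]; ring
    · rfl

/-- The majorant of `dcolPoly`; `T` is the derivative of the linear part. -/
structure DMajorized (γ σ x v : ℝ) (T : ℝ[X]) (P : ℝ[X] × ℝ[X]) : Prop where
  nonneg : 0 ≤ v
  target : cnorm T ≤ |γ| * v
  fst : cnorm P.1 ≤ v * (|γ| * Real.sinh x + |σ| * Real.cosh x)
  snd : cnorm (P.2 - T) ≤ v * (|γ| * (Real.cosh x - 1) + |σ| * Real.sinh x)

theorem DMajorized.norm_snd {γ σ x v : ℝ} {T : ℝ[X]} {P : ℝ[X] × ℝ[X]}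
    (h : DMajorized γ σ x v T P) :
    cnorm P.2 ≤ v * (|γ| * Real.cosh x + |σ| * Real.sinh x) := by
  have h1 := cnorm_le_add P.2 T
  linarith [h.snd, h.target]

/-- The bounds are `v` times the `x`-derivatives of those in `Majorized`. Differentiating the new
rotation gives the column of `colPoly` turned by a right angle, so the bounds of `Majorized.cons`
enter with weight `|w|`. -/
theorem DMajorized.cons {γ σ x v : ℝ} {T T' : ℝ[X]} {l : List (ℝ × ℝ)}
    (h : Majorized γ σ x T (colPoly (l.map Prod.fst))) (h' : DMajorized γ σ x v T' (dcolPoly l))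
    (φ w : ℝ) : DMajorized γ σ (|φ| + x) (|w| + v) (C (γ * w) + X * T')
      (dcolPoly ((φ, w) :: l)) := by
  have hs := abs_sin_le_sinh φ
  have hc := abs_cos_le_cosh φ
  have hc1 := abs_cos_sub_one_le φ
  have hφ := Real.one_le_cosh |φ|
  have hφs := (abs_nonneg _).trans hs
  have hγ := abs_nonneg γ
  have hw := abs_nonneg w
  have hv := h'.nonneg
  have hN := (h.cons φ).fst
  have hN1 := (h.cons φ).norm_fst
  have hN2 := (h.cons φ).norm_snd
  refine ⟨by positivity, ?_, ?_, ?_⟩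
  · refine (cnorm_add_le _ _).trans ?_
    rw [cnorm_C, cnorm_X_mul, abs_mul]
    linarith [h'.target]
  · have e : (dcolPoly ((φ, w) :: l)).1 = C (Real.cos φ) * (dcolPoly l).1 -
        C (Real.sin φ) * (X * (dcolPoly l).2) -
        C w * (colPoly (φ :: l.map Prod.fst)).2 := rfl
    rw [e]
    refine (cnorm_sub_le _ _).trans ((add_le_add_left (cnorm_sub_le _ _) _).trans ?_)
    rw [cnorm_C_mul, cnorm_C_mul, cnorm_C_mul, cnorm_X_mul]
    have h1 := mul_le_mul hc h'.fst (cnorm_nonneg _) (by linarith)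
    have h2 := mul_le_mul hs h'.norm_snd (cnorm_nonneg _) hφs
    have h3 := mul_le_mul_of_nonneg_left hN2 hw
    rw [Real.cosh_add, Real.sinh_add] at *
    linarith
  · have e : (dcolPoly ((φ, w) :: l)).2 - (C (γ * w) + X * T') =
        C (Real.sin φ) * (dcolPoly l).1 + C (Real.cos φ) * (X * ((dcolPoly l).2 - T')) +
        C (Real.cos φ - 1) * (X * T') + C w * ((colPoly (φ :: l.map Prod.fst)).1 - C γ) := by
      simp only [colPoly, dcolPoly, map_sub, map_mul, map_one]; ring
    rw [e]
    refine (cnorm_add_le _ _).trans ((add_le_add_left ((cnorm_add_le _ _).trans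
      (add_le_add_left (cnorm_add_le _ _) _)) _).trans ?_)
    rw [cnorm_C_mul, cnorm_C_mul, cnorm_C_mul, cnorm_C_mul, cnorm_X_mul, cnorm_X_mul]
    have h1 := mul_le_mul hs h'.fst (cnorm_nonneg _) hφs
    have h2 := mul_le_mul hc h'.snd (cnorm_nonneg _) (by linarith)
    have h3 := mul_le_mul_of_nonneg_left hN hw
    have h4 := mul_le_mul hc1 h'.target (cnorm_nonneg _) (by linarith)
    rw [Real.cosh_add, Real.sinh_add] at *
    linarith

theorem dmajorized_dcolPoly (l : List (ℝ × ℝ)) :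
    DMajorized 1 0 (absSum (l.map Prod.fst)) (absSum (l.map Prod.snd))
      (linPoly (l.map Prod.snd)) (dcolPoly l) := by
  induction l with
  | nil => constructor <;> simp [linPoly, dcolPoly, cnorm_zero]
  | cons a l ih => simpa [linPoly] using ih.cons (majorized_colPoly (l.map Prod.fst)) a.1 a.2

theorem dmajorized_dcolPoly_center (l r : List (ℝ × ℝ)) (ψ : ℝ) :
    DMajorized (Real.cos ψ) (Real.sin ψ) (absSum (l.map Prod.fst) + absSum (r.map Prod.fst))
      (absSum (l.map Prod.snd) + absSum (r.map Prod.snd))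
      (C (Real.cos ψ) * linPoly (l.map Prod.snd ++ 0 :: r.map Prod.snd))
      (dcolPoly (l ++ (ψ, 0) :: r)) := by
  induction l with
  | nil =>
    have h := dmajorized_dcolPoly r
    have f := h.fst
    have g := h.snd
    have n1 := h.norm_snd
    have t := h.target
    simp only [abs_one, abs_zero, zero_mul, add_zero, one_mul] at f g n1 t
    have hc := abs_nonneg (Real.cos ψ)
    have hs := abs_nonneg (Real.sin ψ)
    simp only [List.map_nil, absSum_nil, zero_add, List.nil_append]
    refine ⟨h.nonneg, ?_, ?_, ?_⟩
    · simp only [linPoly, map_zero, zero_add]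
      rw [cnorm_C_mul, cnorm_X_mul]
      gcongr
    · simp only [dcolPoly, map_zero, zero_mul, sub_zero]
      refine (cnorm_sub_le _ _).trans ?_
      rw [cnorm_C_mul, cnorm_C_mul, cnorm_X_mul]
      nlinarith
    · have e : (dcolPoly ((ψ, 0) :: r)).2 - C (Real.cos ψ) * linPoly (0 :: r.map Prod.snd) =
          C (Real.sin ψ) * (dcolPoly r).1 +
            C (Real.cos ψ) * (X * ((dcolPoly r).2 - linPoly (r.map Prod.snd))) := by
        simp only [dcolPoly, linPoly, map_zero]; ring
      rw [e]
      refine (cnorm_add_le _ _).trans ?_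
      rw [cnorm_C_mul, cnorm_C_mul, cnorm_X_mul]
      nlinarith
  | cons a l ih =>
    have h := majorized_colPoly_center (l.map Prod.fst) (r.map Prod.fst) ψ
    convert ih.cons (T := _) (by simpa using h) a.1 a.2 using 1
    · simp [add_assoc]
    · simp [add_assoc]
    · simp [linPoly]; ring
    · rfl

/-- Differentiating a rotation advances its angle by `π / 2`. The derivative in the middle angle is
therefore another `colPoly`, already covered by `majorized_colPoly_center`. -/
theorem dcolPoly_center (l r : List (ℝ × ℝ)) (ψ v : ℝ) :
    dcolPoly (l ++ (ψ, v) :: r) = dcolPoly (l ++ (ψ, 0) :: r) +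
      (C v * (colPoly (l.map Prod.fst ++ (ψ + Real.pi / 2) :: r.map Prod.fst)).1,
        C v * (colPoly (l.map Prod.fst ++ (ψ + Real.pi / 2) :: r.map Prod.fst)).2) := by
  induction l with
  | nil =>
    ext1 <;>
    · simp only [List.nil_append, List.map_nil, dcolPoly, colPoly, Real.cos_add_pi_div_two,
        Real.sin_add_pi_div_two, map_neg, map_zero, Prod.fst_add, Prod.snd_add]
      ring
  | cons a l ih =>
    obtain ⟨φ, w⟩ := a
    have e : (l ++ (ψ, v) :: r).map Prod.fst = (l ++ (ψ, 0) :: r).map Prod.fst := by simp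
    ext1 <;>
    · simp only [List.cons_append, List.map_cons, dcolPoly, colPoly, ih, e, Prod.fst_add,
        Prod.snd_add]
      ring

/-! ### The matrices of quantum signal processing in terms of `colPoly` -/

theorem coeff_colPoly_eq_zero (l : List ℝ) (k : ℕ) (hk : l.length ≤ k) :
    (1 ≤ k → (colPoly l).1.coeff k = 0) ∧ (colPoly l).2.coeff k = 0 := by
  induction l generalizing k with
  | nil => exact ⟨fun h => by simp [colPoly, coeff_one]; omega, by simp [colPoly]⟩
  | cons a l ih =>
    obtain ⟨k, rfl⟩ : ∃ j, k = j + 1 := ⟨k - 1, by simp at hk; omega⟩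
    simp only [List.length_cons, add_le_add_iff_right] at hk
    have h1 := (ih (k + 1) (by omega)).1 (by omega)
    have h2 := (ih k hk).2
    simp [colPoly, coeff_X_mul, h1, h2]

/-- The matrix with parameters `α`, `β` and their conjugates in the Hadamard basis. -/
def hadamard (α α' β β' : ℂ) : Matrix (Fin 2) (Fin 2) ℂ :=
  !![(α + α' + Complex.I * (β + β')) / 2, (α - α' + Complex.I * (β - β')) / 2;
     (α - α' - Complex.I * (β - β')) / 2, (α + α' - Complex.I * (β + β')) / 2]

/-- In the Hadamard basis `Wang θ` is `diag(w, w')`. Factoring `w` out of it leaves `diag(1, w' ^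
2)`, which is why the polynomials are evaluated at `w' ^ 2` and multiplied by `w ^ n`. -/
theorem Uang_eq {n : ℕ} (θ : ℝ) (Φ : Fin (n + 1) → ℝ) (w w' : ℂ)
    (hw : w = Complex.exp (Complex.I * θ)) (hw' : w' = Complex.exp (-(Complex.I * θ))) :
    Uang θ Φ = hadamard (w ^ n * aeval (w' ^ 2) (colPoly (List.ofFn Φ)).1)
      (w' ^ n * aeval (w ^ 2) (colPoly (List.ofFn Φ)).1)
      (w ^ n * aeval (w' ^ 2) (colPoly (List.ofFn Φ)).2)
      (w' ^ n * aeval (w ^ 2) (colPoly (List.ofFn Φ)).2) := by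
  have hww : w * w' = 1 := by rw [hw, hw', ← Complex.exp_add]; simp
  have hcos : ∀ φ : ℝ, ((Real.cos φ : ℝ) : ℂ) =
      (Complex.exp (Complex.I * φ) + Complex.exp (-(Complex.I * φ))) / 2 := by
    intro φ; rw [Complex.ofReal_cos, Complex.cos]; ring_nf
  have hsin : ∀ φ : ℝ, ((Real.sin φ : ℝ) : ℂ) =
      -Complex.I * (Complex.exp (Complex.I * φ) - Complex.exp (-(Complex.I * φ))) / 2 := by
    intro φ; rw [Complex.ofReal_sin, Complex.sin]; ring_nf
  have hI : Complex.I ^ 2 = -1 := Complex.I_sq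
  induction n with
  | zero =>
    simp only [Uang, List.ofFn_zero, List.prod_nil, mul_one, List.ofFn_succ, colPoly, aeval_C,
      mul_zero, sub_zero, add_zero, pow_zero, one_mul, Complex.coe_algebraMap, hcos, hsin, hadamard, expZ]
    ext i j
    fin_cases i <;> fin_cases j <;> simp <;> ring_nf <;> simp only [hI] <;> ring
  | succ n ih =>
    rw [Uang_succ, ih]
    have hW : Wang θ = !![(w + w') / 2, (w - w') / 2; (w - w') / 2, (w + w') / 2] := by
      rw [hw, hw', Wang, Complex.cos, Complex.sin]
      ext i j
      fin_cases i <;> fin_cases j <;> simp <;> ring_nf <;> simp only [hI] <;> ring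
    rw [hW, List.ofFn_succ (f := Φ)]
    simp only [colPoly, map_sub, map_add, map_mul, aeval_C, aeval_X, Complex.coe_algebraMap,
      hcos, hsin, hadamard, expZ]
    generalize Complex.exp (Complex.I * (Φ 0 : ℝ)) = e
    generalize Complex.exp (-(Complex.I * (Φ 0 : ℝ))) = e'
    generalize aeval (w' ^ 2) (colPoly (List.ofFn fun j : Fin (n + 1) => Φ j.succ)).1 = a
    generalize aeval (w ^ 2) (colPoly (List.ofFn fun j : Fin (n + 1) => Φ j.succ)).1 = a'
    generalize aeval (w' ^ 2) (colPoly (List.ofFn fun j : Fin (n + 1) => Φ j.succ)).2 = b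
    generalize aeval (w ^ 2) (colPoly (List.ofFn fun j : Fin (n + 1) => Φ j.succ)).2 = b'
    have e1 : ∀ x : ℂ, w ^ (n + 1) * (w' ^ 2 * x) = w' * (w ^ n * x) := fun x => by
      linear_combination (w ^ n * w' * x) * hww
    have e2 : ∀ x : ℂ, w' ^ (n + 1) * (w ^ 2 * x) = w * (w' ^ n * x) := fun x => by
      linear_combination (w' ^ n * w * x) * hww
    have f1 : ∀ x y u v : ℂ, w ^ (n + 1) * (x * u + y * (w' ^ 2 * v)) =
        x * (w * (w ^ n * u)) + y * (w' * (w ^ n * v)) := fun x y u v => by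
      linear_combination y * e1 v
    have f2 : ∀ x y u v : ℂ, w' ^ (n + 1) * (x * u + y * (w ^ 2 * v)) =
        x * (w' * (w' ^ n * u)) + y * (w * (w' ^ n * v)) := fun x y u v => by
      linear_combination y * e2 v
    have g1 : ∀ x y u v : ℂ, w ^ (n + 1) * (x * u - y * (w' ^ 2 * v)) =
        x * (w * (w ^ n * u)) - y * (w' * (w ^ n * v)) := fun x y u v => by
      linear_combination -y * e1 v
    have g2 : ∀ x y u v : ℂ, w' ^ (n + 1) * (x * u - y * (w ^ 2 * v)) =
        x * (w' * (w' ^ n * u)) - y * (w * (w' ^ n * v)) := fun x y u v => by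
      linear_combination -y * e2 v
    simp only [f1, f2, g1, g2]
    ext i j
    fin_cases i <;> fin_cases j <;> simp [Matrix.mul_apply, Fin.sum_univ_two] <;> ring_nf <;>
      simp only [hI] <;> ring

theorem aeval_conj (P : ℝ[X]) (z : ℂ) :
    aeval ((starRingEnd ℂ) z) P = (starRingEnd ℂ) (aeval z P) := by
  simp only [aeval_eq_sum_range, map_sum, Complex.real_smul, map_mul, map_pow, Complex.conj_ofReal]

/-- For real coefficients the primed parameters of `hadamard` are the conjugates of the unprimed
ones, so the first polynomial contributes only to the real part. -/
theorem Uang_zero_zero_im {n : ℕ} (θ : ℝ) (Φ : Fin (n + 1) → ℝ) :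
    (Uang θ Φ 0 0).im = (Complex.exp (Complex.I * θ) ^ n *
      aeval (Complex.exp (-(Complex.I * θ)) ^ 2) (colPoly (List.ofFn Φ)).2).re := by
  set w := Complex.exp (Complex.I * θ) with hw
  have hw' : Complex.exp (-(Complex.I * θ)) = (starRingEnd ℂ) w := by
    rw [hw, ← Complex.exp_conj]; simp
  rw [Uang_eq θ Φ w _ hw rfl, hw']
  simp only [hadamard, ← map_pow, aeval_conj]
  have : ∀ P : ℝ[X], (starRingEnd ℂ) (w ^ n) * aeval (w ^ 2) P =
      (starRingEnd ℂ) (w ^ n * (starRingEnd ℂ) (aeval (w ^ 2) P)) := by intro P; simp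
  simp only [this, Matrix.of_apply, Matrix.cons_val_zero, Matrix.cons_val', Complex.add_conj]
  simp [Complex.add_im, Complex.mul_im]

/-- The Chebyshev coefficients of `Re (w^{2d} P(w⁻²))`. -/
def foldCoeff (d : ℕ) (P : ℝ[X]) (j : ℕ) : ℝ :=
  if j = 0 then P.coeff d else P.coeff (d - j) + P.coeff (d + j)

/-- The map `k ↦ |k - d|` on `{0, …, 2d}` is two-to-one except over `0`, hence the separate case. -/
theorem sum_fold (d : ℕ) (a c : ℕ → ℝ) :
    ∑ k ∈ Finset.range (2 * d + 1), a k * c ((k : ℤ) - d).natAbs =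
      ∑ j ∈ Finset.range (d + 1), (if j = 0 then a d else a (d - j) + a (d + j)) * c j := by
  rw [show 2 * d + 1 = d + (d + 1) by ring, Finset.sum_range_add, Finset.sum_range_succ',
    Finset.sum_range_succ' _ d, ← Finset.sum_range_reflect, ← add_assoc, ← Finset.sum_add_distrib]
  congr 1
  · refine Finset.sum_congr rfl fun j hj => ?_
    rw [Finset.mem_range] at hj
    rw [if_neg (by omega), show ((d - 1 - j : ℕ) - (d : ℤ)).natAbs = j + 1 by omega,
      show ((d + (j + 1) : ℕ) - (d : ℤ)).natAbs = j + 1 by omega,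
      show d - 1 - j = d - (j + 1) by omega]
    ring
  · simp

theorem exp_pow_mul_aeval_re (d : ℕ) (θ : ℝ) (P : ℝ[X]) (hP : ∀ k, 2 * d + 1 ≤ k → P.coeff k = 0) :
    (Complex.exp (Complex.I * θ) ^ (2 * d) * aeval (Complex.exp (-(Complex.I * θ)) ^ 2) P).re =
      ∑ j ∈ Finset.range (d + 1), foldCoeff d P j * Real.cos (2 * j * θ) := by
  have h1 : aeval (Complex.exp (-(Complex.I * θ)) ^ 2) P =
      ∑ k ∈ Finset.range (2 * d + 1), P.coeff k • (Complex.exp (-(Complex.I * θ)) ^ 2) ^ k := by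
    rw [aeval_eq_sum_range' (n := 2 * d + 1)]
    by_contra h
    have h2 : 2 * d + 1 ≤ P.natDegree := by omega
    have h3 := hP _ h2
    rw [coeff_natDegree, leadingCoeff_eq_zero] at h3
    simp [h3] at h2
  have h2 := sum_fold d (fun k => P.coeff k) (fun j => Real.cos (2 * j * θ))
  simp only [foldCoeff] at *
  rw [← h2, h1, Finset.mul_sum, Complex.re_sum]
  refine Finset.sum_congr rfl fun k _ => ?_
  have e : Complex.exp (Complex.I * θ) ^ (2 * d) * (Complex.exp (-(Complex.I * θ)) ^ 2) ^ k =
      Complex.exp (((2 * ((d : ℝ) - k) * θ : ℝ) : ℂ) * Complex.I) := by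
    rw [← pow_mul, ← Complex.exp_nat_mul, ← Complex.exp_nat_mul, ← Complex.exp_add]
    congr 1; push_cast; ring
  rw [Complex.real_smul, mul_left_comm, e, Complex.re_ofReal_mul, Complex.exp_ofReal_mul_I_re]
  congr 1
  have : ((((k : ℤ) - d).natAbs : ℕ) : ℝ) = |(k : ℝ) - d| := by
    rw [Nat.cast_natAbs]; push_cast; rfl
  rw [this]
  rcases abs_choice ((k : ℝ) - d) with h | h <;> rw [h]
  · rw [← Real.cos_neg]; ring_nf
  · ring_nf

theorem eval_chebSum_cos {d : ℕ} (q : Fin (d + 1) → ℝ) (θ : ℝ) :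
    (chebSum q).eval (Real.cos θ) = ∑ j : Fin (d + 1), q j * Real.cos (2 * (j : ℕ) * θ) := by
  rw [chebSum, eval_finsetSum]
  refine Finset.sum_congr rfl fun j _ => ?_
  rw [eval_mul, eval_C, Polynomial.Chebyshev.T_real_cos]
  push_cast; rfl

theorem U_eq_Uang {n : ℕ} {x : ℝ} (hx : x ∈ Set.Icc (-1 : ℝ) 1) (Φ : Fin (n + 1) → ℝ) :
    U x Φ = Uang (Real.arccos x) Φ := by simp [U, Uang, W_arccos hx]

theorem g_eq_chebSum {d : ℕ} (Φ : Fin (2 * d + 1) → ℝ) {x : ℝ} (hx : x ∈ Set.Icc (-1 : ℝ) 1) :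
    g x Φ = (chebSum fun j : Fin (d + 1) =>
      foldCoeff d (colPoly (List.ofFn Φ)).2 j).eval x := by
  conv_rhs => rw [← Real.cos_arccos hx.1 hx.2]
  rw [eval_chebSum_cos, g, U_eq_Uang hx, Uang_zero_zero_im, exp_pow_mul_aeval_re,
    ← Fin.sum_univ_eq_sum_range (fun j => foldCoeff d (colPoly (List.ofFn Φ)).2 j *
      Real.cos (2 * j * Real.arccos x))]
  intro k hk
  exact (coeff_colPoly_eq_zero _ _ (by simpa using hk)).2

theorem chebyshev_linearIndependent :
    LinearIndependent ℝ fun n : ℕ => Polynomial.Chebyshev.T ℝ (n : ℤ) :=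
  Polynomial.Sequence.linearIndependent
    { elems' := fun n : ℕ => Polynomial.Chebyshev.T ℝ (n : ℤ)
      degree_eq' := fun n => by simp [Polynomial.Chebyshev.degree_T] }

theorem chebSum_injective {d : ℕ} : Function.Injective (chebSum (d := d)) := by
  have h := chebyshev_linearIndependent.comp (fun j : Fin (d + 1) => 2 * (j : ℕ))
    (fun i j hij => Fin.ext (by simpa using hij))
  rw [Fintype.linearIndependent_iff] at h
  intro q q' hq
  rw [← sub_eq_zero] at hq
  funext j
  have := h (q - q') (by
    rw [← hq, chebSum, chebSum, ← Finset.sum_sub_distrib]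
    refine Finset.sum_congr rfl fun i _ => ?_
    simp only [Function.comp, Pi.sub_apply, smul_eq_C_mul, C_sub]
    push_cast
    ring) j
  simpa [sub_eq_zero] using this

theorem eq_of_eval_Icc {p q : ℝ[X]} (h : ∀ x ∈ Set.Icc (-1 : ℝ) 1, p.eval x = q.eval x) :
    p = q :=
  Polynomial.eq_of_infinite_eval_eq p q
    ((Set.Icc_infinite (by norm_num : (-1 : ℝ) < 1)).mono fun x hx => h x hx)

/-- `F` is defined by choice; the linear independence of the Chebyshev polynomials identifies what
was chosen. -/
theorem F_eq {d : ℕ} (Ψ : Fin (d + 1) → ℝ) (j : Fin (d + 1)) :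
    F Ψ j = foldCoeff d (colPoly (List.ofFn (full Ψ))).2 j := by
  have h := Classical.choose_spec (exists_chebSum (full Ψ))
  have : chebSum (F Ψ) = chebSum fun j : Fin (d + 1) =>
      foldCoeff d (colPoly (List.ofFn (full Ψ))).2 j :=
    eq_of_eval_Icc fun x hx => by rw [← g_eq_chebSum _ hx]; exact (h x hx).symm
  exact congrFun (chebSum_injective this) j

theorem g_full_eq {d : ℕ} (Ψ : Fin (d + 1) → ℝ) {x : ℝ} (hx : x ∈ Set.Icc (-1 : ℝ) 1) :
    g x (full Ψ) = (chebSum (F Ψ)).eval x :=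
  Classical.choose_spec (exists_chebSum (full Ψ)) x hx

/-! ### The nonlinear Fourier transform -/

/-- On `(-π/2, π/2)` the cosine is positive, so the normalization `(1 + tan²)^{-1/2}` is the cosine
itself, with the right sign. -/
theorem nlft_factor {φ : ℝ} (hφ : |φ| < Real.pi / 2) (z : ℂ) (m : ℤ) :
    ((1 / Real.sqrt (1 + ‖Complex.I * (Real.tan φ : ℂ)‖ ^ 2) : ℝ) : ℂ) •
      !![1, Complex.I * (Real.tan φ : ℂ) * z ^ m;
         -(starRingEnd ℂ) (Complex.I * (Real.tan φ : ℂ)) * z ^ (-m), 1] =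
    !![(Real.cos φ : ℂ), Complex.I * Real.sin φ * z ^ m;
       Complex.I * Real.sin φ * z ^ (-m), (Real.cos φ : ℂ)] := by
  have hc : 0 < Real.cos φ := Real.cos_pos_of_mem_Ioo ⟨by linarith [abs_lt.1 hφ], (abs_lt.1 hφ).2⟩
  have h1 : 1 / Real.sqrt (1 + ‖Complex.I * (Real.tan φ : ℂ)‖ ^ 2) = Real.cos φ := by
    rw [norm_mul, Complex.norm_I, one_mul, Complex.norm_real, Real.norm_eq_abs, sq_abs,
      (Real.sqrt_eq_iff_eq_sq (by positivity) (by positivity)).2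
        (_ : 1 + Real.tan φ ^ 2 = (1 / Real.cos φ) ^ 2)]
    · simp
    · rw [Real.tan_eq_sin_div_cos]
      field_simp
      linarith [Real.sin_sq_add_cos_sq φ]
  have h2 : (Real.cos φ : ℂ) * Real.tan φ = Real.sin φ := by
    rw [← Complex.ofReal_mul, mul_comm, Real.tan_mul_cos hc.ne']
  rw [h1]
  ext i j
  fin_cases i <;> fin_cases j <;> simp [-Complex.ofReal_cos, -Complex.ofReal_tan,
    -Complex.ofReal_sin, ← h2] <;> ring

/-- Successive powers of `z` differ by one factor, and this factor is the matrix `diag(1, z⁻¹)`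
between neighbouring rotations. The general starting exponent `e` is needed for the induction. -/
theorem nlft_prod {n : ℕ} (Φ : Fin n → ℝ) {z : ℂ} (hz : z ≠ 0) (e : ℤ) :
    let M := (List.ofFn fun k : Fin n =>
      (!![(Real.cos (Φ k) : ℂ), Complex.I * Real.sin (Φ k) * z ^ (e + k);
       Complex.I * Real.sin (Φ k) * z ^ (-(e + k)), (Real.cos (Φ k) : ℂ)] :
        Matrix (Fin 2) (Fin 2) ℂ)).prod
    M 0 0 = aeval z⁻¹ (colPoly (List.ofFn Φ)).1 ∧
      M 1 0 = Complex.I * z ^ (-e) * aeval z⁻¹ (colPoly (List.ofFn Φ)).2 := by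
  induction n generalizing e with
  | zero => simp [colPoly]
  | succ n ih =>
    have h := ih (fun k => Φ k.succ) (e + 1)
    have hr : ∀ k : Fin n, e + ((k.succ : Fin (n + 1)) : ℕ) = (e + 1) + (k : ℕ) := by
      intro k; simp; ring
    simp only [List.ofFn_succ, List.prod_cons, Matrix.mul_apply, Fin.sum_univ_two, hr] at h ⊢
    rw [h.1, h.2]
    have hI : Complex.I ^ 2 = -1 := Complex.I_sq
    have e1 : z ^ (e + 0) * z ^ (-(e + 1)) = z⁻¹ := by
      rw [← zpow_add₀ hz, ← zpow_neg_one]; congr 1; ring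
    have e2 : z ^ (-(e + 1)) = z ^ (-e) * z⁻¹ := by
      rw [← zpow_sub_one₀ hz]; congr 1; ring
    constructor
    · simp [colPoly, -Complex.ofReal_cos, -Complex.ofReal_sin]
      simp only [add_zero, neg_add_rev] at e1
      linear_combination (Real.sin (Φ 0) * aeval z⁻¹ (colPoly (List.ofFn fun k => Φ k.succ)).2 : ℂ) *
        (e1 * Complex.I ^ 2 + z⁻¹ * hI)
    · simp [colPoly, -Complex.ofReal_cos, -Complex.ofReal_sin]
      simp only [neg_add_rev] at e2
      rw [e2, zpow_neg]
      ring

theorem nlft_zero_zero {d : ℕ} (Φ : Fin (2 * d + 1) → ℝ) (hΦ : ∀ k, |Φ k| < Real.pi / 2) {z : ℂ}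
    (hz : z ≠ 0) :
    nlft (fun k => Complex.I * (Real.tan (Φ k) : ℂ)) z 0 0 =
      aeval z⁻¹ (colPoly (List.ofFn Φ)).1 := by
  rw [← (nlft_prod Φ hz (-d)).1, nlft]
  have h : ∀ k : Fin (2 * d + 1), (-d : ℤ) + (k : ℕ) = (k : ℤ) - d := fun k => by ring
  simp only [nlft_factor (hΦ _), h]

/-! ### Injectivity -/

theorem normSq_colPoly (l : List ℝ) {z : ℂ} (hz : ‖z‖ = 1) :
    ‖aeval z (colPoly l).1‖ ^ 2 + ‖aeval z (colPoly l).2‖ ^ 2 = 1 := by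
  induction l with
  | nil => simp [colPoly]
  | cons a l ih =>
    have key : ∀ u v : ℂ, ‖(Real.cos a : ℂ) * u - Real.sin a * v‖ ^ 2 +
        ‖(Real.sin a : ℂ) * u + Real.cos a * v‖ ^ 2 = ‖u‖ ^ 2 + ‖v‖ ^ 2 := by
      intro u v
      have h := Real.sin_sq_add_cos_sq a
      simp only [← Complex.normSq_eq_norm_sq, Complex.normSq_apply, Complex.sub_re, Complex.add_re,
        Complex.sub_im, Complex.add_im, Complex.re_ofReal_mul, Complex.im_ofReal_mul]
      linear_combination (u.re ^ 2 + u.im ^ 2 + v.re ^ 2 + v.im ^ 2) * h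
    have h := key (aeval z (colPoly l).1) (z * aeval z (colPoly l).2)
    rw [norm_mul, hz, one_mul, ih] at h
    simpa [colPoly] using h

theorem colPoly_coeff_zero (l : List ℝ) :
    (colPoly l).1.coeff 0 = (l.map Real.cos).prod := by
  induction l with
  | nil => simp [colPoly]
  | cons a l ih => simp [colPoly, ih]

theorem prod_cos_pos {l : List ℝ} (hl : ∀ φ ∈ l, |φ| < Real.pi / 2) :
    0 < (l.map Real.cos).prod := by
  induction l with
  | nil => simp
  | cons a l ih =>
    simp only [List.mem_cons, forall_eq_or_imp] at hl
    rw [List.map_cons, List.prod_cons]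
    exact mul_pos (Real.cos_pos_of_mem_Ioo ⟨by linarith [abs_lt.1 hl.1], (abs_lt.1 hl.1).2⟩)
      (ih hl.2)

/-- Layer stripping: the constant coefficients are `cos a` and `sin a` times the same positive
product, so their ratio gives `tan a` and hence `a`. Rotating back and cancelling `X` leaves the
columns of the tails. -/
theorem colPoly_injective {l l' : List ℝ} (hlen : l.length = l'.length)
    (hl : ∀ φ ∈ l, |φ| < Real.pi / 2) (hl' : ∀ φ ∈ l', |φ| < Real.pi / 2)
    (h : colPoly l = colPoly l') : l = l' := by
  induction l generalizing l' with
  | nil => exact (List.eq_nil_of_length_eq_zero hlen.symm).symm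
  | cons a l ih =>
    cases l' with
    | nil => simp at hlen
    | cons b l' =>
      simp only [List.mem_cons, forall_eq_or_imp] at hl hl'
      have h1 := congrArg Prod.fst h
      have h2 := congrArg Prod.snd h
      simp only [colPoly] at h1 h2
      have c1 := congrArg (fun P : ℝ[X] => P.coeff 0) h1
      have c2 := congrArg (fun P : ℝ[X] => P.coeff 0) h2
      simp only [coeff_sub, coeff_add, coeff_C_mul, coeff_X_mul_zero, mul_zero, sub_zero,
        add_zero, colPoly_coeff_zero] at c1 c2
      have p1 := prod_cos_pos hl.2
      have p2 := prod_cos_pos hl'.2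
      have ca : 0 < Real.cos a :=
        Real.cos_pos_of_mem_Ioo ⟨by linarith [abs_lt.1 hl.1], (abs_lt.1 hl.1).2⟩
      have cb : 0 < Real.cos b :=
        Real.cos_pos_of_mem_Ioo ⟨by linarith [abs_lt.1 hl'.1], (abs_lt.1 hl'.1).2⟩
      have hab : a = b := by
        refine Real.injOn_tan ⟨by linarith [abs_lt.1 hl.1], (abs_lt.1 hl.1).2⟩
          ⟨by linarith [abs_lt.1 hl'.1], (abs_lt.1 hl'.1).2⟩ ?_
        rw [Real.tan_eq_sin_div_cos, Real.tan_eq_sin_div_cos, div_eq_div_iff ca.ne' cb.ne']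
        refine mul_right_cancel₀ (mul_pos p1 p2).ne' ?_
        linear_combination (Real.cos b * (l'.map Real.cos).prod) * c2 -
          (Real.sin b * (l'.map Real.cos).prod) * c1
      subst hab
      have hsc := Real.sin_sq_add_cos_sq a
      have hC : C (Real.sin a) ^ 2 + C (Real.cos a) ^ 2 = (1 : ℝ[X]) := by
        rw [← C_pow, ← C_pow, ← C_add, hsc, C_1]
      have e1 : (colPoly l).1 = (colPoly l').1 := by
        linear_combination C (Real.cos a) * h1 + C (Real.sin a) * h2 -
          ((colPoly l).1 - (colPoly l').1) * hC
      have e2 : X * (colPoly l).2 = X * (colPoly l').2 := by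
        linear_combination -C (Real.sin a) * h1 + C (Real.cos a) * h2 -
          (X * (colPoly l).2 - X * (colPoly l').2) * hC
      rw [ih (by simpa using hlen) hl.2 hl'.2 (Prod.ext e1 (mul_left_cancel₀ X_ne_zero e2))]

/-! ### Symmetric sequences -/

/-- The reduced phase factors `ψ₁, …, ψ_d`. -/
def outer {d : ℕ} (Ψ : Fin (d + 1) → ℝ) : List ℝ := List.ofFn fun j : Fin d => Ψ j.succ

theorem ofFn_full {d : ℕ} (Ψ : Fin (d + 1) → ℝ) :
    List.ofFn (full Ψ) = (outer Ψ).reverse ++ Ψ 0 :: outer Ψ := by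
  refine List.ext_getElem (by simp [outer]; omega) fun i h1 h2 => ?_
  simp only [List.length_ofFn] at h1
  simp only [List.getElem_ofFn, full, List.getElem_append, List.length_reverse, outer,
    List.length_ofFn, List.getElem_reverse, List.getElem_cons]
  split_ifs with h h' <;> congr 1 <;> ext <;> simp <;> omega

theorem reverse_ofFn_full {d : ℕ} (Ψ : Fin (d + 1) → ℝ) :
    (List.ofFn (full Ψ)).reverse = List.ofFn (full Ψ) := by
  rw [ofFn_full]; simp

theorem Uang_mul_Wang {n : ℕ} (θ : ℝ) (Φ : Fin (n + 1) → ℝ) :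
    Uang θ Φ * Wang θ = ((List.ofFn Φ).map fun φ => expZ φ * Wang θ).prod := by
  induction n with
  | zero => simp [Uang, List.ofFn_succ]
  | succ n ih =>
    rw [Uang_succ, List.ofFn_succ, List.map_cons, List.prod_cons, ← ih]
    simp only [mul_assoc]

/-- `Uang θ Φ * Wang θ` is a product of factors `expZ φ * Wang θ` of symmetric matrices.
Transposition reverses it, which a palindromic sequence does not notice, and the invertible `Wang θ`
cancels. -/
theorem transpose_Uang {n : ℕ} (θ : ℝ) (Φ : Fin (n + 1) → ℝ)
    (h : (List.ofFn Φ).reverse = List.ofFn Φ) : (Uang θ Φ).transpose = Uang θ Φ := by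
  have hW : (Wang θ).transpose = Wang θ := by
    ext i j; fin_cases i <;> fin_cases j <;> rfl
  have hE : ∀ φ, (expZ φ).transpose = expZ φ := by
    intro φ; ext i j; fin_cases i <;> fin_cases j <;> rfl
  have hdet : IsUnit (Wang θ) := by
    rw [Matrix.isUnit_iff_isUnit_det, Wang, Matrix.det_fin_two_of]
    have : Complex.cos θ * Complex.cos θ - Complex.I * Complex.sin θ *
        (Complex.I * Complex.sin θ) = 1 := by
      linear_combination Complex.sin_sq_add_cos_sq (θ : ℂ) - Complex.sin θ ^ 2 * Complex.I_sq
    rw [this]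
    exact isUnit_one
  have h1 : ∀ l : List ℝ, Wang θ * (l.map fun φ => expZ φ * Wang θ).prod =
      (l.map fun φ => Wang θ * expZ φ).prod * Wang θ := by
    intro l
    induction l with
    | nil => simp
    | cons a l ih =>
      rw [List.map_cons, List.map_cons, List.prod_cons, List.prod_cons,
        mul_assoc (Wang θ * expZ a), ← ih]
      simp only [mul_assoc]
  have h2 : (Uang θ Φ * Wang θ).transpose =
      ((List.ofFn Φ).map fun φ => Wang θ * expZ φ).prod := by
    rw [Uang_mul_Wang, Matrix.transpose_list_prod, List.map_map, ← List.map_reverse, h]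
    congr 2
    funext φ
    simp [hW, hE]
  have h3 := h1 (List.ofFn Φ)
  rw [← h2, ← Uang_mul_Wang, Matrix.transpose_mul, hW] at h3
  have h4 : Wang θ * Uang θ Φ * Wang θ = Wang θ * (Uang θ Φ).transpose * Wang θ := by
    rw [← h3, mul_assoc]
  exact (hdet.mul_left_cancel (hdet.mul_right_cancel h4)).symm

/-- Equality of the two off-diagonal entries of `hadamard` forces `β = β'`, while `β'` is the
conjugate of `β`. -/
theorem aeval_snd_real {n : ℕ} (θ : ℝ) (Φ : Fin (n + 1) → ℝ)
    (h : (List.ofFn Φ).reverse = List.ofFn Φ) :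
    (Complex.exp (Complex.I * θ) ^ n *
      aeval (Complex.exp (-(Complex.I * θ)) ^ 2) (colPoly (List.ofFn Φ)).2).im = 0 := by
  have ht := transpose_Uang θ Φ h
  set w := Complex.exp (Complex.I * θ) with hw
  have hw' : Complex.exp (-(Complex.I * θ)) = (starRingEnd ℂ) w := by
    rw [hw, ← Complex.exp_conj]; simp
  rw [Uang_eq θ Φ w _ hw rfl] at ht
  have h1 := congrFun (congrFun ht 0) 1
  simp only [hadamard, Matrix.transpose_apply, Matrix.of_apply, Matrix.cons_val', Matrix.cons_val_zero,
    Matrix.cons_val_one, Matrix.cons_val_fin_one] at h1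
  have h2 : w ^ n * aeval (Complex.exp (-(Complex.I * θ)) ^ 2) (colPoly (List.ofFn Φ)).2 =
      Complex.exp (-(Complex.I * θ)) ^ n * aeval (w ^ 2) (colPoly (List.ofFn Φ)).2 :=
    mul_left_cancel₀ Complex.I_ne_zero (by linear_combination -h1)
  rw [← Complex.conj_eq_iff_im]
  conv_rhs => rw [h2]
  simp only [hw', map_mul, ← map_pow, aeval_conj, Complex.conj_conj]

/-- On the unit circle, the second polynomial of a symmetric sequence is determined by the
Chebyshev coefficients. -/
theorem aeval_snd_eq {d : ℕ} (Ψ : Fin (d + 1) → ℝ) (θ : ℝ) :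
    Complex.exp (Complex.I * θ) ^ (2 * d) *
      aeval (Complex.exp (-(Complex.I * θ)) ^ 2) (colPoly (List.ofFn (full Ψ))).2 =
      (((chebSum (F Ψ)).eval (Real.cos θ) : ℝ) : ℂ) := by
  refine Complex.ext ?_ ?_
  · rw [exp_pow_mul_aeval_re, Complex.ofReal_re, eval_chebSum_cos,
      ← Fin.sum_univ_eq_sum_range (fun j => foldCoeff d (colPoly (List.ofFn (full Ψ))).2 j *
      Real.cos (2 * j * θ))]
    · simp only [F_eq]
    · intro k hk
      exact (coeff_colPoly_eq_zero _ _ (by simpa using hk)).2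
  · rw [aeval_snd_real θ _ (reverse_ofFn_full Ψ), Complex.ofReal_im]

theorem exists_exp_sq {z : ℂ} (hz : ‖z‖ = 1) :
    ∃ θ : ℝ, Complex.exp (-(Complex.I * θ)) ^ 2 = z := by
  refine ⟨-(Complex.arg z / 2), ?_⟩
  rw [← Complex.exp_nat_mul]
  have h := Complex.norm_mul_exp_arg_mul_I z
  rw [hz, Complex.ofReal_one, one_mul] at h
  conv_rhs => rw [← h]
  push_cast
  ring_nf

/-- Two polynomials without zeros in the closed unit disc, with equal modulus on the unit circle
and positive value at `0`, are equal. -/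
theorem eq_of_norm_eq_on_sphere {P Q : ℂ[X]} (hP : ∀ z, ‖z‖ ≤ 1 → P.eval z ≠ 0)
    (hQ : ∀ z, ‖z‖ ≤ 1 → Q.eval z ≠ 0) (h : ∀ z, ‖z‖ = 1 → ‖P.eval z‖ = ‖Q.eval z‖)
    {a b : ℝ} (ha : 0 < a) (hb : 0 < b) (hPa : P.eval 0 = a) (hQb : Q.eval 0 = b) : P = Q := by
  have key : ∀ P Q : ℂ[X], (∀ z, ‖z‖ ≤ 1 → Q.eval z ≠ 0) →
      (∀ z, ‖z‖ = 1 → ‖P.eval z‖ = ‖Q.eval z‖) →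
      DiffContOnCl ℂ (fun z => P.eval z / Q.eval z) (Metric.ball 0 1) ∧
      ∀ z, ‖z‖ ≤ 1 → ‖P.eval z / Q.eval z‖ ≤ 1 := by
    intro P Q hQ h
    have hd : DiffContOnCl ℂ (fun z => P.eval z / Q.eval z) (Metric.ball 0 1) := by
      apply DifferentiableOn.diffContOnCl
      rw [closure_ball (0 : ℂ) one_ne_zero]
      exact P.differentiable.differentiableOn.div Q.differentiable.differentiableOn
        fun z hz => hQ z (by simpa using hz)
    refine ⟨hd, fun z hz => ?_⟩
    refine Complex.norm_le_of_forall_mem_frontier_norm_le Metric.isBounded_ball hd ?_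
      (by rw [closure_ball (0 : ℂ) one_ne_zero]; simpa using hz)
    intro w hw
    rw [frontier_ball (0 : ℂ) one_ne_zero, mem_sphere_zero_iff_norm] at hw
    rw [norm_div, h w hw, div_self (norm_ne_zero_iff.2 (hQ w hw.le))]
  obtain ⟨h1, h2⟩ := key P Q hQ h
  obtain ⟨-, h3⟩ := key Q P hP fun z hz => (h z hz).symm
  -- At `0` the two quotients are `a / b` and `b / a`, and both are at most `1`.
  have hab : a = b := by
    have e1 := h2 0 (by simp)
    have e2 := h3 0 (by simp)
    rw [hPa, hQb, norm_div, Complex.norm_real, Complex.norm_real, Real.norm_of_nonneg ha.le,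
      Real.norm_of_nonneg hb.le] at e1 e2
    rw [div_le_one (by assumption)] at e1 e2
    exact le_antisymm e1 e2
  -- The modulus of the quotient reaches its maximum `1` at the centre, so the quotient is constant.
  have hmax : IsMaxOn (norm ∘ fun z => P.eval z / Q.eval z) (Metric.ball (0 : ℂ) 1) 0 := by
    intro z hz
    have : ‖z‖ ≤ 1 := by simpa using (mem_ball_zero_iff.1 hz).le
    simp only [Function.comp, Set.mem_ofPred_eq, hPa, hQb, hab]
    rw [div_self (Complex.ofReal_ne_zero.2 hb.ne'), norm_one]
    exact h2 z this
  have hc := Complex.eqOn_of_isPreconnected_of_isMaxOn_norm (convex_ball (0 : ℂ) 1).isPreconnected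
    Metric.isOpen_ball h1.differentiableOn (Metric.mem_ball_self one_pos) hmax
  refine Polynomial.eq_of_infinite_eval_eq P Q (Set.Infinite.mono (s := Metric.ball (0 : ℂ) 1) ?_ ?_)
  · intro z hz
    have e := hc hz
    simp only [Function.const, hPa, hQb, hab] at e
    rw [div_self (Complex.ofReal_ne_zero.2 hb.ne'), div_eq_one_iff_eq
      (hQ z (by simpa using (mem_ball_zero_iff.1 hz).le))] at e
    exact e
  · exact (infinite_of_mem_nhds (0 : ℂ) (Metric.ball_mem_nhds _ one_pos))

/-- Two maximal solutions share `P₂`, then `|P₁|` on the circle, then `P₁` because both are outer,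
and finally the angles. -/
theorem isMaximalSolution_unique {d : ℕ} {fhat : Fin (d + 1) → ℝ} (hf : ∑ j, |fhat j| < 1)
    {Ψ Ψ' : Fin (d + 1) → ℝ} (h : IsMaximalSolution (chebSum fhat) Ψ)
    (h' : IsMaximalSolution (chebSum fhat) Ψ') : Ψ' = Ψ := by
  have hF : ∀ {Ψ : Fin (d + 1) → ℝ}, IsMaximalSolution (chebSum fhat) Ψ →
      chebSum (F Ψ) = chebSum fhat := fun {Ψ} h =>
    eq_of_eval_Icc fun x hx => by rw [← g_full_eq _ hx, h.2.1 x hx]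
  have hlt : ∀ θ : ℝ, |(chebSum fhat).eval (Real.cos θ)| < 1 := by
    intro θ
    rw [eval_chebSum_cos]
    refine (Finset.abs_sum_le_sum_abs _ _).trans_lt (lt_of_le_of_lt ?_ hf)
    refine Finset.sum_le_sum fun j _ => ?_
    rw [abs_mul]
    exact mul_le_of_le_one_right (abs_nonneg _) (Real.abs_cos_le_one _)
  have hsnd : ∀ {Ψ : Fin (d + 1) → ℝ}, IsMaximalSolution (chebSum fhat) Ψ → ∀ θ : ℝ,
      ‖aeval (Complex.exp (-(Complex.I * θ)) ^ 2) (colPoly (List.ofFn (full Ψ))).2‖ =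
        |(chebSum fhat).eval (Real.cos θ)| := by
    intro Ψ h θ
    have e := congrArg norm (aeval_snd_eq Ψ θ)
    rw [hF h, norm_mul, norm_pow, mul_comm Complex.I, Complex.norm_exp_ofReal_mul_I, one_pow,
      one_mul, Complex.norm_real, Real.norm_eq_abs] at e
    rw [mul_comm Complex.I]
    exact e
  have hfull : ∀ {Ψ : Fin (d + 1) → ℝ}, IsMaximalSolution (chebSum fhat) Ψ →
      ∀ k, |full Ψ k| < Real.pi / 2 := fun {Ψ} h k => h.1 _
  have hmem : ∀ {Ψ : Fin (d + 1) → ℝ}, IsMaximalSolution (chebSum fhat) Ψ →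
      ∀ φ ∈ List.ofFn (full Ψ), |φ| < Real.pi / 2 := by
    intro Ψ h φ hφ
    obtain ⟨k, rfl⟩ := (List.mem_ofFn' _ _).1 hφ
    exact hfull h k
  have hsq : ∀ {Ψ : Fin (d + 1) → ℝ}, IsMaximalSolution (chebSum fhat) Ψ → ∀ θ : ℝ,
      ‖aeval (Complex.exp (-(Complex.I * θ)) ^ 2) (colPoly (List.ofFn (full Ψ))).1‖ ^ 2 =
        1 - |(chebSum fhat).eval (Real.cos θ)| ^ 2 := by
    intro Ψ h θ
    have e := normSq_colPoly (List.ofFn (full Ψ)) (z := Complex.exp (-(Complex.I * θ)) ^ 2) (by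
      rw [norm_pow, show -(Complex.I * (θ : ℂ)) = ((-θ : ℝ) : ℂ) * Complex.I by push_cast; ring,
        Complex.norm_exp_ofReal_mul_I, one_pow])
    rw [hsnd h θ] at e
    linarith
  have h0 : ∀ {Ψ : Fin (d + 1) → ℝ},
      ((colPoly (List.ofFn (full Ψ))).1.map (algebraMap ℝ ℂ)).eval 0 =
        (((List.ofFn (full Ψ)).map Real.cos).prod : ℝ) := by
    intro Ψ
    rw [eval_map_algebraMap, ← coeff_zero_eq_aeval_zero' , colPoly_coeff_zero]
    rfl
  have hne : ∀ {Ψ : Fin (d + 1) → ℝ}, IsMaximalSolution (chebSum fhat) Ψ → ∀ z : ℂ, ‖z‖ ≤ 1 →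
      ((colPoly (List.ofFn (full Ψ))).1.map (algebraMap ℝ ℂ)).eval z ≠ 0 := by
    intro Ψ h z hz
    rcases eq_or_ne z 0 with rfl | hz0
    · rw [h0]
      exact Complex.ofReal_ne_zero.2 (prod_cos_pos (hmem h)).ne'
    rw [eval_map_algebraMap]
    rcases hz.lt_or_eq with hz1 | hz1
    · have e := h.2.2 z⁻¹ (by
        rw [norm_inv]; exact (one_lt_inv₀ (norm_pos_iff.2 hz0)).2 hz1)
      rwa [nlft_zero_zero _ (hfull h) (inv_ne_zero hz0), inv_inv] at e
    -- On the circle itself `|P₁|² = 1 - f²`, and `|f| ≤ ∑ |f̂_j| < 1`.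
    · obtain ⟨θ, rfl⟩ := exists_exp_sq hz1
      intro e
      have := hsq h θ
      rw [e, norm_zero] at this
      nlinarith [hlt θ, abs_nonneg ((chebSum fhat).eval (Real.cos θ))]
  have e1 : (colPoly (List.ofFn (full Ψ'))).1 = (colPoly (List.ofFn (full Ψ))).1 := by
    refine Polynomial.map_injective (algebraMap ℝ ℂ) (algebraMap ℝ ℂ).injective ?_
    refine eq_of_norm_eq_on_sphere (hne h') (hne h) ?_ (prod_cos_pos (hmem h'))
      (prod_cos_pos (hmem h)) h0 h0
    intro z hz
    obtain ⟨θ, rfl⟩ := exists_exp_sq hz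
    rw [eval_map_algebraMap, eval_map_algebraMap]
    refine (sq_eq_sq₀ (norm_nonneg _) (norm_nonneg _)).1 ?_
    rw [hsq h', hsq h]
  have e2 : (colPoly (List.ofFn (full Ψ'))).2 = (colPoly (List.ofFn (full Ψ))).2 := by
    refine Polynomial.map_injective (algebraMap ℝ ℂ) (algebraMap ℝ ℂ).injective ?_
    refine Polynomial.eq_of_infinite_eval_eq _ _ (Set.Infinite.mono (s := Metric.sphere (0 : ℂ) 1)
      ?_ ?_)
    · intro z hz
      obtain ⟨θ, rfl⟩ := exists_exp_sq (mem_sphere_zero_iff_norm.1 hz)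
      have a1 := aeval_snd_eq Ψ θ
      have a2 := aeval_snd_eq Ψ' θ
      rw [hF h, ← hF h', ← a2] at a1
      simp only [Set.mem_ofPred_eq, eval_map_algebraMap]
      exact (mul_left_cancel₀ (pow_ne_zero _ (Complex.exp_ne_zero _)) a1).symm
    · have : (Metric.sphere (0 : ℂ) 1).Nontrivial :=
        ⟨1, by simp, -1, by simp, by norm_num⟩
      exact (isConnected_sphere (by simp) 0 zero_le_one).isPreconnected.infinite_of_nontrivial this
  have e3 := colPoly_injective (by simp) (hmem h') (hmem h) (Prod.ext e1 e2)
  have e4 := List.ofFn_injective e3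
  funext j
  have e5 := congrFun e4 ⟨d + j, by omega⟩
  simpa [full] using e5

/-! ### An invariant region for the majorant of the iteration -/

/-- `Real.exp_bound` needs an argument of modulus at most `1`, so it is applied at `y / 2` and
followed by the double-angle formulas. The denominators `115` and `22`, in place of `120` and `24`,
absorb the tails of the series. -/
theorem sinh_cosh_le_of_le {y : ℝ} (h0 : 0 ≤ y) (h1 : y ≤ 1.26) :
    Real.sinh y ≤ y + y ^ 3 / 6 + y ^ 5 / 115 ∧ Real.cosh y ≤ 1 + y ^ 2 / 2 + y ^ 4 / 22 := by
  obtain ⟨x, rfl⟩ : ∃ x, y = 2 * x := ⟨y / 2, by ring⟩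
  have hx0 : 0 ≤ x := by linarith
  have hx1 : x ≤ 0.63 := by linarith
  have b1 := abs_le.1 (Real.exp_bound (x := x) (by rw [abs_of_nonneg hx0]; linarith)
    (n := 8) (by norm_num))
  have b2 := abs_le.1 (Real.exp_bound (x := -x) (by rw [abs_neg, abs_of_nonneg hx0]; linarith)
    (n := 8) (by norm_num))
  rw [abs_of_nonneg hx0] at b1
  rw [abs_neg, abs_of_nonneg hx0] at b2
  norm_num [Finset.sum_range_succ, Nat.factorial] at b1 b2
  have hs : Real.sinh x ≤ x + x ^ 3 / 6 + x ^ 5 / 120 + x ^ 7 / 4000 := by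
    rw [Real.sinh_eq]
    have : x ^ 8 ≤ 0.63 * x ^ 7 := by
      rw [pow_succ, mul_comm]; gcongr
    have : 0 ≤ x ^ 7 := by positivity
    linarith
  have hc : Real.cosh x ≤ 1 + x ^ 2 / 2 + x ^ 4 / 24 + x ^ 6 / 600 := by
    rw [Real.cosh_eq]
    have : x ^ 8 ≤ 0.4 * x ^ 6 := by
      have : x ^ 8 = x ^ 2 * x ^ 6 := by ring
      rw [this]; gcongr; nlinarith
    have : 0 ≤ x ^ 6 := by positivity
    linarith
  have hs0 : 0 ≤ Real.sinh x := Real.sinh_nonneg_iff.2 hx0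
  have q1 : x ^ 2 ≤ 0.3969 := by nlinarith
  have q0 : 0 ≤ x ^ 2 := by positivity
  constructor
  · rw [Real.sinh_two_mul]
    have h := mul_le_mul hs hc (by positivity) (by positivity)
    have e : (x + x ^ 3 / 6 + x ^ 5 / 120 + x ^ 7 / 4000) *
        (1 + x ^ 2 / 2 + x ^ 4 / 24 + x ^ 6 / 600) ≤ x + 2 * x ^ 3 / 3 + 16 * x ^ 5 / 115 := by
      have : 0 ≤ x ^ 5 * (16 / 115 - 2 / 15 - (0.0134 * x ^ 2 + 0.001 * (x ^ 2) ^ 2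
        + 0.0001 * (x ^ 2) ^ 3 + 0.0001 * (x ^ 2) ^ 4)) := by
        refine mul_nonneg (by positivity) ?_
        have t1 : (x ^ 2) ^ 2 ≤ 0.16 := by nlinarith
        have t2 : (x ^ 2) ^ 3 ≤ 0.07 := by nlinarith
        have t3 : (x ^ 2) ^ 4 ≤ 0.03 := by nlinarith [pow_nonneg q0 3]
        linarith
      have p7 : 0 ≤ x ^ 7 := by positivity
      have p9 : 0 ≤ x ^ 9 := by positivity
      have p11 : 0 ≤ x ^ 11 := by positivity
      have p13 : 0 ≤ x ^ 13 := by positivity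
      linarith
    linarith
  · rw [Real.cosh_two_mul, Real.cosh_sq]
    have h : Real.sinh x ^ 2 ≤ (x + x ^ 3 / 6 + x ^ 5 / 120 + x ^ 7 / 4000) ^ 2 := by gcongr
    have e : (x + x ^ 3 / 6 + x ^ 5 / 120 + x ^ 7 / 4000) ^ 2 ≤ x ^ 2 + 4 * x ^ 4 / 11 := by
      have : 0 ≤ x ^ 4 * (4 / 11 - 1 / 3 - (0.045 * x ^ 2 + 0.004 * (x ^ 2) ^ 2
        + 0.001 * (x ^ 2) ^ 3 + 0.001 * (x ^ 2) ^ 4 + 0.001 * (x ^ 2) ^ 5)) := by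
        refine mul_nonneg (by positivity) ?_
        have t1 : (x ^ 2) ^ 2 ≤ 0.16 := by nlinarith
        have t2 : (x ^ 2) ^ 3 ≤ 0.07 := by nlinarith
        have t3 : (x ^ 2) ^ 4 ≤ 0.03 := by nlinarith [pow_nonneg q0 3]
        have t4 : (x ^ 2) ^ 5 ≤ 0.03 := by nlinarith [pow_nonneg q0 4]
        linarith
      have p6 : 0 ≤ x ^ 6 := by positivity
      have p8 : 0 ≤ x ^ 8 := by positivity
      have p10 : 0 ≤ x ^ 10 := by positivity
      have p12 : 0 ≤ x ^ 12 := by positivity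
      have p14 : 0 ≤ x ^ 14 := by positivity
      linarith
    linarith

theorem pow_bounds {y : ℝ} (h0 : 0 ≤ y) (h1 : y ≤ 1.26) : y ^ 2 ≤ 1.5876 ∧ y ^ 4 ≤ 2.5205 ∧
    y ^ 3 ≤ 1.26 * y ^ 2 ∧ y ^ 3 ≤ 1.5876 * y ∧ y ^ 5 ≤ 2.5205 * y ∧ y ^ 5 ≤ 2.0004 * y ^ 2 := by
  have y2 : y ^ 2 ≤ 1.5876 := by nlinarith
  have y4 : y ^ 4 ≤ 2.5205 := by nlinarith [sq_nonneg y]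
  have y3 : y ^ 3 ≤ 1.26 * y ^ 2 := by
    rw [pow_succ, mul_comm]; gcongr
  have y3' : y ^ 3 ≤ 1.5876 * y := by rw [pow_succ]; gcongr
  have y5 : y ^ 5 ≤ 2.5205 * y := by rw [pow_succ]; gcongr
  have hy5 : y ^ 5 ≤ 2.0004 * y ^ 2 := by
    have : y ^ 5 = y ^ 3 * y ^ 2 := by ring
    rw [this]; gcongr; linarith
  exact ⟨y2, y4, y3, y3', y5, hy5⟩

/-- The decrease of `2p + y` in one step of the iteration. -/
def decr (p y : ℝ) : ℝ :=
  Real.sin p * (2 - Real.cosh y) + Real.cos p * (2 * y - Real.sinh y)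

/-- The bound for the nonlinear remainder. -/
def remBound (p y : ℝ) : ℝ :=
  Real.cos p * (Real.sinh y - y) + Real.sin p * (Real.cosh y - 1)

/-- Twice the contraction margin. -/
def margin (p y : ℝ) : ℝ :=
  2 * Real.cos p - Real.cos p * Real.cosh y - Real.sin p * Real.sinh y

/-- The invariant region, where `s` is the modulus of the constant coefficient of the target. -/
structure InRegion (s p y : ℝ) : Prop where
  p_nonneg : 0 ≤ p
  y_nonneg : 0 ≤ y
  p_le : p ≤ 0.22 + s
  y_le : y ≤ 1.26 - 0.95 * s
  sum_le : 2 * p + y ≤ 1.33 + 1.05 * s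

/-! ### Estimates at the vertices and on the slanted edge of the region. -/

/-- Up to constants these are the Bernstein polynomials of `[0, 0.861]`. A polynomial in `s` with
nonnegative coefficients in this basis is nonnegative there, which makes the vertex estimates linear
problems. -/
theorem bernstein_nonneg {s : ℝ} (h0 : 0 ≤ s) (h1 : s ≤ 0.861) (i j : ℕ) :
    0 ≤ s ^ i * (0.861 - s) ^ j :=
  mul_nonneg (pow_nonneg h0 _) (pow_nonneg (by linarith) _)

theorem trig_bounds {p : ℝ} (h0 : 0 ≤ p) (h1 : p ≤ 1.1) :
    p - p ^ 3 / 6 ≤ Real.sin p ∧ Real.sin p ≤ p ∧ 1 - p ^ 2 / 2 ≤ Real.cos p ∧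
      Real.cos p ≤ 1 ∧ 0 ≤ Real.sin p ∧ 0 ≤ Real.cos p ∧ 0 ≤ 1 - p ^ 2 / 2 := by
  have hpi := Real.pi_gt_three
  exact ⟨Real.sin_ge_sub_cube h0, Real.sin_le h0, Real.one_sub_sq_div_two_le_cos, Real.cos_le_one p,
    Real.sin_nonneg_of_nonneg_of_le_pi h0 (by linarith),
    Real.cos_nonneg_of_neg_pi_div_two_le_of_le (by linarith) (by linarith), by nlinarith⟩

/-- Polynomial minorants, so that on substituting a vertex only a polynomial inequality in `s`
remains. -/
theorem decr_ge {p y : ℝ} (hp0 : 0 ≤ p) (hp1 : p ≤ 1.1) (hy0 : 0 ≤ y) (hy1 : y ≤ 1.26) :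
    (p - p ^ 3 / 6) * (1 - y ^ 2 / 2 - y ^ 4 / 22) +
      (1 - p ^ 2 / 2) * (y - y ^ 3 / 6 - y ^ 5 / 115) ≤ decr p y ∧
    p * (-(y ^ 2 / 2) - y ^ 4 / 22) +
      (1 - p ^ 2 / 2) * (y - y ^ 3 / 6 - y ^ 5 / 115) ≤ decr p y - Real.sin p ∧
    (p - p ^ 3 / 6) * (1 - y ^ 2 / 2 - y ^ 4 / 22) - (y ^ 3 / 6 + y ^ 5 / 115) ≤
      decr p y - y * Real.cos p ∧
    (1 - p ^ 2 / 2) * (1 - y ^ 2 / 2 - y ^ 4 / 22) - p * (y + y ^ 3 / 6 + y ^ 5 / 115) ≤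
      margin p y := by
  obtain ⟨t1, t2, t3, t4, t5, t6, t7⟩ := trig_bounds hp0 hp1
  obtain ⟨k1, k2⟩ := sinh_cosh_le_of_le hy0 hy1
  obtain ⟨y2, y4, -⟩ := pow_bounds hy0 hy1
  have c0 : 0 ≤ 1 - y ^ 2 / 2 - y ^ 4 / 22 := by linarith
  have ys : y ≤ Real.sinh y := Real.self_le_sinh_iff.2 hy0
  have c1 := Real.one_le_cosh y
  have s0 : 0 ≤ y - y ^ 3 / 6 - y ^ 5 / 115 := by
    have : y - y ^ 3 / 6 - y ^ 5 / 115 = y * (1 - y ^ 2 / 6 - y ^ 4 / 115) := by ring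
    rw [this]
    exact mul_nonneg hy0 (by linarith)
  have pp : 0 ≤ p - p ^ 3 / 6 := by
    have : p - p ^ 3 / 6 = p * (1 - p ^ 2 / 6) := by ring
    rw [this]
    exact mul_nonneg hp0 (by nlinarith)
  have m1 : (p - p ^ 3 / 6) * (1 - y ^ 2 / 2 - y ^ 4 / 22) ≤ Real.sin p * (2 - Real.cosh y) :=
    mul_le_mul t1 (by linarith) c0 t5
  have m2 : (1 - p ^ 2 / 2) * (y - y ^ 3 / 6 - y ^ 5 / 115) ≤
      Real.cos p * (2 * y - Real.sinh y) := mul_le_mul t3 (by linarith) s0 t6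
  have m3 : Real.sin p * (Real.cosh y - 1) ≤ p * (y ^ 2 / 2 + y ^ 4 / 22) :=
    mul_le_mul t2 (by linarith) (by linarith) hp0
  have m4 : Real.cos p * (Real.sinh y - y) ≤ 1 * (y ^ 3 / 6 + y ^ 5 / 115) :=
    mul_le_mul t4 (by linarith) (by linarith) zero_le_one
  have m5 : (1 - p ^ 2 / 2) * (1 - y ^ 2 / 2 - y ^ 4 / 22) ≤ Real.cos p * (2 - Real.cosh y) :=
    mul_le_mul t3 (by linarith) c0 t6
  have m6 : Real.sin p * Real.sinh y ≤ p * (y + y ^ 3 / 6 + y ^ 5 / 115) :=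
    mul_le_mul t2 k1 (by linarith) hp0
  unfold decr margin
  refine ⟨by linarith, by linarith, by linarith, by linarith⟩

/-- The vertex where the bound on `y` meets the bound on `2p + y`. The first three estimates say
that its image satisfies the constraints on `2p + y`, on `y` and on `p`, in this order. The margin
is least at this vertex. -/
theorem vertex_A {s : ℝ} (h0 : 0 ≤ s) (h1 : s ≤ 0.861) :
    0.862 ≤ decr (0.035 + s) (1.26 - 0.95 * s) ∧
    0.8615 - s + Real.sin (0.035 + s) ≤ decr (0.035 + s) (1.26 - 0.95 * s) ∧
    s + 0.0005 - 0.37 + (1.26 - 0.95 * s) * Real.cos (0.035 + s) ≤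
      decr (0.035 + s) (1.26 - 0.95 * s) ∧
    0.03 ≤ margin (0.035 + s) (1.26 - 0.95 * s) := by
  obtain ⟨d1, d2, d3, d4⟩ := decr_ge (p := 0.035 + s) (y := 1.26 - 0.95 * s) (by linarith)
    (by linarith) (by linarith) (by linarith)
  have b := bernstein_nonneg h0 h1
  refine ⟨d1.trans' ?_, ?_, ?_, d4.trans' ?_⟩
  · linarith [b 0 7, b 1 6, b 2 5, b 3 4, b 4 3, b 5 2, b 6 1, b 7 0]
  · linarith [d2, b 0 7, b 1 6, b 2 5, b 3 4, b 4 3, b 5 2, b 6 1, b 7 0]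
  · linarith [d3, b 0 7, b 1 6, b 2 5, b 3 4, b 4 3, b 5 2, b 6 1, b 7 0]
  · linarith [b 0 6, b 1 5, b 2 4, b 3 3, b 4 2, b 5 1, b 6 0]

/-- The same three constraints at the vertex where the bound on `p` meets the bound on `2p + y`. -/
theorem vertex_B {s : ℝ} (h0 : 0 ≤ s) (h1 : s ≤ 0.861) :
    0.862 ≤ decr (0.22 + s) (0.89 - 0.95 * s) ∧
    0.4915 - s + Real.sin (0.22 + s) ≤ decr (0.22 + s) (0.89 - 0.95 * s) ∧
    s + 0.0005 + (0.89 - 0.95 * s) * Real.cos (0.22 + s) ≤ decr (0.22 + s) (0.89 - 0.95 * s) := by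
  obtain ⟨d1, d2, d3, -⟩ := decr_ge (p := 0.22 + s) (y := 0.89 - 0.95 * s) (by linarith)
    (by linarith) (by linarith) (by linarith)
  have b := bernstein_nonneg h0 h1
  refine ⟨d1.trans' ?_, ?_, ?_⟩
  · linarith [b 0 7, b 1 6, b 2 5, b 3 4, b 4 3, b 5 2, b 6 1, b 7 0]
  · linarith [d2, b 0 7, b 1 6, b 2 5, b 3 4, b 4 3, b 5 2, b 6 1, b 7 0]
  · linarith [d3, b 0 7, b 1 6, b 2 5, b 3 4, b 4 3, b 5 2, b 6 1, b 7 0]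

theorem hasDerivAt_decr_edge (X p : ℝ) :
    HasDerivAt (fun p => decr p (X - 2 * p))
      (Real.cos p * (Real.cosh (X - 2 * p) - 2) +
        Real.sin p * (3 * Real.sinh (X - 2 * p) - 2 * (X - 2 * p))) p ∧
    HasDerivAt (fun p => Real.cos p * (Real.cosh (X - 2 * p) - 2) +
        Real.sin p * (3 * Real.sinh (X - 2 * p) - 2 * (X - 2 * p)))
      (Real.sin p * (6 - 7 * Real.cosh (X - 2 * p)) +
        Real.cos p * (Real.sinh (X - 2 * p) - 2 * (X - 2 * p))) p := by
  have hy : HasDerivAt (fun p : ℝ => X - 2 * p) (-2) p := by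
    simpa using ((hasDerivAt_id p).const_mul 2).const_sub X
  have hs := Real.hasDerivAt_sin p
  have hc := Real.hasDerivAt_cos p
  constructor
  · exact ((hs.mul (hy.cosh.const_sub 2)).add
      (hc.mul ((hy.const_mul 2).sub hy.sinh))).congr_deriv (by
        simp only [Pi.sub_apply]; ring)
  · exact ((hc.mul (hy.cosh.sub_const 2)).add
      (hs.mul ((hy.sinh.const_mul 3).sub (hy.const_mul 2)))).congr_deriv (by
        simp only [Pi.sub_apply]; ring)

/-- A convex function is largest at an endpoint; this reduces the slanted edge to its two vertices.
-/
theorem le_of_deriv2_nonneg {a b c p : ℝ} {u u' u'' : ℝ → ℝ} (hp : p ∈ Set.Icc a b)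
    (h1 : ∀ x, HasDerivAt u (u' x) x) (h2 : ∀ x, HasDerivAt u' (u'' x) x)
    (h3 : ∀ x ∈ Set.Icc a b, 0 ≤ u'' x) (ha : u a ≤ c) (hb : u b ≤ c) : u p ≤ c := by
  have hconv : ConvexOn ℝ (Set.Icc a b) u :=
    convexOn_of_hasDerivWithinAt2_nonneg (convex_Icc a b)
      (fun x _ => (h1 x).continuousAt.continuousWithinAt) (fun x _ => (h1 x).hasDerivWithinAt)
      (fun x _ => (h2 x).hasDerivWithinAt) (fun x hx => h3 x (interior_subset hx))
  have hab := hp.1.trans hp.2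
  exact (hconv.le_max_of_mem_Icc (Set.left_mem_Icc.2 hab) (Set.right_mem_Icc.2 hab) hp).trans
    (max_le ha hb)

/-- The ingredients for the sign of the second derivatives along the edge. The last one fails for
small `x`; `0.035` is the smallest abscissa of the edge, attained for `s = 0`. -/
theorem edge_facts {x y : ℝ} (hx0 : 0.035 ≤ x) (hx1 : x ≤ 1.1) (hy0 : 0 ≤ y) (hy1 : y ≤ 1.26) :
    0 ≤ Real.sin x ∧ 0 ≤ Real.cos x ∧ x * Real.cos x ≤ Real.sin x ∧ 1 ≤ Real.cosh y ∧
      Real.sinh y ≤ 2 * y ∧ Real.sinh y - y ≤ x * (7 * Real.cosh y - 2) := by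
  have hx : 0 ≤ x := by linarith
  obtain ⟨-, -, -, -, t5, t6, -⟩ := trig_bounds hx hx1
  obtain ⟨k1, -⟩ := sinh_cosh_le_of_le hy0 hy1
  have hc := one_add_sq_le_cosh y
  obtain ⟨y2, y4, y3, y3', y5, y5'⟩ := pow_bounds hy0 hy1
  refine ⟨t5, t6, ?_, Real.one_le_cosh _, by linarith, ?_⟩
  · have ht := Real.le_tan hx (by linarith [Real.pi_gt_three])
    rw [Real.tan_eq_sin_div_cos] at ht
    rcases t6.eq_or_lt with h | h
    · rw [← h]; simpa using t5
    · rwa [le_div_iff₀ h] at ht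
  · have : 0.035 * (7 * Real.cosh y - 2) ≤ x * (7 * Real.cosh y - 2) := by
      refine mul_le_mul_of_nonneg_right hx0 ?_
      linarith [Real.one_le_cosh y]
    linarith

/-- The estimates on the slanted edge of the region. -/
theorem edge_bounds {s p : ℝ} (h0 : 0 ≤ s) (h1 : s ≤ 0.861) (hp : p ∈ Set.Icc (0.035 + s) (0.22 + s)) :
    0.862 ≤ decr p (1.33 + 1.05 * s - 2 * p) ∧
    (1.33 + 1.05 * s - 2 * p) + Real.sin p - decr p (1.33 + 1.05 * s - 2 * p) ≤
      0.3985 + 0.05 * s ∧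
    2 * p + (1.33 + 1.05 * s - 2 * p) * Real.cos p - decr p (1.33 + 1.05 * s - 2 * p) ≤
      0.4395 + s := by
  obtain ⟨a1, a2, a3, -⟩ := vertex_A h0 h1
  obtain ⟨b1, b2, b3⟩ := vertex_B h0 h1
  set X := 1.33 + 1.05 * s with hX
  have eA : X - 2 * (0.035 + s) = 1.26 - 0.95 * s := by rw [hX]; ring
  have eB : X - 2 * (0.22 + s) = 0.89 - 0.95 * s := by rw [hX]; ring
  have hD := fun x => (hasDerivAt_decr_edge X x).1
  have hD2 := fun x => (hasDerivAt_decr_edge X x).2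
  have hy : ∀ x : ℝ, HasDerivAt (fun p : ℝ => X - 2 * p) (-2) x := fun x => by
    simpa using ((hasDerivAt_id x).const_mul 2).const_sub X
  have facts : ∀ x ∈ Set.Icc (0.035 + s) (0.22 + s), 0 ≤ Real.sin x ∧ 0 ≤ Real.cos x ∧
      x * Real.cos x ≤ Real.sin x ∧ 1 ≤ Real.cosh (X - 2 * x) ∧
      Real.sinh (X - 2 * x) ≤ 2 * (X - 2 * x) ∧
      Real.sinh (X - 2 * x) - (X - 2 * x) ≤ x * (7 * Real.cosh (X - 2 * x) - 2) := fun x hx =>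
    edge_facts (by linarith [hx.1]) (by linarith [hx.2]) (by linarith [hx.2]) (by linarith [hx.1])
  refine ⟨?_, ?_, ?_⟩
  · have := le_of_deriv2_nonneg hp (u := fun p => -decr p (X - 2 * p)) (c := -0.862)
      (fun x => (hD x).neg) (fun x => (hD2 x).neg) (fun x hx => ?_) (by rw [eA]; linarith)
      (by rw [eB]; linarith)
    · linarith
    · obtain ⟨f1, f2, f3, f4, f5, f6⟩ := facts x hx
      have q1 := mul_nonneg f1 (show 0 ≤ 7 * Real.cosh (X - 2 * x) - 6 by linarith)
      have q2 := mul_nonneg f2 (sub_nonneg.2 f5)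
      linarith
  · refine le_of_deriv2_nonneg hp (u := fun p => (X - 2 * p) + Real.sin p - decr p (X - 2 * p))
      (fun x => ((hy x).add (Real.hasDerivAt_sin x)).sub (hD x))
      (fun x => ((Real.hasDerivAt_cos x).const_add (-2)).sub (hD2 x)) (fun x hx => ?_)
      (by rw [eA]; linarith) (by rw [eB]; linarith)
    obtain ⟨f1, f2, f3, f4, f5, f6⟩ := facts x hx
    have q1 := mul_nonneg f1 (sub_nonneg.2 f4)
    have q2 := mul_nonneg f2 (sub_nonneg.2 f5)
    linarith
  · refine le_of_deriv2_nonneg hp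
      (u := fun p => 2 * p + (X - 2 * p) * Real.cos p - decr p (X - 2 * p))
      (fun x => ((((hasDerivAt_id x).const_mul 2).add
        ((hy x).mul (Real.hasDerivAt_cos x)))).sub (hD x))
      (fun x => ((((Real.hasDerivAt_cos x).const_mul (-2)).add
        ((hy x).mul (Real.hasDerivAt_sin x).neg)).const_add (2 * 1)).sub (hD2 x))
      (fun x hx => ?_) (by rw [eA]; linarith) (by rw [eB]; linarith)
    obtain ⟨f1, f2, f3, f4, f5, f6⟩ := facts x hx
    have q1 := mul_le_mul_of_nonneg_left f6 f2
    have q2 := mul_le_mul_of_nonneg_right f3 (show 0 ≤ 7 * Real.cosh (X - 2 * x) - 2 by linarith)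
    simp only [Pi.neg_apply]
    linarith

/-- The three bounds for the image do not decrease when `(p, y)` is replaced by a point `(q, z)` of
the slanted edge that dominates it, and there `edge_bounds` applies. The two target parts together
are at most `0.862 = (s + 0.0005) + (0.8615 - s)`; the excess over `0.861` is room for rounding
errors. -/
theorem InRegion.step {s p y p' y' ρ₀ ρ₁ f₀ f₁ : ℝ} (h0 : 0 ≤ s) (h1 : s ≤ 0.861)
    (h : InRegion s p y) (hρ₀ : 0 ≤ ρ₀) (hρ₁ : 0 ≤ ρ₁) (hρ : ρ₀ + ρ₁ ≤ remBound p y)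
    (hf₀ : f₀ ≤ s + 0.0005) (hf₁ : f₁ ≤ 0.8615 - s) (hp'0 : 0 ≤ p') (hy'0 : 0 ≤ y')
    (hp' : p' ≤ p - Real.sin p / 2 + ρ₀ / 2 + f₀ / 2)
    (hy' : y' ≤ (1 - Real.cos p) * y + ρ₁ + f₁) : InRegion s p' y' := by
  obtain ⟨q, z, hq, hz, hpq, hyz⟩ : ∃ q z, q ∈ Set.Icc (0.035 + s) (0.22 + s) ∧
      z = 1.33 + 1.05 * s - 2 * q ∧ p ≤ q ∧ y ≤ z := by
    refine ⟨max p (0.035 + s), _, ⟨le_max_right _ _, max_le h.p_le (by linarith)⟩, rfl,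
      le_max_left _ _, ?_⟩
    rcases max_choice p (0.035 + s) with e | e <;> rw [e] <;> linarith [h.sum_le, h.y_le]
  obtain ⟨e1, e2, e3⟩ := edge_bounds h0 h1 hq
  rw [← hz] at e1 e2 e3
  have hp0 := h.p_nonneg
  have hy0 := h.y_nonneg
  have hq1 : q ≤ 1.1 := by linarith [hq.2]
  have hz1 : z ≤ 1.26 := by linarith [hq.1]
  obtain ⟨-, -, -, t4, t5, t6, -⟩ := trig_bounds hp0 (hpq.trans hq1)
  obtain ⟨-, -, -, -, t5', t6', -⟩ := trig_bounds (hp0.trans hpq) hq1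
  obtain ⟨k1, -⟩ := sinh_cosh_le_of_le (hy0.trans hyz) hz1
  have hpi := Real.pi_gt_three
  have hsin : Real.sin p ≤ Real.sin q :=
    Real.sin_le_sin_of_le_of_le_pi_div_two (by linarith) (by linarith) hpq
  have hcos : Real.cos q ≤ Real.cos p := Real.cos_le_cos_of_nonneg_of_le_pi hp0 (by linarith) hpq
  have hsin' := abs_le.1 (Real.abs_sin_sub_sin_le q p)
  have hcos' := abs_le.1 (Real.abs_cos_sub_cos_le p q)
  rw [abs_of_nonneg (by linarith : 0 ≤ q - p)] at hsin'
  rw [abs_sub_comm, abs_of_nonneg (by linarith : 0 ≤ q - p)] at hcos'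
  have hz0 : 0 ≤ z := hy0.trans hyz
  obtain ⟨hz2, -, z3', z3, z5, z5'⟩ := pow_bounds hz0 hz1
  have hA1 : Real.sinh y - y ≤ Real.sinh z - z := by
    have h := Real.sinh_sub_id_strictMono.monotone hyz
    simpa using h
  have hA0 : 0 ≤ Real.sinh y - y := by linarith [Real.self_le_sinh_iff.2 hy0]
  have hA2 : Real.sinh z - z ≤ z := by linarith
  have hA3 : Real.sinh z - z ≤ 1 := by linarith
  have hB1 : Real.cosh y ≤ Real.cosh z := by
    rw [Real.cosh_le_cosh, abs_of_nonneg hy0, abs_of_nonneg hz0]; exact hyz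
  have hB0 := Real.one_le_cosh y
  have hr : remBound p y ≤ remBound p z := by
    unfold remBound
    gcongr
  -- This gives the bound on `y'`; added to `hV` it gives the one on `2p' + y'`, while `hL` gives
  -- the one on `p'`.
  have hΘ : (1 - Real.cos p) * y + remBound p y ≤ z + Real.sin q - decr q z := by
    have m1 : (1 - Real.cos p) * y ≤ (1 - Real.cos p) * z :=
      mul_le_mul_of_nonneg_left hyz (by linarith)
    have m2 : 0 ≤ (Real.cos p - Real.cos q) * (z - (Real.sinh z - z)) :=
      mul_nonneg (by linarith) (by linarith)
    have m3 : 0 ≤ (Real.sin q - Real.sin p) * (Real.cosh z - 1) :=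
      mul_nonneg (by linarith) (by linarith)
    unfold remBound decr at *
    linarith
  have hL : 2 * p - Real.sin p + remBound p y ≤ 2 * q + z * Real.cos q - decr q z := by
    have m2 : (Real.cos p - Real.cos q) * (Real.sinh z - z) ≤ (q - p) * 1 :=
      mul_le_mul (by linarith) hA3 (by linarith) (by linarith)
    have m3 : 0 ≤ (Real.sin q - Real.sin p) * (Real.cosh z - 1) :=
      mul_nonneg (by linarith) (by linarith)
    unfold remBound decr at *
    linarith
  have hV : 2 * p - Real.sin p ≤ 2 * q - Real.sin q := by linarith
  exact ⟨hp'0, hy'0, by linarith, by linarith, by linarith⟩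

/-- The margin decreases in `p` and in `y`, but increases with `p` along the slanted edge, so its
minimum over the region is at the vertex of `vertex_A`. -/
theorem InRegion.margin_ge {s p y : ℝ} (h0 : 0 ≤ s) (h1 : s ≤ 0.861) (h : InRegion s p y) :
    0.03 ≤ margin p y := by
  obtain ⟨-, -, -, a4⟩ := vertex_A h0 h1
  have hp0 := h.p_nonneg
  have hy0 := h.y_nonneg
  have hpi := Real.pi_gt_three
  have key : ∀ {p q y z : ℝ}, 0 ≤ p → p ≤ q → q ≤ 1.1 → 0 ≤ y → y ≤ z → z ≤ 1.26 →
      margin q z ≤ margin p y := by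
    intro p q y z hp hpq hq hy hyz hz
    obtain ⟨-, -, -, t4, t5, t6, -⟩ := trig_bounds hp (hpq.trans hq)
    obtain ⟨-, -, -, -, t5', t6', -⟩ := trig_bounds (hp.trans hpq) hq
    have hsin : Real.sin p ≤ Real.sin q :=
      Real.sin_le_sin_of_le_of_le_pi_div_two (by linarith) (by linarith) hpq
    have hcos : Real.cos q ≤ Real.cos p := Real.cos_le_cos_of_nonneg_of_le_pi hp (by linarith) hpq
    have hB1 : Real.cosh y ≤ Real.cosh z := by
      rw [Real.cosh_le_cosh, abs_of_nonneg hy, abs_of_nonneg (hy.trans hyz)]; exact hyz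
    have hS := Real.sinh_le_sinh.2 hyz
    have hS0 := Real.sinh_nonneg_iff.2 hy
    obtain ⟨-, k2⟩ := sinh_cosh_le_of_le (hy.trans hyz) hz
    obtain ⟨z2, z4, -⟩ := pow_bounds (hy.trans hyz) hz
    have m1 : Real.cos q * (2 - Real.cosh z) ≤ Real.cos p * (2 - Real.cosh y) :=
      mul_le_mul hcos (by linarith) (by linarith) t6
    have m2 : Real.sin p * Real.sinh y ≤ Real.sin q * Real.sinh z :=
      mul_le_mul hsin hS hS0 t5'
    unfold margin
    linarith
  rcases le_total p (0.035 + s) with hp | hp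
  · exact a4.trans (key hp0 hp (by linarith) hy0 h.y_le (by linarith))
  · have hD : MonotoneOn (fun p => margin p (1.33 + 1.05 * s - 2 * p))
        (Set.Icc (0.035 + s) (0.22 + s)) := by
      have hd : ∀ x, HasDerivAt (fun p => margin p (1.33 + 1.05 * s - 2 * p))
          (-2 * Real.sin x + 3 * Real.sin x * Real.cosh (1.33 + 1.05 * s - 2 * x) +
            Real.cos x * Real.sinh (1.33 + 1.05 * s - 2 * x)) x := by
        intro x
        have hy : HasDerivAt (fun p : ℝ => 1.33 + 1.05 * s - 2 * p) (-2) x := by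
          simpa using ((hasDerivAt_id x).const_mul 2).const_sub (1.33 + 1.05 * s)
        have hs := Real.hasDerivAt_sin x
        have hc := Real.hasDerivAt_cos x
        exact (((hc.const_mul 2).sub (hc.mul hy.cosh)).sub (hs.mul hy.sinh)).congr_deriv (by ring)
      refine monotoneOn_of_deriv_nonneg (convex_Icc _ _)
        (fun x _ => (hd x).continuousAt.continuousWithinAt)
        (fun x _ => (hd x).differentiableAt.differentiableWithinAt) fun x hx => ?_
      have hx := interior_subset hx
      rw [(hd x).deriv]
      obtain ⟨-, -, -, -, t5, t6, -⟩ := trig_bounds (p := x) (by linarith [hx.1])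
        (by linarith [hx.2])
      have := Real.one_le_cosh (1.33 + 1.05 * s - 2 * x)
      have := Real.sinh_nonneg_iff.2 (show 0 ≤ 1.33 + 1.05 * s - 2 * x by linarith [hx.2])
      nlinarith [mul_nonneg t6 this]
    have h2 := hD (Set.left_mem_Icc.2 (by linarith)) ⟨hp, h.p_le⟩ hp
    simp only at h2
    rw [show 1.33 + 1.05 * s - 2 * (0.035 + s) = 1.26 - 0.95 * s by ring] at h2
    exact (a4.trans h2).trans (key hp0 le_rfl (by linarith [h.p_le]) hy0 (by linarith [h.sum_le])
      (by linarith))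

/-! ### The fixed-point map -/

theorem foldCoeff_add (d : ℕ) (P Q : ℝ[X]) (j : ℕ) :
    foldCoeff d (P + Q) j = foldCoeff d P j + foldCoeff d Q j := by
  unfold foldCoeff; split_ifs
  · simp
  · simp only [coeff_add]; ring

theorem foldCoeff_sub (d : ℕ) (P Q : ℝ[X]) (j : ℕ) :
    foldCoeff d (P - Q) j = foldCoeff d P j - foldCoeff d Q j := by
  unfold foldCoeff; split_ifs
  · simp
  · simp only [coeff_sub]; ring

theorem foldCoeff_C_mul (d : ℕ) (a : ℝ) (P : ℝ[X]) (j : ℕ) :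
    foldCoeff d (C a * P) j = a * foldCoeff d P j := by
  unfold foldCoeff; split_ifs
  · simp
  · simp only [coeff_C_mul]; ring

theorem foldCoeff_X_pow {d j : ℕ} (hj : j ≤ d) :
    foldCoeff d (X ^ d) j = if j = 0 then 1 else 0 := by
  unfold foldCoeff; split_ifs with h
  · simp
  · rw [coeff_X_pow, coeff_X_pow, if_neg (by omega), if_neg (by omega), add_zero]

theorem sum_abs_foldCoeff_le (d : ℕ) (P : ℝ[X]) :
    ∑ j : Fin (d + 1), |foldCoeff d P j| ≤ cnorm P := by
  rw [Fin.sum_univ_eq_sum_range (fun j => |foldCoeff d P j|)]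
  have h := sum_fold d (fun k => |P.coeff k|) (fun _ => 1)
  simp only [mul_one] at h
  refine le_trans ?_ ((h.symm.le).trans (sum_abs_coeff_le _ _))
  refine Finset.sum_le_sum fun j _ => ?_
  unfold foldCoeff
  split_ifs
  · exact le_rfl
  · exact abs_add_le _ _

theorem foldCoeff_linPoly_full {d : ℕ} (Ψ : Fin (d + 1) → ℝ) (j : Fin (d + 1)) :
    foldCoeff d (linPoly (List.ofFn (full Ψ))) j = if j = 0 then Ψ 0 else 2 * Ψ j := by
  have hc : ∀ i (h : i < 2 * d + 1),
      (linPoly (List.ofFn (full Ψ))).coeff i = full Ψ ⟨i, h⟩ := by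
    intro i h
    rw [coeff_linPoly, List.getD_eq_getElem _ _ (by simpa using h), List.getElem_ofFn]
  have hj := j.2
  unfold foldCoeff
  simp only [Fin.val_eq_zero_iff]
  split_ifs with h
  · rw [hc _ (by omega), full]
    congr 1; ext; simp
  · rw [hc _ (by omega), hc _ (by omega), full, full, two_mul (Ψ j)]
    congr 2 <;> ext <;> simp only <;> omega

/-- `Ψ` with its first entry removed. -/
def dropZero {d : ℕ} (Ψ : Fin (d + 1) → ℝ) : Fin (d + 1) → ℝ := Fin.cons 0 fun j => Ψ j.succ

theorem ofFn_full_dropZero {d : ℕ} (Ψ : Fin (d + 1) → ℝ) :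
    List.ofFn (full (dropZero Ψ)) = (outer Ψ).reverse ++ 0 :: outer Ψ := by
  rw [ofFn_full]; simp [outer, dropZero]

theorem foldCoeff_target {d : ℕ} (a b : ℝ) (Ψ : Fin (d + 1) → ℝ) (j : Fin (d + 1)) :
    foldCoeff d (C a * X ^ d + C b * linPoly ((outer Ψ).reverse ++ 0 :: outer Ψ)) j =
      if j = 0 then a else 2 * b * Ψ j := by
  rw [← ofFn_full_dropZero, foldCoeff_add, foldCoeff_C_mul, foldCoeff_C_mul,
    foldCoeff_X_pow (by omega), foldCoeff_linPoly_full]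
  simp only [Fin.val_eq_zero_iff]
  split_ifs with h
  · simp [dropZero]
  · obtain ⟨i, rfl⟩ := Fin.exists_succ_eq.2 h
    simp [dropZero]; ring

/-- The sum of the moduli of the entries but the first one. -/
def tailSum {d : ℕ} (Ψ : Fin (d + 1) → ℝ) : ℝ := ∑ j : Fin d, |Ψ j.succ|

theorem tailSum_nonneg {d : ℕ} (Ψ : Fin (d + 1) → ℝ) : 0 ≤ tailSum Ψ :=
  Finset.sum_nonneg fun _ _ => abs_nonneg _

theorem l1_eq {d : ℕ} (Ψ : Fin (d + 1) → ℝ) : l1 Ψ = |Ψ 0| + tailSum Ψ := by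
  rw [l1, Fin.sum_univ_succ, tailSum]

theorem absSum_outer {d : ℕ} (Ψ : Fin (d + 1) → ℝ) : absSum (outer Ψ) = tailSum Ψ := by
  simp [absSum, outer, tailSum, List.map_ofFn, List.sum_ofFn]

theorem absSum_reverse (l : List ℝ) : absSum l.reverse = absSum l := by
  simp [absSum, List.map_reverse, List.sum_reverse]

theorem abs_cos_sin_of_abs_le {ψ : ℝ} (h : |ψ| ≤ 1.1) :
    |Real.cos ψ| = Real.cos |ψ| ∧ |Real.sin ψ| = Real.sin |ψ| ∧ Real.cos ψ = Real.cos |ψ| := by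
  have h3 := Real.pi_gt_three
  have h1 := abs_le.1 h
  refine ⟨?_, ?_, (Real.cos_abs ψ).symm⟩
  · rw [Real.cos_abs, abs_of_nonneg]
    exact Real.cos_nonneg_of_mem_Icc ⟨by linarith, by linarith⟩
  · rcases le_total 0 ψ with h0 | h0
    · rw [abs_of_nonneg h0, abs_of_nonneg]
      exact Real.sin_nonneg_of_nonneg_of_le_pi h0 (by linarith)
    · rw [abs_of_nonpos h0, Real.sin_neg, abs_of_nonpos]
      exact Real.sin_nonpos_of_nonpos_of_neg_pi_le h0 (by linarith)

/-- The difference between `F` and its main part. -/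
def rem {d : ℕ} (Ψ : Fin (d + 1) → ℝ) (j : Fin (d + 1)) : ℝ :=
  F Ψ j - if j = 0 then Real.sin (Ψ 0) else 2 * Real.cos (Ψ 0) * Ψ j

/-- The main part of `F` is the folded target polynomial of `majorized_colPoly_center`, and folding
does not increase `ℓ¹` norms. -/
theorem sum_abs_rem_le {d : ℕ} {Ψ : Fin (d + 1) → ℝ} (h : |Ψ 0| ≤ 1.1) :
    |rem Ψ 0| + ∑ j : Fin d, |rem Ψ j.succ| ≤ remBound |Ψ 0| (2 * tailSum Ψ) := by
  rw [← Fin.sum_univ_succ (fun j => |rem Ψ j|)]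
  have hm := (majorized_colPoly_center (outer Ψ).reverse (outer Ψ) (Ψ 0)).snd
  rw [absSum_reverse, absSum_outer, ← two_mul, (abs_cos_sin_of_abs_le h).1,
    (abs_cos_sin_of_abs_le h).2.1] at hm
  refine le_trans (le_of_eq ?_) ((sum_abs_foldCoeff_le d _).trans hm)
  refine Finset.sum_congr rfl fun j _ => ?_
  have hl : (outer Ψ).reverse.length = d := by simp [outer]
  rw [foldCoeff_sub, hl, foldCoeff_target, ← ofFn_full, ← F_eq, rem]

/-- One step of the iteration. -/
def fpStep {d : ℕ} (fhat Ψ : Fin (d + 1) → ℝ) : Fin (d + 1) → ℝ :=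
  Ψ - (1 / 2 : ℝ) • (F Ψ - fhat)

/-- The invariant region of the iteration for the target `fhat`. -/
def region {d : ℕ} (fhat : Fin (d + 1) → ℝ) : Set (Fin (d + 1) → ℝ) :=
  {Ψ | InRegion |fhat 0| |Ψ 0| (2 * tailSum Ψ)}

theorem sub_half_sin_abs (x : ℝ) : |x - Real.sin x / 2| = |x| - Real.sin |x| / 2 := by
  have h : ∀ y, 0 ≤ y → 0 ≤ y - Real.sin y / 2 := by
    intro y hy; have := Real.sin_le hy; linarith
  rcases le_total 0 x with h0 | h0
  · rw [abs_of_nonneg h0, abs_of_nonneg (h x h0)]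
  · have := h (-x) (by linarith)
    rw [Real.sin_neg] at this
    rw [abs_of_nonpos h0, Real.sin_neg, abs_of_nonpos (by linarith)]; ring

/-- The region belongs to `fhat` while the step uses a nearby target `f'`. The deviation allowed
here is what later represents the rounding error of a step. -/
theorem fpStep_mem_region {d : ℕ} {fhat f' Ψ : Fin (d + 1) → ℝ} (hf : l1 fhat ≤ 0.861)
    (hf' : l1 (f' - fhat) ≤ 0.0005) (hΨ : Ψ ∈ region fhat) : fpStep f' Ψ ∈ region fhat := by
  rw [l1_eq] at hf hf'
  have hd0 := abs_nonneg ((f' - fhat) 0)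
  have hdt := tailSum_nonneg (f' - fhat)
  have hs0 := abs_nonneg (fhat 0)
  have hst := tailSum_nonneg fhat
  have hp : |Ψ 0| ≤ 1.1 := by have := hΨ.p_le; linarith
  have hcs := abs_cos_sin_of_abs_le hp
  have h0 : |f' 0| ≤ |fhat 0| + |(f' - fhat) 0| := by
    have := abs_add_le (fhat 0) (f' 0 - fhat 0)
    rwa [add_sub_cancel] at this
  have ht : tailSum f' ≤ tailSum fhat + tailSum (f' - fhat) := by
    rw [tailSum, tailSum, tailSum, ← Finset.sum_add_distrib]
    refine Finset.sum_le_sum fun j _ => ?_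
    have := abs_add_le (fhat j.succ) (f' j.succ - fhat j.succ)
    rwa [add_sub_cancel] at this
  refine InRegion.step hs0 (by linarith) hΨ (abs_nonneg (rem Ψ 0))
    (Finset.sum_nonneg fun j _ => abs_nonneg (rem Ψ (Fin.succ j))) (sum_abs_rem_le hp)
    (f₀ := |f' 0|) (f₁ := tailSum f') (by linarith) (by linarith) (abs_nonneg _)
    (mul_nonneg zero_le_two (tailSum_nonneg _)) ?_ ?_
  · have e : fpStep f' Ψ 0 = (Ψ 0 - Real.sin (Ψ 0) / 2) + -(rem Ψ 0 / 2) + f' 0 / 2 := by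
      simp [fpStep, rem]; ring
    rw [e]
    refine (abs_add_three _ _ _).trans (le_of_eq ?_)
    rw [sub_half_sin_abs, abs_neg, abs_div, abs_div, abs_two]
  · rw [tailSum, tailSum, tailSum, Finset.mul_sum, Finset.mul_sum, Finset.mul_sum,
      ← Finset.sum_add_distrib, ← Finset.sum_add_distrib]
    refine Finset.sum_le_sum fun j _ => ?_
    have e : fpStep f' Ψ j.succ = (1 - Real.cos (Ψ 0)) * Ψ j.succ + -(rem Ψ j.succ / 2) +
        f' j.succ / 2 := by
      simp [fpStep, rem]; ring
    rw [e]
    have h1 := abs_add_three ((1 - Real.cos (Ψ 0)) * Ψ j.succ) (-(rem Ψ j.succ / 2)) (f' j.succ / 2)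
    rw [abs_neg, abs_div, abs_div, abs_two, abs_mul, hcs.2.2,
      abs_of_nonneg (sub_nonneg.2 (Real.cos_le_one |Ψ 0|))] at h1
    rw [hcs.2.2]
    linarith

/-! ### The derivative of `F` and the contraction estimate. -/

theorem ofFn_full_pair {d : ℕ} (Ψ v : Fin (d + 1) → ℝ) :
    (List.ofFn fun k => (full Ψ k, full v k)) =
      (List.ofFn fun j : Fin d => (Ψ j.succ, v j.succ)).reverse ++
        (Ψ 0, v 0) :: List.ofFn fun j : Fin d => (Ψ j.succ, v j.succ) := by
  refine List.ext_getElem (by simp; omega) fun i h1 h2 => ?_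
  simp only [List.length_ofFn] at h1
  simp only [List.getElem_ofFn, full, List.getElem_append, List.length_reverse,
    List.length_ofFn, List.getElem_reverse, List.getElem_cons]
  split_ifs with h h' <;> congr 1 <;> congr 1 <;> ext <;> simp <;> omega

/-- The derivative of `F` at `Ψ` in the direction `v`. -/
def dF {d : ℕ} (Ψ v : Fin (d + 1) → ℝ) (j : Fin (d + 1)) : ℝ :=
  foldCoeff d (dcolPoly (List.ofFn fun k => (full Ψ k, full v k))).2 j

theorem hasDerivAt_F {d : ℕ} (Ψ v : Fin (d + 1) → ℝ) (j : Fin (d + 1)) (t : ℝ) :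
    HasDerivAt (fun t => F (Ψ + t • v) j) (dF (Ψ + t • v) v j) t := by
  have h := fun k => (hasDerivAt_colPoly (List.ofFn fun k => (full Ψ k, full v k)) t k).2
  simp only [List.map_ofFn, Function.comp_def] at h
  have e : ∀ t k, full Ψ k + t * full v k = full (Ψ + t • v) k := fun t k => by simp [full]
  simp only [e] at h
  simp only [F_eq, dF, foldCoeff]
  split_ifs
  · exact h d
  · exact (h _).add (h _)

/-- The derivative splits into the outer directions (`dmajorized_dcolPoly_center`) and the middle
one (`dcolPoly_center`). Each outer entry occurs twice in the full sequence and the middle one once.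
Halving therefore gives the factor `1 - margin` for the tail, but only `1 - margin / 2` for the
first entry. -/
theorem sum_abs_dF_le {d : ℕ} {Ψ v : Fin (d + 1) → ℝ} (h : |Ψ 0| ≤ 1.1) :
    ∑ j, |v j - dF Ψ v j / 2| ≤ |v 0| * (1 - margin |Ψ 0| (2 * tailSum Ψ) / 2) +
      tailSum v * (1 - margin |Ψ 0| (2 * tailSum Ψ)) := by
  obtain ⟨hc, hs, hc'⟩ := abs_cos_sin_of_abs_le h
  set L : List (ℝ × ℝ) := List.ofFn fun j : Fin d => (Ψ j.succ, v j.succ) with hL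
  have hL1 : L.map Prod.fst = outer Ψ := by simp [hL, List.map_ofFn, outer, Function.comp_def]
  have hL2 : L.map Prod.snd = outer v := by simp [hL, List.map_ofFn, outer, Function.comp_def]
  have hlΨ : (outer Ψ).reverse.length = d := by simp [outer]
  have h1 := (dmajorized_dcolPoly_center L.reverse L (Ψ 0)).snd
  have h2 := (majorized_colPoly_center (outer Ψ).reverse (outer Ψ) (Ψ 0 + Real.pi / 2)).snd
  have hlin := cnorm_linPoly_le ((outer Ψ).reverse ++ 0 :: outer Ψ)
  have hd := dcolPoly_center L.reverse L (Ψ 0) (v 0)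
  rw [absSum_append, absSum_cons, abs_zero, zero_add, absSum_reverse, absSum_outer,
    ← two_mul] at hlin
  rw [List.map_reverse, List.map_reverse, hL1, hL2, absSum_reverse, absSum_reverse, absSum_outer,
    absSum_outer, ← two_mul, ← two_mul, hc, hs] at h1
  rw [absSum_reverse, absSum_outer, ← two_mul, hlΨ, Real.cos_add_pi_div_two,
    Real.sin_add_pi_div_two, abs_neg, hc, hs] at h2
  rw [List.map_reverse, hL1, ← ofFn_full_pair] at hd
  set y := 2 * tailSum Ψ
  set P1 := (dcolPoly (L.reverse ++ (Ψ 0, 0) :: L)).2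
  set P2 := (colPoly ((outer Ψ).reverse ++ (Ψ 0 + Real.pi / 2) :: outer Ψ)).2
  set Λ := linPoly ((outer Ψ).reverse ++ 0 :: outer Ψ)
  set Λv := linPoly ((outer v).reverse ++ 0 :: outer v) with hΛv
  have hs0 : 0 ≤ Real.sin |Ψ 0| := hs ▸ abs_nonneg _
  -- The linear part `-sin ψ₀ Λ` is counted as error here: its norm, at most `sin |ψ₀| * y`,
  -- completes `sinh y - y` to `sinh y`.
  have h3 : cnorm (P2 - C (Real.cos (Ψ 0)) * X ^ d) ≤
      Real.cos |Ψ 0| * (Real.cosh y - 1) + Real.sin |Ψ 0| * Real.sinh y := by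
    have e : P2 - C (Real.cos (Ψ 0)) * X ^ d =
        (P2 - (C (Real.cos (Ψ 0)) * X ^ d + C (-Real.sin (Ψ 0)) * Λ)) +
          C (-Real.sin (Ψ 0)) * Λ := by ring
    rw [e]
    refine (cnorm_add_le _ _).trans ?_
    rw [cnorm_C_mul, abs_neg, hs]
    have := mul_le_mul_of_nonneg_left hlin hs0
    linarith
  set E := (P1 - C (Real.cos (Ψ 0)) * Λv) + C (v 0) * (P2 - C (Real.cos (Ψ 0)) * X ^ d) with hE
  have hEn : cnorm E ≤ (2 * tailSum v + |v 0|) *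
      (Real.cos |Ψ 0| * (Real.cosh y - 1) + Real.sin |Ψ 0| * Real.sinh y) := by
    refine (cnorm_add_le _ _).trans ?_
    rw [cnorm_C_mul]
    have := mul_le_mul_of_nonneg_left h3 (abs_nonneg (v 0))
    linarith
  have hdF : ∀ j, dF Ψ v j = foldCoeff d E j +
      if j = 0 then v 0 * Real.cos (Ψ 0) else 2 * Real.cos (Ψ 0) * v j := by
    intro j
    have e : (dcolPoly (List.ofFn fun k => (full Ψ k, full v k))).2 =
        E + (C (v 0 * Real.cos (Ψ 0)) * X ^ d + C (Real.cos (Ψ 0)) * Λv) := by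
      rw [hd, hE, map_mul, Prod.snd_add]; ring
    rw [dF, e, foldCoeff_add, hΛv, foldCoeff_target]
  have hEs := (sum_abs_foldCoeff_le d E).trans hEn
  rw [Fin.sum_univ_succ] at hEs ⊢
  have hc0 : 0 ≤ Real.cos |Ψ 0| := hc ▸ abs_nonneg _
  have hc1 := Real.cos_le_one |Ψ 0|
  have t0 : |v 0 - dF Ψ v 0 / 2| ≤ |v 0| * (1 - Real.cos |Ψ 0| / 2) + |foldCoeff d E 0| / 2 := by
    rw [hdF, if_pos rfl, hc']
    have e : v 0 - (foldCoeff d E ((0 : Fin (d + 1)) : ℕ) + v 0 * Real.cos |Ψ 0|) / 2 =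
      v 0 * (1 - Real.cos |Ψ 0| / 2) + -(foldCoeff d E 0 / 2) := by
        rw [Fin.val_zero]; ring
    rw [e]
    refine (abs_add_le _ _).trans (le_of_eq ?_)
    rw [abs_neg, abs_div, abs_two, abs_mul, abs_of_nonneg (a := 1 - _) (by linarith)]
  have tj : ∑ j : Fin d, |v j.succ - dF Ψ v j.succ / 2| ≤
      tailSum v * (1 - Real.cos |Ψ 0|) + (∑ j : Fin d, |foldCoeff d E (j.succ : Fin (d + 1))|) / 2 := by
    rw [tailSum, Finset.sum_mul, Finset.sum_div, ← Finset.sum_add_distrib]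
    refine Finset.sum_le_sum fun j _ => ?_
    rw [hdF, if_neg (Fin.succ_ne_zero j), hc']
    have e : v j.succ - (foldCoeff d E (j.succ : Fin (d + 1)) + 2 * Real.cos |Ψ 0| * v j.succ) / 2 =
      v j.succ * (1 - Real.cos |Ψ 0|) + -(foldCoeff d E (j.succ : Fin (d + 1)) / 2) := by ring
    rw [e]
    refine (abs_add_le _ _).trans (le_of_eq ?_)
    rw [abs_neg, abs_div, abs_two, abs_mul, abs_of_nonneg (a := 1 - _) (by linarith)]
  unfold margin
  rw [Fin.val_zero] at hEs
  linarith

theorem convex_region {d : ℕ} (fhat : Fin (d + 1) → ℝ) : Convex ℝ (region fhat) := by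
  intro x hx y hy a b ha hb hab
  have h0 : |(a • x + b • y) 0| ≤ a * |x 0| + b * |y 0| := by
    simp only [Pi.add_apply, Pi.smul_apply, smul_eq_mul]
    refine (abs_add_le _ _).trans (le_of_eq ?_)
    rw [abs_mul, abs_mul, abs_of_nonneg ha, abs_of_nonneg hb]
  have ht : tailSum (a • x + b • y) ≤ a * tailSum x + b * tailSum y := by
    rw [tailSum, tailSum, tailSum, Finset.mul_sum, Finset.mul_sum, ← Finset.sum_add_distrib]
    refine Finset.sum_le_sum fun j _ => ?_
    simp only [Pi.add_apply, Pi.smul_apply, smul_eq_mul]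
    refine (abs_add_le _ _).trans (le_of_eq ?_)
    rw [abs_mul, abs_mul, abs_of_nonneg ha, abs_of_nonneg hb]
  obtain ⟨-, -, x1, x2, x3⟩ := hx
  obtain ⟨-, -, y1, y2, y3⟩ := hy
  have hb' : b = 1 - a := by linarith
  refine ⟨abs_nonneg _, mul_nonneg zero_le_two (tailSum_nonneg _), ?_, ?_, ?_⟩
  · have := mul_le_mul_of_nonneg_left x1 ha
    have := mul_le_mul_of_nonneg_left y1 hb
    subst hb'; linarith
  · have := mul_le_mul_of_nonneg_left x2 ha
    have := mul_le_mul_of_nonneg_left y2 hb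
    subst hb'; linarith
  · have := mul_le_mul_of_nonneg_left x3 ha
    have := mul_le_mul_of_nonneg_left y3 hb
    subst hb'; linarith

theorem l1_fpStep_sub_le {d : ℕ} {fhat f' Ψ Ψ' : Fin (d + 1) → ℝ} (hf : l1 fhat ≤ 0.861)
    (hΨ : Ψ ∈ region fhat) (hΨ' : Ψ' ∈ region fhat) :
    l1 (fpStep f' Ψ' - fpStep f' Ψ) ≤ 0.985 * l1 (Ψ' - Ψ) := by
  set v := Ψ' - Ψ with hv
  have hs0 := abs_nonneg (fhat 0)
  have hs1 : |fhat 0| ≤ 0.861 := by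
    rw [l1_eq] at hf; linarith [tailSum_nonneg fhat]
  -- Pairing with the signs of the final difference turns its `ℓ¹` norm into the increment of a
  -- scalar function on the segment, to which the mean value inequality applies.
  set σ : Fin (d + 1) → ℝ := fun j => SignType.sign ((fpStep f' Ψ' - fpStep f' Ψ) j) with hσ
  have hσ1 : ∀ j, |σ j| ≤ 1 := fun j => by
    rw [hσ]
    rcases lt_trichotomy ((fpStep f' Ψ' - fpStep f' Ψ) j) 0 with h | h | h
    · simp only [sign_neg h]; simp
    · simp only [h]; simp
    · simp only [sign_pos h]; simp
  have hder : ∀ t : ℝ, HasDerivAt (fun t : ℝ => ∑ j, σ j * fpStep f' (Ψ + t • v) j)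
      (∑ j, σ j * (v j - dF (Ψ + t • v) v j / 2)) t := by
    intro t
    refine HasDerivAt.fun_sum fun j _ => HasDerivAt.const_mul (σ j) ?_
    have h1 : HasDerivAt (fun t : ℝ => (Ψ j + t * v j) - (1 / 2) * (F (Ψ + t • v) j - f' j))
        (1 * v j - (1 / 2) * dF (Ψ + t • v) v j) t :=
      (((hasDerivAt_id t).mul_const (v j)).const_add (Ψ j)).sub
        (((hasDerivAt_F Ψ v j t).sub_const (f' j)).const_mul (1 / 2))
    exact h1.congr_deriv (by ring)
  have hmv := norm_image_sub_le_of_norm_deriv_le_segment_01' (C := 0.985 * l1 v)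
    (fun t _ => (hder t).hasDerivWithinAt) (fun t ht => ?_)
  · rw [one_smul, zero_smul, add_zero, hv, add_sub_cancel, ← hv, Real.norm_eq_abs] at hmv
    refine le_trans (le_trans (le_of_eq ?_) (le_abs_self _)) hmv
    rw [l1, ← Finset.sum_sub_distrib]
    refine Finset.sum_congr rfl fun j _ => ?_
    rw [← mul_sub, ← Pi.sub_apply, hσ, sign_mul_self]
  · have hm : Ψ + t • v ∈ region fhat := by
      have := convex_region fhat hΨ hΨ' (sub_nonneg.2 ht.2.le) ht.1 (by ring)
      convert this using 1
      rw [hv, smul_sub, sub_smul, one_smul]; abel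
    have hp : |(Ψ + t • v) 0| ≤ 1.1 := by have := hm.p_le; linarith
    have hmar := hm.margin_ge hs0 hs1
    rw [Real.norm_eq_abs]
    refine (Finset.abs_sum_le_sum_abs _ _).trans ?_
    refine (Finset.sum_le_sum (g := fun j => |v j - dF (Ψ + t • v) v j / 2|)
      fun j _ => ?_).trans ?_
    · rw [abs_mul]
      exact mul_le_of_le_one_left (abs_nonneg _) (hσ1 j)
    · refine (sum_abs_dF_le hp).trans ?_
      rw [l1_eq]
      have := mul_le_mul_of_nonneg_left hmar (abs_nonneg (v 0))
      have := mul_le_mul_of_nonneg_left hmar (tailSum_nonneg v)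
      have := tailSum_nonneg v
      linarith

/-! ### Existence of the maximal solution and convergence -/

theorem l1_nonneg {d : ℕ} (v : Fin (d + 1) → ℝ) : 0 ≤ l1 v :=
  Finset.sum_nonneg fun _ _ => abs_nonneg _

theorem l1_add_le {d : ℕ} (v w : Fin (d + 1) → ℝ) : l1 (v + w) ≤ l1 v + l1 w := by
  rw [l1, l1, l1, ← Finset.sum_add_distrib]
  exact Finset.sum_le_sum fun j _ => abs_add_le _ _

theorem l1_smul {d : ℕ} (a : ℝ) (v : Fin (d + 1) → ℝ) : l1 (a • v) = |a| * l1 v := by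
  simp [l1, Finset.mul_sum, abs_mul]

theorem l1_sub_le {d : ℕ} (a b c : Fin (d + 1) → ℝ) : l1 (a - c) ≤ l1 (a - b) + l1 (b - c) := by
  have := l1_add_le (a - b) (b - c)
  rwa [sub_add_sub_cancel] at this

theorem norm_le_l1 {d : ℕ} (v : Fin (d + 1) → ℝ) : ‖v‖ ≤ l1 v := by
  refine (pi_norm_le_iff_of_nonneg (l1_nonneg v)).2 fun j => ?_
  exact Finset.single_le_sum (f := fun j => |v j|) (fun _ _ => abs_nonneg _) (Finset.mem_univ j)

theorem continuous_l1 {d : ℕ} : Continuous (l1 : (Fin (d + 1) → ℝ) → ℝ) := by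
  unfold l1; fun_prop

theorem isClosed_region {d : ℕ} (fhat : Fin (d + 1) → ℝ) : IsClosed (region fhat) := by
  have h : region fhat = {Ψ | |Ψ 0| ≤ 0.22 + |fhat 0|} ∩
      ({Ψ | 2 * tailSum Ψ ≤ 1.26 - 0.95 * |fhat 0|} ∩
        {Ψ | 2 * |Ψ 0| + 2 * tailSum Ψ ≤ 1.33 + 1.05 * |fhat 0|}) := by
    ext Ψ
    exact ⟨fun h => ⟨h.3, h.4, h.5⟩, fun h => ⟨abs_nonneg _,
      mul_nonneg zero_le_two (tailSum_nonneg _), h.1, h.2.1, h.2.2⟩⟩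
  rw [h]
  unfold tailSum
  refine (isClosed_le (by fun_prop) (by fun_prop)).inter
    ((isClosed_le (by fun_prop) (by fun_prop)).inter (isClosed_le (by fun_prop) (by fun_prop)))

theorem l1_le_of_mem_region {d : ℕ} {fhat Ψ : Fin (d + 1) → ℝ} (hf : l1 fhat ≤ 0.861)
    (h : Ψ ∈ region fhat) : l1 Ψ ≤ 1.5 := by
  have := h.5
  rw [l1_eq] at hf ⊢
  have := tailSum_nonneg fhat
  have := h.3
  have := tailSum_nonneg Ψ
  linarith

theorem zero_mem_region {d : ℕ} {fhat : Fin (d + 1) → ℝ} (hf : l1 fhat ≤ 0.861) :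
    0 ∈ region fhat := by
  have h0 := abs_nonneg (fhat 0)
  have ht := tailSum_nonneg fhat
  rw [l1_eq] at hf
  have e : tailSum (0 : Fin (d + 1) → ℝ) = 0 := by simp [tailSum]
  refine ⟨abs_nonneg _, by rw [e, mul_zero], ?_, ?_, ?_⟩ <;>
    simp only [Pi.zero_apply, abs_zero, e] <;> linarith

theorem fpi_mem_region {d : ℕ} {fhat : Fin (d + 1) → ℝ} (hf : l1 fhat ≤ 0.861) (k : ℕ) :
    fpi fhat k ∈ region fhat := by
  induction k with
  | zero => exact zero_mem_region hf
  | succ k ih => exact fpStep_mem_region hf (by norm_num [l1]) ih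

theorem exists_fixedPoint {d : ℕ} {fhat : Fin (d + 1) → ℝ} (hf : l1 fhat ≤ 0.861) :
    ∃ Ψ ∈ region fhat, fpStep fhat Ψ = Ψ := by
  have hdist : ∀ k, l1 (fpi fhat (k + 1) - fpi fhat k) ≤ l1 (fpi fhat 1) * 0.985 ^ k := by
    intro k
    induction k with
    | zero => simp [fpi]
    | succ k ih =>
      have := l1_fpStep_sub_le (f' := fhat) hf (fpi_mem_region hf k) (fpi_mem_region hf (k + 1))
      refine this.trans ?_
      rw [pow_succ]; linarith
  have hc : CauchySeq (fpi fhat) := by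
    refine cauchySeq_of_le_geometric 0.985 (l1 (fpi fhat 1)) (by norm_num) fun k => ?_
    rw [dist_comm, dist_eq_norm]
    exact (norm_le_l1 _).trans (hdist k)
  obtain ⟨Ψ, hΨ⟩ := cauchySeq_tendsto_of_complete hc
  have hm : Ψ ∈ region fhat :=
    (isClosed_region fhat).mem_of_tendsto hΨ (Filter.Eventually.of_forall (fpi_mem_region hf))
  refine ⟨Ψ, hm, ?_⟩
  have h1 : Filter.Tendsto (fun k => 0.985 * l1 (fpi fhat k - Ψ)) Filter.atTop (nhds 0) := by
    have := ((continuous_l1.tendsto _).comp (hΨ.sub_const Ψ)).const_mul (0.985 : ℝ)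
    simpa [l1] using this
  have h2 : Filter.Tendsto (fun k => fpi fhat (k + 1)) Filter.atTop (nhds (fpStep fhat Ψ)) := by
    rw [tendsto_iff_norm_sub_tendsto_zero]
    refine squeeze_zero (fun _ => norm_nonneg _) (fun k => ?_) h1
    exact (norm_le_l1 _).trans (l1_fpStep_sub_le (f' := fhat) hf hm (fpi_mem_region hf k))
  exact tendsto_nhds_unique h2 ((Filter.tendsto_add_atTop_iff_nat 1).2 hΨ)

theorem l1_fpi_sub_le {d : ℕ} {fhat Ψ : Fin (d + 1) → ℝ} (hf : l1 fhat ≤ 0.861)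
    (hΨ : Ψ ∈ region fhat) (hfix : fpStep fhat Ψ = Ψ) (k : ℕ) :
    l1 (fpi fhat k - Ψ) ≤ 1.5 * 0.985 ^ k := by
  induction k with
  | zero =>
    rw [fpi, zero_sub, pow_zero, mul_one, ← neg_one_smul ℝ, l1_smul]
    simpa using l1_le_of_mem_region hf hΨ
  | succ k ih =>
    have := l1_fpStep_sub_le (f' := fhat) hf hΨ (fpi_mem_region hf k)
    rw [hfix] at this
    refine this.trans ?_
    rw [pow_succ]; linarith

/-- The distance `δ / 0.015` reproduces itself, because `0.985 * (δ / 0.015) + δ = δ / 0.015`. -/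
theorem perturbed_step {d : ℕ} {fhat Ψ Ψ₁ Ψ₁' : Fin (d + 1) → ℝ} {δ : ℝ} (hf : l1 fhat ≤ 0.861)
    (hδ : δ ≤ 0.00025) (hΨ : Ψ ∈ region fhat) (hΨ₁ : Ψ₁ ∈ region fhat)
    (h : l1 (Ψ₁ - Ψ) ≤ δ / 0.015) (h' : l1 (Ψ₁' - fpStep fhat Ψ₁) ≤ δ) :
    Ψ₁' ∈ region fhat ∧ l1 (Ψ₁' - fpStep fhat Ψ) ≤ δ / 0.015 := by
  constructor
  · have e : Ψ₁' = fpStep (fhat + (2 : ℝ) • (Ψ₁' - fpStep fhat Ψ₁)) Ψ₁ := by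
      ext j; simp [fpStep]; ring
    rw [e]
    refine fpStep_mem_region hf ?_ hΨ₁
    rw [add_sub_cancel_left, l1_smul, abs_two]
    linarith
  · have h1 := l1_sub_le Ψ₁' (fpStep fhat Ψ₁) (fpStep fhat Ψ)
    have h2 := l1_fpStep_sub_le (f' := fhat) hf hΨ hΨ₁
    have : δ = 0.015 * (δ / 0.015) := by ring
    linarith

/-- The only delicate point is outerness: a positive margin says that `P₁ - cos ψ₀` has coefficient
norm below `cos ψ₀`, so `P₁` has no zero in the closed unit disc. -/
theorem isMaximalSolution_of_fixedPoint {d : ℕ} {fhat Ψ : Fin (d + 1) → ℝ} (hf : l1 fhat ≤ 0.861)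
    (hΨ : Ψ ∈ region fhat) (hfix : fpStep fhat Ψ = Ψ) :
    IsMaximalSolution (chebSum fhat) Ψ := by
  have hs0 := abs_nonneg (fhat 0)
  have hs1 : |fhat 0| ≤ 0.861 := by
    rw [l1_eq] at hf; linarith [tailSum_nonneg fhat]
  have hp : |Ψ 0| ≤ 1.1 := by have := hΨ.p_le; linarith
  have hπ := Real.pi_gt_three
  have hlt : ∀ j, |Ψ j| < Real.pi / 2 := by
    intro j
    refine Fin.cases (by linarith) (fun i => ?_) j
    have h1 : |Ψ i.succ| ≤ tailSum Ψ :=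
      Finset.single_le_sum (f := fun i : Fin d => |Ψ i.succ|) (fun _ _ => abs_nonneg _)
        (Finset.mem_univ i)
    have := hΨ.y_le
    linarith
  have hF : F Ψ = fhat := by
    have h1 : (1 / 2 : ℝ) • (F Ψ - fhat) = 0 := by
      rw [fpStep] at hfix; simpa using hfix
    rw [smul_eq_zero] at h1
    exact sub_eq_zero.1 (h1.resolve_left (by norm_num))
  refine ⟨hlt, fun x hx => by rw [g_full_eq Ψ hx, hF], fun z hz => ?_⟩
  have hz0 : z ≠ 0 := by rintro rfl; simp at hz; linarith
  rw [nlft_zero_zero (full Ψ) (fun k => hlt _) hz0, ofFn_full]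
  have hm := (majorized_colPoly_center (outer Ψ).reverse (outer Ψ) (Ψ 0)).fst
  obtain ⟨hc, hs, hc'⟩ := abs_cos_sin_of_abs_le hp
  rw [absSum_reverse, absSum_outer, ← two_mul, hc, hs] at hm
  have hmar := hΨ.margin_ge hs0 hs1
  have hn := abs_aeval_le_cnorm ((colPoly ((outer Ψ).reverse ++ Ψ 0 :: outer Ψ)).1 -
    C (Real.cos (Ψ 0))) (z := z⁻¹) (by rw [norm_inv]; exact inv_le_one_of_one_le₀ hz.le)
  intro h0
  rw [map_sub, h0, aeval_C, zero_sub, norm_neg] at hn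
  have : ‖(algebraMap ℝ ℂ) (Real.cos (Ψ 0))‖ = Real.cos |Ψ 0| := by
    rw [norm_algebraMap', Real.norm_eq_abs, hc]
  unfold margin at hmar
  linarith

/-! ### Total correctness with cost bounds -/

/-- Started in `s`, the program halts after at most `T` operations in a state satisfying `Q`. -/
def Ends {u : ℝ} (A : Arith u) (P : Prog) (s : State) (T : ℕ) (Q : State → Prop) : Prop :=
  ∃ s' t, Exec A P s s' t ∧ t ≤ T ∧ Q s'

namespace Ends

variable {u : ℝ} {A : Arith u} {P P' : Prog} {s : State} {T T' : ℕ} {Q R : State → Prop}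

theorem mono (h : Ends A P s T Q) (hT : T ≤ T') (hQ : ∀ s', Q s' → R s') : Ends A P s T' R := by
  obtain ⟨s', t, h1, h2, h3⟩ := h
  exact ⟨s', t, h1, h2.trans hT, hQ _ h3⟩

theorem seq (h : Ends A P s T Q) (h' : ∀ s', Q s' → Ends A P' s' T' R) :
    Ends A (.seq P P') s (T + T') R := by
  obtain ⟨s', t, h1, h2, h3⟩ := h
  obtain ⟨s'', t', h1', h2', h3'⟩ := h' s' h3
  exact ⟨s'', t + t', h1.seq h1', add_le_add h2 h2', h3'⟩

theorem skip (hQ : Q s) : Ends A .skip s 1 Q := ⟨s, 1, .skip s, le_rfl, hQ⟩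

theorem setReg {r : ℕ} {e : NExpr} (hQ : Q (s.setReg r (e.eval s))) :
    Ends A (.setReg r e) s (e.cost + 1) Q := ⟨_, _, .setReg s r e, le_rfl, hQ⟩

theorem store {a : ℕ} {i : NExpr} {e : RExpr} (hQ : Q (s.store a (i.eval s) (e.eval A s))) :
    Ends A (.store a i e) s (i.cost + e.cost + 1) Q := ⟨_, _, .store s a i e, le_rfl, hQ⟩

theorem ite {b : Test} (h : b.holds A s → Ends A P s T Q) (h' : ¬ b.holds A s → Ends A P' s T Q) :
    Ends A (.ite b P P') s (b.cost + T) Q := by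
  by_cases hb : b.holds A s
  · obtain ⟨s', t, h1, h2, h3⟩ := h hb
    exact ⟨s', _, .ite_true hb h1, by omega, h3⟩
  · obtain ⟨s', t, h1, h2, h3⟩ := h' hb
    exact ⟨s', _, .ite_false hb h1, by omega, h3⟩

/-- A loop with a known number `n` of iterations. -/
theorem while_count {b : Test} (n : ℕ) (I : ℕ → State → Prop) (h0 : I 0 s)
    (hstep : ∀ k < n, ∀ s, I k s → b.holds A s ∧ Ends A P s T (I (k + 1)))
    (hend : ∀ s, I n s → ¬ b.holds A s) :
    Ends A (.while b P) s (n * (b.cost + T) + b.cost) (I n) := by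
  suffices h : ∀ k, k ≤ n → ∀ s, I (n - k) s →
      Ends A (.while b P) s (k * (b.cost + T) + b.cost) (I n) by
    exact h n le_rfl s (by simpa using h0)
  intro k
  induction k with
  | zero =>
    intro _ s hs
    exact ⟨s, _, .while_false (hend s (by simpa using hs)), by simp, by simpa using hs⟩
  | succ k ih =>
    intro hk s hs
    obtain ⟨hb, s', t, h1, h2, h3⟩ := hstep (n - (k + 1)) (by omega) s hs
    rw [show n - (k + 1) + 1 = n - k by omega] at h3
    obtain ⟨s'', t', h1', h2', h3'⟩ := ih (by omega) s' h3
    refine ⟨s'', _, .while_true hb h1 h1', ?_, h3'⟩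
    rw [Nat.succ_mul]; omega

end Ends

/-! ### Loops over an index range -/

/-- The instruction `arr[idx] := val`. -/
structure Store where
  arr : ℕ
  idx : NExpr
  val : RExpr

def Store.cost (st : Store) : ℕ := st.idx.cost + st.val.cost + 1

/-- The arrays an expression reads. -/
def RExpr.arrays : RExpr → List ℕ
  | .load a _ => [a]
  | .ofNat _ => []
  | .pi => []
  | .add e₁ e₂ => e₁.arrays ++ e₂.arrays
  | .sub e₁ e₂ => e₁.arrays ++ e₂.arrays
  | .mul e₁ e₂ => e₁.arrays ++ e₂.arrays
  | .div e₁ e₂ => e₁.arrays ++ e₂.arrays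
  | .sin e => e.arrays
  | .cos e => e.arrays

theorem NExpr.eval_congr {s s' : State} (h : s.reg = s'.reg) (e : NExpr) :
    e.eval s = e.eval s' := by
  induction e <;> simp_all [NExpr.eval]

theorem RExpr.eval_congr {u : ℝ} {A : Arith u} {s s' : State} (h : s.reg = s'.reg) (e : RExpr)
    (hm : ∀ a ∈ e.arrays, s.mem a = s'.mem a) : e.eval A s = e.eval A s' := by
  induction e with
  | load a i => simp [RExpr.eval, NExpr.eval_congr h i, hm a (by simp [RExpr.arrays])]
  | ofNat e => simp [RExpr.eval, NExpr.eval_congr h e]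
  | pi => rfl
  | add e₁ e₂ h₁ h₂ | sub e₁ e₂ h₁ h₂ | mul e₁ e₂ h₁ h₂ | div e₁ e₂ h₁ h₂ =>
    simp only [RExpr.eval]
    rw [h₁ fun a ha => hm a (by simp [RExpr.arrays, ha]),
      h₂ fun a ha => hm a (by simp [RExpr.arrays, ha])]
  | sin e h₁ | cos e h₁ =>
    simp only [RExpr.eval]
    rw [h₁ fun a ha => hm a (by simpa [RExpr.arrays] using ha)]

/-- Perform the given stores in order. -/
def storesProg : List Store → Prog
  | [] => .skip
  | st :: l => .seq (.store st.arr st.idx st.val) (storesProg l)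

def storesCost (l : List Store) : ℕ := (l.map Store.cost).sum + 1

/-- The stores do not write into the arrays that are read. -/
def Separate (l : List Store) : Prop :=
  ∀ st ∈ l, ∀ st' ∈ l, st'.arr ∉ st.val.arrays

/-- `tgt` prescribes a value for every location, so a location may be written repeatedly as long as
the values agree. By `Separate` every value can be computed in the state `s₀`. The larger list `L`
stays fixed in the induction and covers stores already performed. -/
theorem ends_storesProg {u : ℝ} {A : Arith u} (L l : List Store) (hl : ∀ st ∈ l, st ∈ L)
    (hsep : Separate L) (s₀ s : State) (hreg : s.reg = s₀.reg)
    (hmem : ∀ a, (∀ st ∈ L, st.arr ≠ a) → s.mem a = s₀.mem a) (tgt : ℕ → ℕ → ℝ)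
    (htgt : ∀ st ∈ L, st.val.eval A s₀ = tgt st.arr (st.idx.eval s₀)) :
    Ends A (storesProg l) s (storesCost l) fun s' => s'.reg = s₀.reg ∧
      (∀ a p, (∃ st ∈ l, st.arr = a ∧ st.idx.eval s₀ = p) → s'.mem a p = tgt a p) ∧
      (∀ a p, (∀ st ∈ l, st.arr = a → st.idx.eval s₀ ≠ p) → s'.mem a p = s.mem a p) := by
  induction l generalizing s with
  | nil => exact Ends.skip ⟨hreg, by simp, by simp⟩
  | cons st l ih =>
    have hst := hl st (by simp)
    have hv : st.val.eval A s = tgt st.arr (st.idx.eval s₀) := by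
      rw [← htgt st hst]
      refine RExpr.eval_congr hreg _ fun a ha => hmem a fun st' h' e => ?_
      exact hsep st hst st' h' (e ▸ ha)
    have hi : st.idx.eval s = st.idx.eval s₀ := NExpr.eval_congr hreg _
    set s₁ := s.store st.arr (st.idx.eval s) (st.val.eval A s) with hs₁
    have h1 : ∀ a p, s₁.mem a p = if a = st.arr ∧ p = st.idx.eval s₀ then tgt a p else s.mem a p := by
      intro a p
      simp only [hs₁, State.store, hi, hv]
      by_cases ha : a = st.arr
      · subst ha
        by_cases hp : p = st.idx.eval s₀
        · subst hp; simp
        · simp [hp]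
      · simp [ha]
    have key := ih (fun st' h' => hl st' (by simp [h'])) s₁ hreg (fun a ha => by
      funext p
      rw [h1, if_neg (fun h => ha st hst h.1.symm)]
      exact congrFun (hmem a ha) p)
    have hseq := Ends.seq (Ends.store (A := A) (Q := fun s' => s' = s₁) (s := s) rfl)
      (fun s' (h : s' = s₁) => by rw [h]; exact key)
    refine hseq.mono ?_ fun s' h => ⟨h.1, fun a p hap => ?_, fun a p hap => ?_⟩
    · simp [storesCost, Store.cost]; omega
    · obtain ⟨-, h2, h3⟩ := h
      by_cases hq : ∃ st' ∈ l, st'.arr = a ∧ st'.idx.eval s₀ = p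
      · exact h2 a p hq
      · rw [h3 a p (fun st' h' e e' => hq ⟨st', h', e, e'⟩), h1, if_pos]
        obtain ⟨st', h', e, e'⟩ := hap
        rcases List.mem_cons.1 h' with rfl | h'
        · exact ⟨e.symm, e'.symm⟩
        · exact absurd ⟨st', h', e, e'⟩ hq
    · obtain ⟨-, h2, h3⟩ := h
      rw [h3 a p fun st' h' => hap st' (by simp [h']), h1, if_neg]
      rintro ⟨rfl, rfl⟩
      exact hap st (by simp) rfl rfl

/-- The largest multiple of `S` that is at most `i`. -/
def blockStart (S i : ℕ) : ℕ := S * (i / S)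

/-- The loop `for i < reg nr` over the given stores. Register `5` holds `i` and register `6` the
largest multiple of register `4` that is at most `i`. -/
def pass (nr : ℕ) (l : List Store) : Prog :=
  .seq (.setReg 5 (.lit 0)) (.seq (.setReg 6 (.lit 0))
    (.while (.nlt (.reg 5) (.reg nr))
      (.seq (storesProg l) (.seq (.setReg 5 (.add (.reg 5) (.lit 1)))
        (.ite (.nlt (.reg 5) (.add (.reg 6) (.reg 4))) .skip (.setReg 6 (.reg 5)))))))

/-- The state seen by the stores of `pass` in iteration `i`. -/
def atIter (s : State) (i : ℕ) : State := (s.setReg 5 i).setReg 6 (blockStart (s.reg 4) i)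

@[simp] theorem atIter_mem (s : State) (i : ℕ) : (atIter s i).mem = s.mem := rfl

theorem atIter_reg (s : State) (i r : ℕ) : (atIter s i).reg r =
    if r = 6 then blockStart (s.reg 4) i else if r = 5 then i else s.reg r := by
  simp only [atIter, State.setReg, Function.update_apply]

/-- The machine has no integer division; this recursion lets the loop maintain the block start by
one comparison. -/
theorem blockStart_succ {S : ℕ} (hS : 0 < S) (i : ℕ) :
    blockStart S (i + 1) = if i + 1 < blockStart S i + S then blockStart S i else i + 1 := by
  unfold blockStart
  have h1 := Nat.div_add_mod i S
  have h2 := Nat.mod_lt i hS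
  split_ifs with h
  · congr 1
    rw [Nat.div_eq_iff hS]
    constructor
    · rw [mul_comm]; omega
    · rw [mul_comm]; omega
  · have e : i + 1 = S * (i / S + 1) := by rw [mul_add]; omega
    rw [e, Nat.mul_div_cancel_left _ hS]

/-- No array is both read and written, so the whole loop acts like a simultaneous assignment
computed from the initial memory. -/
theorem ends_pass {u : ℝ} {A : Arith u} {nr : ℕ} (h5 : nr ≠ 5) (h6 : nr ≠ 6) {L : List Store}
    (hsep : Separate L) {s : State} (hS : 0 < s.reg 4) (tgt : ℕ → ℕ → ℝ)
    (htgt : ∀ i < s.reg nr, ∀ st ∈ L,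
      st.val.eval A (atIter s i) = tgt st.arr (st.idx.eval (atIter s i))) :
    Ends A (pass nr L) s (s.reg nr * (storesCost L + 20) + 20) fun s' =>
      (∀ r, r ≠ 5 → r ≠ 6 → s'.reg r = s.reg r) ∧
      (∀ i < s.reg nr, ∀ st ∈ L, s'.mem st.arr (st.idx.eval (atIter s i)) =
        tgt st.arr (st.idx.eval (atIter s i))) ∧
      (∀ a p, (∀ i < s.reg nr, ∀ st ∈ L, st.arr = a → st.idx.eval (atIter s i) ≠ p) →
        s'.mem a p = s.mem a p) := by
  let I : ℕ → State → Prop := fun k s' => s'.reg = (atIter s k).reg ∧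
      (∀ i < k, ∀ st ∈ L, s'.mem st.arr (st.idx.eval (atIter s i)) =
        tgt st.arr (st.idx.eval (atIter s i))) ∧
      (∀ a p, (∀ i < k, ∀ st ∈ L, st.arr = a → st.idx.eval (atIter s i) ≠ p) →
        s'.mem a p = s.mem a p)
  have r5 : ∀ k, (atIter s k).reg 5 = k := fun k => by simp [atIter_reg]
  have r6 : ∀ k, (atIter s k).reg 6 = blockStart (s.reg 4) k := fun k => by simp [atIter_reg]
  have r4 : ∀ k, (atIter s k).reg 4 = s.reg 4 := fun k => by simp [atIter_reg]
  have rn : ∀ k, (atIter s k).reg nr = s.reg nr := fun k => by simp [atIter_reg, h5, h6]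
  have hbody : ∀ k < s.reg nr, ∀ s₁, I k s₁ →
      Ends A (.seq (storesProg L) (.seq (.setReg 5 (.add (.reg 5) (.lit 1)))
        (.ite (.nlt (.reg 5) (.add (.reg 6) (.reg 4))) .skip (.setReg 6 (.reg 5))))) s₁
        (storesCost L + 11) (I (k + 1)) := by
    rintro k hk s₁ ⟨h1, h2, h3⟩
    have hst := ends_storesProg (A := A) L L (fun _ h => h) hsep (atIter s k) s₁ h1
      (fun a ha => by
        funext p
        exact h3 a p fun i _ st hst e => absurd e (ha st hst)) tgt (htgt k hk)
    refine Ends.mono (Ends.seq hst (R := I (k + 1)) (T' := 11) ?_) le_rfl fun _ h => h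
    rintro s₂ ⟨g1, g2, g3⟩
    refine Ends.mono (Ends.seq (T' := 7) (Ends.setReg
      (Q := fun s' => s' = s₂.setReg 5 (k + 1)) (by simp [NExpr.eval, g1, r5])) ?_)
      (by simp [NExpr.cost]) fun _ h => h
    rintro s₃ rfl
    have hmem : ∀ s' : State, s'.mem = s₂.mem →
        (∀ i < k + 1, ∀ st ∈ L, s'.mem st.arr (st.idx.eval (atIter s i)) =
          tgt st.arr (st.idx.eval (atIter s i))) ∧
        (∀ a p, (∀ i < k + 1, ∀ st ∈ L, st.arr = a → st.idx.eval (atIter s i) ≠ p) →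
          s'.mem a p = s.mem a p) := by
      intro s' e
      constructor
      · intro i hi st hmem
        rw [e]
        by_cases hq : ∃ st' ∈ L, st'.arr = st.arr ∧
            st'.idx.eval (atIter s k) = st.idx.eval (atIter s i)
        · exact g2 _ _ hq
        · rw [g3 _ _ fun st' h' e e' => hq ⟨st', h', e, e'⟩]
          have : i ≠ k := by
            rintro rfl
            exact hq ⟨st, hmem, rfl, rfl⟩
          exact h2 i (by omega) st hmem
      · intro a p hap
        rw [e, g3 a p (hap k (by omega)), h3 a p fun i hi => hap i (by omega)]
    have hreg : ∀ s' : State, s'.reg = Function.update (Function.update s₂.reg 5 (k + 1)) 6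
        (blockStart (s.reg 4) (k + 1)) → s'.reg = (atIter s (k + 1)).reg := by
      intro s' e
      rw [e, g1]
      funext r
      simp only [Function.update_apply, atIter_reg]
      split_ifs <;> rfl
    have hbs := blockStart_succ hS k
    have hb : (Test.nlt (.reg 5) (.add (.reg 6) (.reg 4))).holds A (s₂.setReg 5 (k + 1)) ↔
        k + 1 < blockStart (s.reg 4) k + s.reg 4 := by
      simp [Test.holds, NExpr.eval, State.setReg, g1, r6, r4]
    refine Ends.mono (T := 7) (Ends.ite (T := 2) (fun h => ?_) fun h => ?_)
      (by simp) fun _ h => h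
    · refine Ends.mono (Ends.skip (Q := I (k + 1)) ⟨hreg _ ?_, hmem _ rfl⟩) (by norm_num)
        fun _ h => h
      rw [hbs, if_pos (hb.1 h)]
      funext r
      by_cases hr : r = 6
      · subst hr; simp [State.setReg, g1, r6]
      · simp [State.setReg, hr]
    · refine Ends.setReg (Q := I (k + 1)) ⟨hreg _ ?_, hmem _ rfl⟩
      rw [hbs, if_neg (fun h' => h (hb.2 h'))]
      simp [State.setReg, NExpr.eval]
  have hinit : Ends A (.seq (.setReg 5 (.lit 0)) (.setReg 6 (.lit 0))) s 4 (I 0) := by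
    refine Ends.seq (T := 2) (T' := 2)
      (Ends.setReg (e := .lit 0) (Q := fun s' => s' = s.setReg 5 0) rfl) ?_
    rintro _ rfl
    refine Ends.setReg (e := .lit 0) ⟨?_, by simp, fun a p _ => rfl⟩
    simp [atIter, NExpr.eval, blockStart]
  have hloop : ∀ s₀, I 0 s₀ → Ends A (.while (.nlt (.reg 5) (.reg nr))
      (.seq (storesProg L) (.seq (.setReg 5 (.add (.reg 5) (.lit 1)))
        (.ite (.nlt (.reg 5) (.add (.reg 6) (.reg 4))) .skip (.setReg 6 (.reg 5)))))) s₀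
      (s.reg nr * (3 + (storesCost L + 11)) + 3) (I (s.reg nr)) := by
    intro s₀ h0
    refine Ends.while_count (s.reg nr) I h0 (fun k hk s₁ h => ⟨?_, hbody k hk s₁ h⟩) fun s₁ h => ?_
    · simp only [Test.holds, NExpr.eval, h.1, r5, rn]; exact hk
    · simp only [Test.holds, NExpr.eval, h.1, r5, rn]; omega
  obtain ⟨s₀, t₀, e₀, ht₀, i₀⟩ := hinit
  obtain ⟨s₁, t₁, e₁, ht₁, i₁⟩ := hloop s₀ i₀
  cases e₀ with
  | seq ea eb =>
    refine ⟨s₁, _, ea.seq (eb.seq e₁), ?_, fun r q5 q6 => ?_, i₁.2.1, i₁.2.2⟩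
    · have : s.reg nr * (3 + (storesCost L + 11)) ≤ s.reg nr * (storesCost L + 20) :=
        Nat.mul_le_mul_left _ (by omega)
      omega
    · rw [i₁.1, atIter_reg, if_neg q6, if_neg q5]

/-! ### Propagation of rounding errors -/

/-- `xh` approximates `x`, which is bounded by `B`, with error at most `K u B`. -/
def Ap (u K B xh x : ℝ) : Prop := |x| ≤ B ∧ |xh - x| ≤ K * u * B

namespace Ap

variable {u K L B B' x y xh yh : ℝ} {A : Arith u}

theorem bound_nonneg (h : Ap u K B xh x) : 0 ≤ B := (abs_nonneg _).trans h.1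

theorem exact (hu : 0 ≤ u) (hK : 0 ≤ K) (h : |x| ≤ B) : Ap u K B x x :=
  ⟨h, by rw [sub_self, abs_zero]; have := (abs_nonneg _).trans h; positivity⟩

theorem mono (hu : 0 ≤ u) (h : Ap u K B xh x) (hKL : K ≤ L) (hL : 0 ≤ L) (hB : B ≤ B') :
    Ap u L B' xh x := by
  refine ⟨h.1.trans hB, h.2.trans ?_⟩
  have h0 := h.bound_nonneg
  gcongr

theorem abs_hat_le (h : Ap u K B xh x) (hK : K * u ≤ 1) : |xh| ≤ 2 * B := by
  have h1 := abs_add_le (xh - x) x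
  rw [sub_add_cancel] at h1
  have := mul_le_mul_of_nonneg_right hK h.bound_nonneg
  linarith [h.1, h.2]

theorem ofNat (A : Arith u) (n : ℕ) : Ap u 1 n (A.ofNat n) n :=
  ⟨by simp, by simpa using A.ofNat_err n⟩

theorem pi (hu : 0 ≤ u) (A : Arith u) : Ap u 1 4 A.pi Real.pi := by
  have h := A.pi_err
  have h4 := Real.pi_le_four
  rw [abs_of_pos Real.pi_pos] at h
  refine ⟨by rw [abs_of_pos Real.pi_pos]; exact h4, h.trans ?_⟩
  rw [one_mul]; gcongr

theorem add (hu : 0 ≤ u) (hx : Ap u K B xh x) (hy : Ap u K B' yh y) (hK : K * u ≤ 1) :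
    Ap u (K + 2) (B + B') (A.add xh yh) (x + y) := by
  refine ⟨(abs_add_le _ _).trans (add_le_add hx.1 hy.1), ?_⟩
  have e : A.add xh yh - (x + y) = (A.add xh yh - (xh + yh)) + ((xh - x) + (yh - y)) := by ring
  rw [e]
  have h1 := abs_add_three (A.add xh yh - (xh + yh)) (xh - x) (yh - y)
  rw [add_assoc] at h1
  have h2 : |xh + yh| ≤ 2 * B + 2 * B' := (abs_add_le _ _).trans (add_le_add (hx.abs_hat_le hK) (hy.abs_hat_le hK))
  have h3 := (A.add_err xh yh).trans (mul_le_mul_of_nonneg_left h2 hu)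
  linarith [hx.2, hy.2]

theorem sub (hu : 0 ≤ u) (hx : Ap u K B xh x) (hy : Ap u K B' yh y) (hK : K * u ≤ 1) :
    Ap u (K + 2) (B + B') (A.sub xh yh) (x - y) := by
  refine ⟨(abs_sub _ _).trans (add_le_add hx.1 hy.1), ?_⟩
  have e : A.sub xh yh - (x - y) = (A.sub xh yh - (xh - yh)) + ((xh - x) + -(yh - y)) := by ring
  rw [e]
  have h1 := abs_add_three (A.sub xh yh - (xh - yh)) (xh - x) (-(yh - y))
  rw [add_assoc, abs_neg (yh - y)] at h1
  have h2 : |xh - yh| ≤ 2 * B + 2 * B' := (abs_sub _ _).trans (add_le_add (hx.abs_hat_le hK) (hy.abs_hat_le hK))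
  have h3 := (A.sub_err xh yh).trans (mul_le_mul_of_nonneg_left h2 hu)
  linarith [hx.2, hy.2]

/-- As `K * u` and `L * u` are at most `1`, the computed factors are at most twice their bounds. The
second-order terms therefore only add constants, and the new constant is linear in `K` and `L`. -/
theorem mul (hu : 0 ≤ u) (hx : Ap u K B xh x) (hy : Ap u L B' yh y) (hK : K * u ≤ 1)
    (hL : L * u ≤ 1) : Ap u (2 * K + L + 4) (B * B') (A.mul xh yh) (x * y) := by
  have hB := hx.bound_nonneg
  have hB' := hy.bound_nonneg
  refine ⟨by rw [abs_mul]; exact mul_le_mul hx.1 hy.1 (abs_nonneg _) hB, ?_⟩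
  have e : A.mul xh yh - x * y =
      (A.mul xh yh - xh * yh) + ((xh - x) * yh + x * (yh - y)) := by ring
  rw [e]
  have h1 := abs_add_three (A.mul xh yh - xh * yh) ((xh - x) * yh) (x * (yh - y))
  rw [add_assoc, abs_mul (xh - x), abs_mul x (yh - y)] at h1
  have h2 : |xh * yh| ≤ (2 * B) * (2 * B') := by
    rw [abs_mul]
    exact mul_le_mul (hx.abs_hat_le hK) (hy.abs_hat_le hL) (abs_nonneg _) (by linarith)
  have h3 := (A.mul_err xh yh).trans (mul_le_mul_of_nonneg_left h2 hu)
  have h4 : |xh - x| * |yh| ≤ (K * u * B) * (2 * B') :=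
    mul_le_mul hx.2 (hy.abs_hat_le hL) (abs_nonneg _) ((abs_nonneg _).trans hx.2)
  have h5 : |x| * |yh - y| ≤ B * (L * u * B') := mul_le_mul hx.1 hy.2 (abs_nonneg _) hB
  linarith

theorem div_nat (hu : 0 ≤ u) (hu' : u ≤ 1 / 2) (hx : Ap u K B xh x) (hK : K * u ≤ 1) {n : ℕ}
    (hn : 0 < n) : Ap u (K + 8) (B / n) (A.div xh (A.ofNat n)) (x / n) := by
  have hB := hx.bound_nonneg
  have hn' : (0 : ℝ) < n := by exact_mod_cast hn
  have h1 := A.ofNat_err n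
  rw [abs_of_pos hn'] at h1
  set m := A.ofNat n
  have hm : (n : ℝ) / 2 ≤ m := by
    have := (abs_le.1 h1).1
    nlinarith
  have hm0 : 0 < m := by linarith
  refine ⟨by rw [abs_div, abs_of_pos hn']; gcongr; exact hx.1, ?_⟩
  have e : A.div xh m - x / n =
      (A.div xh m - xh / m) + ((xh - x) / n + xh * ((n - m) / (n * m))) := by
    field_simp; ring
  rw [e]
  have h2 := abs_add_three (A.div xh m - xh / m) ((xh - x) / n) (xh * ((n - m) / (n * m)))
  rw [add_assoc] at h2
  have hx2 := hx.abs_hat_le hK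
  have h3 : |xh / m| ≤ 4 * (B / n) := by
    rw [abs_div, abs_of_pos hm0, div_le_iff₀ hm0]
    have : 4 * (B / n) * (n / 2) ≤ 4 * (B / n) * m := by gcongr
    have e : 4 * (B / n) * (n / 2) = 2 * B := by field_simp; ring
    linarith
  have h4 := (A.div_err xh m hm0.ne').trans (mul_le_mul_of_nonneg_left h3 hu)
  have h5 : |(xh - x) / n| ≤ K * u * (B / n) := by
    rw [abs_div, abs_of_pos hn', ← mul_div_assoc]
    gcongr; exact hx.2
  have h6 : |xh * ((n - m) / (n * m))| ≤ 4 * u * (B / n) := by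
    rw [abs_mul, abs_div, abs_of_pos (mul_pos hn' hm0)]
    have : |(n : ℝ) - m| / (n * m) ≤ 2 * u / n := by
      rw [div_le_div_iff₀ (mul_pos hn' hm0) hn', abs_sub_comm]
      have h8 : |m - n| * n ≤ u * n * n := by gcongr
      have h9 : u * n * (n / 2) ≤ u * n * m := by gcongr
      linarith
    calc |xh| * (|(n : ℝ) - m| / (n * m)) ≤ (2 * B) * (2 * u / n) := by
          refine mul_le_mul hx2 this (by positivity) (by linarith)
      _ = 4 * u * (B / n) := by ring
  linarith

/-- The cosine is `1`-Lipschitz, so the absolute error of the argument is passed on, while the bound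
on the value becomes `1`. -/
theorem cos (hu : 0 ≤ u) (hx : Ap u K B xh x) :
    Ap u (K * B + 1) 1 (A.cos xh) (Real.cos x) := by
  refine ⟨Real.abs_cos_le_one _, ?_⟩
  have h1 := A.cos_err xh
  have h2 := mul_le_mul_of_nonneg_left (Real.abs_cos_le_one xh) hu
  have h3 := Real.abs_cos_sub_cos_le xh x
  have h4 := abs_add_le (A.cos xh - Real.cos xh) (Real.cos xh - Real.cos x)
  rw [sub_add_sub_cancel] at h4
  linarith [hx.2]

theorem sin (hu : 0 ≤ u) (hx : Ap u K B xh x) :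
    Ap u (K * B + 1) 1 (A.sin xh) (Real.sin x) := by
  refine ⟨Real.abs_sin_le_one _, ?_⟩
  have h1 := A.sin_err xh
  have h2 := mul_le_mul_of_nonneg_left (Real.abs_sin_le_one xh) hu
  have h3 := Real.abs_sin_sub_sin_le xh x
  have h4 := abs_add_le (A.sin xh - Real.sin xh) (Real.sin xh - Real.sin x)
  rw [sub_add_sub_cancel] at h4
  linarith [hx.2]

end Ap

theorem Arith.ofNat_zero {u : ℝ} (A : Arith u) : A.ofNat 0 = 0 := by
  simpa using A.ofNat_err 0

/-! ### The fast Fourier transform -/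

/-- `e^{iπ b / H}`. -/
def twiddle (H b : ℕ) : ℂ := Complex.exp ((Real.pi * b / H : ℝ) * Complex.I)

/-- A stage of the forward transform of length `2 H`, with `S` interleaved vectors. -/
def fwdStage (H S : ℕ) (x : ℕ → ℂ) (p : ℕ) : ℂ :=
  if p % 2 = 0 then x (p / 2) + x (p / 2 + H)
  else twiddle H (blockStart S (p / 2)) * (x (p / 2) - x (p / 2 + H))

/-- The inverse of `fwdStage`. -/
def invStage (H S : ℕ) (y : ℕ → ℂ) (p : ℕ) : ℂ :=
  if p < H then
    (y (2 * p) + (starRingEnd ℂ) (twiddle H (blockStart S p)) * y (2 * p + 1)) / 2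
  else (y (2 * (p - H)) -
    (starRingEnd ℂ) (twiddle H (blockStart S (p - H))) * y (2 * (p - H) + 1)) / 2

/-- `t` stages of the forward transform. -/
def fwdIter (H S : ℕ) : ℕ → (ℕ → ℂ) → ℕ → ℂ
  | 0, x => x
  | t + 1, x => fwdStage H (2 ^ t * S) (fwdIter H S t x)

/-- `t` stages of the inverse transform. -/
def invIter (H : ℕ) : ℕ → (ℕ → ℂ) → ℕ → ℂ
  | 0, y => y
  | t + 1, y => invStage H (2 * H / 2 ^ (t + 1)) (invIter H t y)

theorem conj_twiddle_mul (H b : ℕ) : (starRingEnd ℂ) (twiddle H b) * twiddle H b = 1 := by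
  rw [twiddle, ← Complex.exp_conj, ← Complex.exp_add, map_mul, Complex.conj_ofReal, Complex.conj_I]
  simp

theorem twiddle_pow {H S : ℕ} (hS : 0 < S) (j n : ℕ) (hH : H = n * S) :
    twiddle H (S * j) = twiddle n 1 ^ j := by
  rcases Nat.eq_zero_or_pos n with rfl | hn
  · simp [twiddle, hH]
  rw [twiddle, twiddle, ← Complex.exp_nat_mul]
  congr 1
  have : (S : ℂ) ≠ 0 := by exact_mod_cast hS.ne'
  have : (n : ℂ) ≠ 0 := by exact_mod_cast hn.ne'
  subst hH
  push_cast
  field_simp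

theorem twiddle_pow_self {n : ℕ} (hn : 0 < n) : twiddle n 1 ^ n = -1 := by
  rw [twiddle, ← Complex.exp_nat_mul, ← Complex.exp_pi_mul_I]
  congr 1
  have : (n : ℂ) ≠ 0 := by exact_mod_cast hn.ne'
  push_cast
  field_simp

theorem invStage_fwdStage {H S : ℕ} (x : ℕ → ℂ) (p : ℕ) :
    invStage H S (fwdStage H S x) p = x p := by
  have e0 : ∀ i, fwdStage H S x (2 * i) = x i + x (i + H) := fun i => by
    rw [fwdStage, if_pos (by omega), show 2 * i / 2 = i by omega]
  have e1 : ∀ i, fwdStage H S x (2 * i + 1) =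
      twiddle H (blockStart S i) * (x i - x (i + H)) := fun i => by
    rw [fwdStage, if_neg (by omega), show (2 * i + 1) / 2 = i by omega]
  unfold invStage
  simp only [e0, e1, ← mul_assoc, conj_twiddle_mul, one_mul]
  split_ifs with h
  · ring
  · rw [show p - H + H = p by omega]; ring

theorem invStage_congr {H S : ℕ} {y y' : ℕ → ℂ} (h : ∀ p < 2 * H, y p = y' p) {p : ℕ}
    (hp : p < 2 * H) : invStage H S y p = invStage H S y' p := by
  unfold invStage
  split_ifs
  · rw [h _ (by omega), h _ (by omega)]
  · rw [h _ (by omega), h _ (by omega)]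

/-- The inverse transform simply undoes the stages in reverse order, so neither an inversion formula
nor the order of the frequencies is needed. -/
theorem invIter_eq_fwdIter {H S t : ℕ} (hN : 2 ^ t * S = 2 * H) {x y : ℕ → ℂ}
    (h : ∀ p < 2 * H, y p = fwdIter H S t x p) {k : ℕ} (hk : k ≤ t) :
    ∀ p < 2 * H, invIter H k y p = fwdIter H S (t - k) x p := by
  induction k with
  | zero => exact h
  | succ k ih =>
    intro p hp
    rw [invIter, invStage_congr (ih (by omega)) hp, show t - k = (t - (k + 1)) + 1 by omega, fwdIter]
    have : 2 * H / 2 ^ (k + 1) = 2 ^ (t - (k + 1)) * S := by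
      rw [← hN]
      refine Nat.div_eq_of_eq_mul_right (by positivity) ?_
      rw [← mul_assoc, ← pow_add]
      congr 2; omega
    rw [this, invStage_fwdStage]

/-- Splits off the first stage instead of the last; it doubles the number of interleaved vectors and
halves their length. -/
theorem fwdIter_succ (H S t : ℕ) (x : ℕ → ℂ) :
    fwdIter H S (t + 1) x = fwdIter H (2 * S) t (fwdStage H S x) := by
  induction t with
  | zero => simp [fwdIter]
  | succ t ih =>
    rw [fwdIter, ih, fwdIter]
    congr 1; ring

/-- The entries of the transform are values, at roots of unity, of the polynomials whose
coefficients are the interleaved vectors. -/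
theorem fwdIter_eq_sum {H t : ℕ} : ∀ {S : ℕ}, 0 < S → 2 ^ t * S = 2 * H → ∀ i < 2 * H,
    ∃ b < S, ∃ ζ : ℂ, ζ ^ 2 ^ t = 1 ∧ ∀ x : ℕ → ℂ,
      fwdIter H S t x i = ∑ j ∈ Finset.range (2 ^ t), x (j * S + b) * ζ ^ j := by
  induction t with
  | zero =>
    intro S hS hN i hi
    exact ⟨i, by omega, 1, by simp, fun x => by simp [fwdIter]⟩
  | succ t ih =>
    intro S hS hN i hi
    have hH : H = 2 ^ t * S := by rw [pow_succ] at hN; linarith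
    obtain ⟨b', hb', ζ', hζ', h⟩ := ih (S := 2 * S) (by omega) (by rw [← hN]; ring) i hi
    have hpos : 0 < 2 ^ t := by positivity
    have hsplit : ∀ f : ℕ → ℂ, ∑ j ∈ Finset.range (2 ^ (t + 1)), f j =
        ∑ j ∈ Finset.range (2 ^ t), (f j + f (2 ^ t + j)) := by
      intro f
      rw [pow_succ, mul_two, Finset.sum_range_add, Finset.sum_add_distrib]
    rcases Nat.even_or_odd' b' with ⟨b, rfl | rfl⟩
    -- Even outputs: `ζ' ^ 2 ^ t = 1`, so the two halves of the vector are added.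
    · refine ⟨b, by omega, ζ', by rw [pow_succ, pow_mul, hζ', one_pow], fun x => ?_⟩
      rw [fwdIter_succ, h, hsplit]
      refine Finset.sum_congr rfl fun j _ => ?_
      have e' : (j * (2 * S) + 2 * b) % 2 = 0 := by
        rw [show j * (2 * S) + 2 * b = 2 * (j * S + b) by ring]; omega
      rw [pow_add, hζ', fwdStage, if_pos e']
      have e : (j * (2 * S) + 2 * b) / 2 = j * S + b := by
        rw [show j * (2 * S) + 2 * b = 2 * (j * S + b) by ring]; omega
      rw [e, show (2 ^ t + j) * S + b = j * S + b + H by rw [hH]; ring]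
      ring
    -- Odd outputs: multiplying `ζ'` by a root with `2 ^ t`-th power `-1` reaches the other half of
    -- the roots of unity and subtracts the two halves. The block start `S * j` supplies the
    -- exponent `j`.
    · have hω := twiddle_pow_self hpos
      refine ⟨b, by omega, twiddle (2 ^ t) 1 * ζ', ?_, fun x => ?_⟩
      · rw [pow_succ, pow_mul, mul_pow, hζ', hω]; norm_num
      rw [fwdIter_succ, h, hsplit]
      refine Finset.sum_congr rfl fun j _ => ?_
      have e : (j * (2 * S) + (2 * b + 1)) / 2 = j * S + b := by
        rw [show j * (2 * S) + (2 * b + 1) = 2 * (j * S + b) + 1 by ring]; omega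
      have e' : (j * (2 * S) + (2 * b + 1)) % 2 ≠ 0 := by
        rw [show j * (2 * S) + (2 * b + 1) = 2 * (j * S + b) + 1 by ring]; omega
      have e2 : blockStart S (j * S + b) = S * j := by
        rw [blockStart, mul_comm j S, Nat.mul_add_div hS, Nat.div_eq_of_lt (by omega), add_zero]
      rw [fwdStage, if_neg e', e, e2, twiddle_pow hS j _ hH, pow_add, mul_pow _ _ (2 ^ t), hζ', hω,
        show (2 ^ t + j) * S + b = j * S + b + H by rw [hH]; ring]
      rw [mul_pow]
      ring

/-- Parseval: the sum of the squared coefficients is the mean of `|P|²` over the circle. -/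
theorem abs_coeff_le_of_circle {P : ℝ[X]} {c : ℝ} (h : ∀ ζ : ℂ, ‖ζ‖ = 1 → ‖aeval ζ P‖ ≤ c)
    (k : ℕ) : |P.coeff k| ≤ c := by
  have hc : 0 ≤ c := (norm_nonneg _).trans (h 1 (by simp))
  set p : ℂ[X] := P.map (algebraMap ℝ ℂ) with hp
  have hk : ‖p.coeff k‖ = |P.coeff k| := by
    rw [hp, coeff_map, norm_algebraMap', Real.norm_eq_abs]
  have h1 := p.sum_sq_norm_coeff_eq_circleAverage
  have h2 : Real.circleAverage (fun z => ‖p.eval z‖ ^ 2) 0 1 ≤ c ^ 2 := by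
    refine Real.circleAverage_mono_on_of_le_circle ?_ ?_
    · refine ContinuousOn.circleIntegrable' ?_
      fun_prop
    · intro z hz
      have hz1 : ‖z‖ = 1 := by simpa using hz
      have := h z hz1
      rw [aeval_def, ← eval_map] at this
      gcongr
  have h3 : ‖p.coeff k‖ ^ 2 ≤ ∑ i ∈ p.support, ‖p.coeff i‖ ^ 2 := by
    by_cases hks : k ∈ p.support
    · exact Finset.single_le_sum (f := fun i => ‖p.coeff i‖ ^ 2) (fun _ _ => by positivity) hks
    · rw [notMem_support_iff.1 hks]
      simp only [norm_zero]
      exact le_trans (by norm_num) (Finset.sum_nonneg fun _ _ => by positivity)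
  rw [← hk]
  refine abs_le_of_sq_le_sq' ?_ hc |>.2
  rw [h1] at h3
  exact h3.trans h2

/-! ### The product tree -/

/-- The polynomial whose `n` coefficients are the entries `b, B + b, 2 B + b, …` of an array. -/
def arrPoly (B n : ℕ) (x : ℕ → ℝ) (b : ℕ) : ℝ[X] :=
  ∑ j ∈ Finset.range n, C (x (j * B + b)) * X ^ j

theorem coeff_arrPoly (B n : ℕ) (x : ℕ → ℝ) (b k : ℕ) :
    (arrPoly B n x b).coeff k = if k < n then x (k * B + b) else 0 := by
  simp only [arrPoly, finsetSum_coeff, coeff_C_mul, coeff_X_pow, mul_ite, mul_one, mul_zero,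
    Finset.sum_ite_eq, Finset.mem_range]

theorem aeval_arrPoly (B n : ℕ) (x : ℕ → ℝ) (b : ℕ) (ζ : ℂ) :
    aeval ζ (arrPoly B n x b) = ∑ j ∈ Finset.range n, (x (j * B + b) : ℂ) * ζ ^ j := by
  simp only [arrPoly, map_sum, map_mul, aeval_C, map_pow, aeval_X]
  rfl

/-- Left factors of the pairs of neighbouring matrices, padded with zeros. -/
def gatherL (H : ℕ) (x : ℕ → ℝ) (i : ℕ) : ℝ := if i < H then x (2 * i) else 0

/-- Right factors, first row. -/
def gatherR (H : ℕ) (x : ℕ → ℝ) (i : ℕ) : ℝ := if i < H then x (2 * i + 1) else 0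

/-- Right factors, second row, multiplied by the variable. -/
def gatherX (H S : ℕ) (x : ℕ → ℝ) (i : ℕ) : ℝ :=
  if S ≤ i ∧ i < H + S then x (2 * (i - S) + 1) else 0

section gather

variable {H S n b : ℕ} (x : ℕ → ℝ)

theorem mul_add_lt_mul_iff {k n S b : ℕ} (hb : b < S) : k * S + b < n * S ↔ k < n := by
  constructor
  · intro h
    by_contra hk
    have := Nat.mul_le_mul_right S (not_lt.1 hk)
    omega
  · intro h
    have := Nat.mul_le_mul_right S (Nat.succ_le_of_lt h)
    rw [Nat.succ_mul] at this
    omega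

theorem arrPoly_gatherL (hH : H = n * S) (hb : b < S) :
    arrPoly S (2 * n) (gatherL H x) b = arrPoly (2 * S) n x (2 * b) := by
  ext k
  rw [coeff_arrPoly, coeff_arrPoly, gatherL]
  simp only [hH, mul_add_lt_mul_iff hb]
  split_ifs <;> first | omega | rfl | (congr 1; ring)

theorem arrPoly_gatherR (hH : H = n * S) (hb : b < S) :
    arrPoly S (2 * n) (gatherR H x) b = arrPoly (2 * S) n x (2 * b + 1) := by
  ext k
  rw [coeff_arrPoly, coeff_arrPoly, gatherR]
  simp only [hH, mul_add_lt_mul_iff hb]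
  split_ifs <;> first | omega | rfl | (congr 1; ring)

theorem arrPoly_gatherX (hH : H = n * S) (hb : b < S) (hn : 0 < n) :
    arrPoly S (2 * n) (gatherX H S x) b = X * arrPoly (2 * S) n x (2 * b + 1) := by
  ext k
  rw [coeff_arrPoly, gatherX]
  cases k with
  | zero => rw [if_pos (by omega), if_neg (by omega), coeff_X_mul_zero]
  | succ k =>
    have h1 : S ≤ (k + 1) * S + b := by rw [Nat.succ_mul]; omega
    have h2 : (k + 1) * S + b < H + S ↔ k < n := by
      rw [hH, ← Nat.succ_mul, mul_add_lt_mul_iff hb]; omega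
    have h3 : (k + 1) * S + b - S = k * S + b := by rw [Nat.succ_mul]; omega
    rw [coeff_X_mul, coeff_arrPoly]
    simp only [h1, h2, h3, true_and]
    split_ifs <;> first | omega | rfl | (congr 1; ring)

end gather

/-- The entries of the products of neighbouring matrices, with `diag(1, X)` in between. -/
def prodPoly (S n : ℕ) (M : Fin 2 → Fin 2 → ℕ → ℝ) (r c : Fin 2) (b : ℕ) : ℝ[X] :=
  arrPoly (2 * S) n (M r 0) (2 * b) * arrPoly (2 * S) n (M 0 c) (2 * b + 1) +
    arrPoly (2 * S) n (M r 1) (2 * b) * (X * arrPoly (2 * S) n (M 1 c) (2 * b + 1))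

/-- The array of the coefficients of `prodPoly`. -/
def convArr (S n : ℕ) (M : Fin 2 → Fin 2 → ℕ → ℝ) (r c : Fin 2) (i : ℕ) : ℝ :=
  (prodPoly S n M r c (i % S)).coeff (i / S)

theorem natDegree_arrPoly_le (B n : ℕ) (x : ℕ → ℝ) (b : ℕ) :
    (arrPoly B n x b).natDegree ≤ n - 1 := by
  refine natDegree_le_iff_coeff_eq_zero.2 fun k hk => ?_
  rw [coeff_arrPoly, if_neg (by omega)]

/-- Two factors of degree `n - 1` and one `X` just fit into `2 n` coefficients, so the cyclic
convolution does not wrap around. -/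
theorem natDegree_prodPoly_le {S n : ℕ} (hn : 0 < n) (M : Fin 2 → Fin 2 → ℕ → ℝ) (r c : Fin 2)
    (b : ℕ) : (prodPoly S n M r c b).natDegree ≤ 2 * n - 1 := by
  have h := natDegree_arrPoly_le (2 * S) n
  refine (natDegree_add_le _ _).trans (max_le (natDegree_mul_le.trans ?_)
    (natDegree_mul_le.trans ?_))
  · have h1 := h (M r 0) (2 * b)
    have h2 := h (M 0 c) (2 * b + 1)
    omega
  · have h1 := h (M r 1) (2 * b)
    have h2 := h (M 1 c) (2 * b + 1)
    have h3 := natDegree_mul_le (p := X) (q := arrPoly (2 * S) n (M 1 c) (2 * b + 1))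
    rw [natDegree_X] at h3
    omega

theorem arrPoly_convArr {S n b : ℕ} (hn : 0 < n) (hb : b < S) (M : Fin 2 → Fin 2 → ℕ → ℝ)
    (r c : Fin 2) : arrPoly S (2 * n) (convArr S n M r c) b = prodPoly S n M r c b := by
  ext k
  have hS : 0 < S := by omega
  have e1 : (k * S + b) % S = b := by rw [mul_comm, Nat.mul_add_mod, Nat.mod_eq_of_lt hb]
  have e2 : (k * S + b) / S = k := by
    rw [mul_comm, Nat.mul_add_div hS, Nat.div_eq_of_lt hb, add_zero]
  rw [coeff_arrPoly, convArr, e1, e2]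
  split_ifs with h
  · rfl
  · exact (coeff_eq_zero_of_natDegree_lt (by
      have := natDegree_prodPoly_le (S := S) hn M r c b
      omega)).symm

/-- The transform of a real array. -/
def fftReal (H S t : ℕ) (x : ℕ → ℝ) : ℕ → ℂ := fwdIter H S t fun i => (x i : ℂ)

/-- The product in the frequency domain. -/
def freqProd (H S t : ℕ) (M : Fin 2 → Fin 2 → ℕ → ℝ) (r c : Fin 2) (p : ℕ) : ℂ :=
  fftReal H S t (gatherL H (M r 0)) p * fftReal H S t (gatherR H (M 0 c)) p +
    fftReal H S t (gatherL H (M r 1)) p * fftReal H S t (gatherX H S (M 1 c)) p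

/-- At a fixed index all transforms are evaluations at the same root of unity, and evaluation is
multiplicative. Hence `freqProd` is the transform of `convArr`, and the inverse stages recover that
array. -/
theorem invIter_freqProd {H S n t : ℕ} (hS : 0 < S) (hn : 0 < n) (hH : H = n * S)
    (ht : 2 ^ t = 2 * n) (M : Fin 2 → Fin 2 → ℕ → ℝ) (r c : Fin 2) {p : ℕ} (hp : p < 2 * H) :
    invIter H t (freqProd H S t M r c) p = (convArr S n M r c p : ℂ) := by
  have hN : 2 ^ t * S = 2 * H := by rw [ht, hH]; ring
  have h := invIter_eq_fwdIter hN (x := fun i => (convArr S n M r c i : ℂ))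
    (y := freqProd H S t M r c) (fun p hp => ?_) le_rfl p hp
  · rw [h, Nat.sub_self, fwdIter]
  · obtain ⟨b, hb, ζ, -, hx⟩ := fwdIter_eq_sum hS hN p hp
    have key : ∀ x : ℕ → ℝ, fftReal H S t x p = aeval ζ (arrPoly S (2 * n) x b) := by
      intro x
      rw [fftReal, hx, aeval_arrPoly, ht]
    change _ = fftReal H S t (convArr S n M r c) p
    rw [freqProd, key, key, key, key, key, arrPoly_convArr hn hb, arrPoly_gatherL _ hH hb,
      arrPoly_gatherL _ hH hb, arrPoly_gatherR _ hH hb, arrPoly_gatherX _ hH hb hn, prodPoly]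
    simp only [map_add, map_mul]

/-! ### The exact nodes of the tree and the growth of errors on the unit circle. -/

/-- The rotation by `φ`. -/
def rotMat (φ : ℝ) : Matrix (Fin 2) (Fin 2) ℂ :=
  !![(Real.cos φ : ℂ), -(Real.sin φ : ℂ); (Real.sin φ : ℂ), (Real.cos φ : ℂ)]

def diagMat (ζ : ℂ) : Matrix (Fin 2) (Fin 2) ℂ := !![1, 0; 0, ζ]

/-- The exact nodes of the product tree at level `l`. -/
def treeMat (φ : ℕ → ℝ) (ζ : ℂ) : ℕ → ℕ → Matrix (Fin 2) (Fin 2) ℂ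
  | 0, b => rotMat (φ b)
  | l + 1, b => treeMat φ ζ l (2 * b) * diagMat ζ * treeMat φ ζ l (2 * b + 1)

theorem rotMat_mem (φ : ℝ) : rotMat φ ∈ Matrix.unitaryGroup (Fin 2) ℂ := by
  rw [Matrix.mem_unitaryGroup_iff]
  have h := Complex.sin_sq_add_cos_sq (φ : ℂ)
  ext i j
  fin_cases i <;> fin_cases j <;>
    simp [rotMat, Matrix.mul_apply, Fin.sum_univ_two, Matrix.star_apply,
      -Complex.ofReal_cos, -Complex.ofReal_sin] <;>
    simp only [Complex.ofReal_cos, Complex.ofReal_sin] <;> first | ring1 | linear_combination h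

theorem diagMat_mem {ζ : ℂ} (hζ : ‖ζ‖ = 1) : diagMat ζ ∈ Matrix.unitaryGroup (Fin 2) ℂ := by
  rw [Matrix.mem_unitaryGroup_iff]
  have h : ζ * (starRingEnd ℂ) ζ = 1 := by rw [Complex.mul_conj']; simp [hζ]
  ext i j
  fin_cases i <;> fin_cases j <;>
    simp [diagMat, Matrix.mul_apply, Fin.sum_univ_two, Matrix.star_apply, h]

/-- The source of stability: on the circle every node is unitary, so its entries stay bounded by `1`
however many factors it contains. -/
theorem treeMat_mem (φ : ℕ → ℝ) {ζ : ℂ} (hζ : ‖ζ‖ = 1) (l b : ℕ) :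
    treeMat φ ζ l b ∈ Matrix.unitaryGroup (Fin 2) ℂ := by
  induction l generalizing b with
  | zero => exact rotMat_mem _
  | succ l ih => exact mul_mem (mul_mem (ih _) (diagMat_mem hζ)) (ih _)

theorem norm_treeMat_le (φ : ℕ → ℝ) {ζ : ℂ} (hζ : ‖ζ‖ = 1) (l b : ℕ) (r c : Fin 2) :
    ‖treeMat φ ζ l b r c‖ ≤ 1 := entry_norm_bound_of_unitary (treeMat_mem φ hζ l b) r c

theorem treeMat_mul_diagMat (φ : ℕ → ℝ) (ζ : ℂ) (l b : ℕ) :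
    treeMat φ ζ l b * diagMat ζ =
      ((List.range' (2 ^ l * b) (2 ^ l)).map fun i => rotMat (φ i) * diagMat ζ).prod := by
  induction l generalizing b with
  | zero => simp [treeMat]
  | succ l ih =>
    have e : List.range' (2 ^ (l + 1) * b) (2 ^ (l + 1)) =
        List.range' (2 ^ l * (2 * b)) (2 ^ l) ++ List.range' (2 ^ l * (2 * b + 1)) (2 ^ l) := by
      rw [show 2 ^ l * (2 * b + 1) = 2 ^ l * (2 * b) + 2 ^ l by ring, List.range'_append_1]
      congr 1 <;> ring
    rw [e, List.map_append, List.prod_append, ← ih, ← ih, treeMat]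
    simp only [mul_assoc]

theorem prod_rotMat_col (ζ : ℂ) (l : List ℝ) :
    (l.map fun φ => rotMat φ * diagMat ζ).prod 0 0 = aeval ζ (colPoly l).1 ∧
      (l.map fun φ => rotMat φ * diagMat ζ).prod 1 0 = aeval ζ (colPoly l).2 := by
  induction l with
  | nil => simp [colPoly]
  | cons φ l ih =>
    simp only [List.map_cons, List.prod_cons, colPoly, map_add, map_sub, map_mul, aeval_C, aeval_X,
      ← ih.1, ← ih.2]
    generalize (l.map fun φ => rotMat φ * diagMat ζ).prod = P
    constructor <;>
    · simp [Matrix.mul_apply, Fin.sum_univ_two, rotMat, diagMat]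
      try ring

/-- The node lacks the last factor `diagMat ζ`, but that factor does not change the first column. -/
theorem treeMat_col (φ : ℕ → ℝ) (ζ : ℂ) (l : ℕ) :
    treeMat φ ζ l 0 1 0 = aeval ζ (colPoly ((List.range (2 ^ l)).map φ)).2 := by
  have h := (prod_rotMat_col ζ ((List.range (2 ^ l)).map φ)).2
  rw [← h, List.map_map, List.range_eq_range']
  have h2 := treeMat_mul_diagMat φ ζ l 0
  rw [mul_zero] at h2
  simp only [Function.comp_def]
  rw [← h2, Matrix.mul_apply, Fin.sum_univ_two]
  simp [diagMat]

/-- A zero angle contributes `diag(1, X)`, which fixes the first basis vector; hence padding to a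
power of two is harmless. -/
theorem colPoly_append_zeros (l : List ℝ) (k : ℕ) :
    colPoly (l ++ List.replicate k 0) = colPoly l := by
  have h : colPoly (List.replicate k 0) = (1, 0) := by
    induction k with
    | zero => rfl
    | succ k ih => rw [List.replicate_succ, colPoly, ih]; simp
  induction l with
  | nil => simpa [colPoly] using h
  | cons a l ih => rw [List.cons_append, colPoly, ih, colPoly]

/-- The arrays `M` hold `B` matrices with polynomial entries of `n` coefficients, approximating the
level `l` of the product tree on the unit circle. -/
def TreeClose (φ : ℕ → ℝ) (B n l : ℕ) (M : Fin 2 → Fin 2 → ℕ → ℝ) (ε : ℝ) : Prop :=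
  ∀ r c, ∀ b < B, ∀ ζ : ℂ, ‖ζ‖ = 1 →
    ‖aeval ζ (arrPoly B n (M r c) b) - treeMat φ ζ l b r c‖ ≤ ε

theorem TreeClose.abs_le {φ : ℕ → ℝ} {B n l : ℕ} {M : Fin 2 → Fin 2 → ℕ → ℝ} {ε : ℝ}
    (h : TreeClose φ B n l M ε) (hε : ε ≤ 1) (hB : 0 < B) (r c : Fin 2) {i : ℕ} (hi : i < n * B) :
    |M r c i| ≤ 2 := by
  have h1 := abs_coeff_le_of_circle (P := arrPoly B n (M r c) (i % B)) (c := 2) (fun ζ hζ => ?_)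
    (i / B)
  · rwa [coeff_arrPoly, if_pos ((Nat.div_lt_iff_lt_mul hB).2 hi), mul_comm, Nat.div_add_mod] at h1
  · have h2 := h r c (i % B) (Nat.mod_lt _ hB) ζ hζ
    have h3 := norm_treeMat_le φ hζ l (i % B) r c
    have h4 := norm_add_le (aeval ζ (arrPoly B n (M r c) (i % B)) - treeMat φ ζ l (i % B) r c)
      (treeMat φ ζ l (i % B) r c)
    rw [sub_add_cancel] at h4
    linarith

theorem norm_mul_sub_mul_le {a a' b b' : ℂ} {ε : ℝ} (hε : ε ≤ 1) (ha : ‖a' - a‖ ≤ ε)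
    (hb : ‖b' - b‖ ≤ ε) (ha1 : ‖a‖ ≤ 1) (hb1 : ‖b‖ ≤ 1) : ‖a' * b' - a * b‖ ≤ 3 * ε := by
  have e : a' * b' - a * b = (a' - a) * b' + a * (b' - b) := by ring
  have hb' : ‖b'‖ ≤ 2 := by
    have := norm_add_le (b' - b) b
    rw [sub_add_cancel] at this
    linarith
  have hε0 := (norm_nonneg _).trans ha
  rw [e]
  refine (norm_add_le _ _).trans ?_
  rw [norm_mul, norm_mul]
  have h1 := mul_le_mul ha hb' (norm_nonneg _) hε0
  have h2 := mul_le_mul ha1 hb (norm_nonneg _) zero_le_one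
  linarith

/-- An entry of the new node is a sum of two products, each off by at most `3 ε`; the `2 n`
coefficients contribute at most `δ` each. -/
theorem TreeClose.step {φ : ℕ → ℝ} {S n l : ℕ} {M M' : Fin 2 → Fin 2 → ℕ → ℝ} {ε δ : ℝ}
    (hn : 0 < n) (h : TreeClose φ (2 * S) n l M ε) (hε : ε ≤ 1)
    (hM' : ∀ r c, ∀ i < 2 * n * S, |M' r c i - convArr S n M r c i| ≤ δ) :
    TreeClose φ S (2 * n) (l + 1) M' (6 * ε + 2 * n * δ) := by
  intro r c b hb ζ hζ
  have h1 : ‖aeval ζ (arrPoly S (2 * n) (M' r c) b) - aeval ζ (prodPoly S n M r c b)‖ ≤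
      2 * n * δ := by
    rw [← arrPoly_convArr hn hb, aeval_arrPoly, aeval_arrPoly, ← Finset.sum_sub_distrib]
    refine (norm_sum_le_of_le _ (f := fun j => ((M' r c (j * S + b) : ℂ) * ζ ^ j -
      (convArr S n M r c (j * S + b) : ℂ) * ζ ^ j)) (n := fun _ => δ) fun j hj => ?_).trans ?_
    · rw [← sub_mul, norm_mul, norm_pow, hζ, one_pow, mul_one, ← Complex.ofReal_sub,
        Complex.norm_real]
      exact hM' r c _ ((mul_add_lt_mul_iff hb).2 (Finset.mem_range.1 hj))
    · rw [Finset.sum_const, Finset.card_range, nsmul_eq_mul]; push_cast; rfl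
  have h2 : ‖aeval ζ (prodPoly S n M r c b) - treeMat φ ζ (l + 1) b r c‖ ≤ 6 * ε := by
    have e : aeval ζ (prodPoly S n M r c b) - treeMat φ ζ (l + 1) b r c =
        (aeval ζ (arrPoly (2 * S) n (M r 0) (2 * b)) *
            aeval ζ (arrPoly (2 * S) n (M 0 c) (2 * b + 1)) -
          treeMat φ ζ l (2 * b) r 0 * treeMat φ ζ l (2 * b + 1) 0 c) +
        ζ * (aeval ζ (arrPoly (2 * S) n (M r 1) (2 * b)) *
            aeval ζ (arrPoly (2 * S) n (M 1 c) (2 * b + 1)) -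
          treeMat φ ζ l (2 * b) r 1 * treeMat φ ζ l (2 * b + 1) 1 c) := by
      simp only [prodPoly, treeMat, map_add, map_mul, aeval_X, Matrix.mul_apply, Fin.sum_univ_two,
        diagMat]
      simp
      ring
    rw [e]
    refine (norm_add_le _ _).trans ?_
    rw [norm_mul ζ, hζ, one_mul]
    have n1 := fun b r c => norm_treeMat_le φ hζ l b r c
    have := norm_mul_sub_mul_le hε (h r 0 (2 * b) (by omega) ζ hζ)
      (h 0 c (2 * b + 1) (by omega) ζ hζ) (n1 _ _ _) (n1 _ _ _)
    have := norm_mul_sub_mul_le hε (h r 1 (2 * b) (by omega) ζ hζ)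
      (h 1 c (2 * b + 1) (by omega) ζ hζ) (n1 _ _ _) (n1 _ _ _)
    linarith
  have h3 := norm_add_le (aeval ζ (arrPoly S (2 * n) (M' r c) b) - aeval ζ (prodPoly S n M r c b))
    (aeval ζ (prodPoly S n M r c b) - treeMat φ ζ (l + 1) b r c)
  rw [sub_add_sub_cancel] at h3
  linarith

/-! ### Loops that write no location twice. -/

theorem Separate.of_pred {L : List Store} (P : ℕ → Prop) (h : ∀ st ∈ L, P st.arr)
    (h' : ∀ st ∈ L, ∀ a ∈ st.val.arrays, ¬ P a) : Separate L :=
  fun st hst st₂ hst₂ ha => h' st hst _ ha (h st₂ hst₂)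

/-- No location is written twice. -/
def Injective (L : List Store) (s : State) (n : ℕ) : Prop :=
  ∀ st ∈ L, ∀ st' ∈ L, ∀ i < n, ∀ i' < n, st.arr = st'.arr →
    st.idx.eval (atIter s i) = st'.idx.eval (atIter s i') → st = st' ∧ i = i'

theorem ends_pass_of_injective {u : ℝ} {A : Arith u} {nr : ℕ} (h5 : nr ≠ 5) (h6 : nr ≠ 6)
    {L : List Store} (hsep : Separate L) {s : State} (hS : 0 < s.reg 4)
    (hinj : Injective L s (s.reg nr)) :
    Ends A (pass nr L) s (s.reg nr * (storesCost L + 20) + 20) fun s' =>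
      (∀ r, r ≠ 5 → r ≠ 6 → s'.reg r = s.reg r) ∧
      (∀ i < s.reg nr, ∀ st ∈ L, s'.mem st.arr (st.idx.eval (atIter s i)) =
        st.val.eval A (atIter s i)) ∧
      (∀ a p, (∀ i < s.reg nr, ∀ st ∈ L, st.arr = a → st.idx.eval (atIter s i) ≠ p) →
        s'.mem a p = s.mem a p) := by
  classical
  let W : ℕ → ℕ → Store × ℕ → Prop := fun a p q => q.1 ∈ L ∧ q.2 < s.reg nr ∧ q.1.arr = a ∧
    q.1.idx.eval (atIter s q.2) = p
  -- The value written by the only store and iteration that reach the location; the default `0` is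
  -- never used.
  let tgt : ℕ → ℕ → ℝ := fun a p =>
    if h : ∃ q, W a p q then (h.choose).1.val.eval A (atIter s h.choose.2) else 0
  have key : ∀ i < s.reg nr, ∀ st ∈ L, st.val.eval A (atIter s i) =
      tgt st.arr (st.idx.eval (atIter s i)) := by
    intro i hi st hst
    have h : ∃ q, W st.arr (st.idx.eval (atIter s i)) q := ⟨(st, i), hst, hi, rfl, rfl⟩
    obtain ⟨h1, h2, h3, h4⟩ := h.choose_spec
    obtain ⟨e1, e2⟩ := hinj _ h1 st hst _ h2 i hi h3 h4
    simp only [tgt, dif_pos h, e1, e2]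
  refine (ends_pass h5 h6 hsep hS tgt key).mono le_rfl fun s' h => ⟨h.1, fun i hi st hst => ?_, h.2.2⟩
  rw [h.2.1 i hi st hst, ← key i hi st hst]

/-! ### The stages of the fast Fourier transform -/

/-- Twice a register expression. -/
def NExpr.dbl (e : NExpr) : NExpr := .add e e

/-- The angle of the twiddle factor. -/
def angleExpr : RExpr := .div (.mul .pi (.ofNat (.reg 6))) (.ofNat (.reg 2))

theorem twiddle_re (H b : ℕ) : (twiddle H b).re = Real.cos (Real.pi * b / H) := by
  rw [twiddle, Complex.exp_ofReal_mul_I_re]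

theorem twiddle_im (H b : ℕ) : (twiddle H b).im = Real.sin (Real.pi * b / H) := by
  rw [twiddle, Complex.exp_ofReal_mul_I_im]

theorem ap_angle {u : ℝ} (hu : 0 ≤ u) (hu' : 100 * u ≤ 1) (A : Arith u) {b H : ℕ} (hH : 0 < H)
    (hb : b ≤ H) :
    Ap u 61 1 (A.cos (A.div (A.mul A.pi (A.ofNat b)) (A.ofNat H))) (twiddle H b).re ∧
    Ap u 61 1 (A.sin (A.div (A.mul A.pi (A.ofNat b)) (A.ofNat H))) (twiddle H b).im := by
  have h1 := (Ap.pi hu A).mul (A := A) hu (Ap.ofNat A b) (by linarith) (by linarith)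
  have h2 := h1.div_nat (A := A) hu (by linarith) (by linarith) hH
  have h3 : (4 * (b : ℝ) / H) ≤ 4 := by
    have : (0 : ℝ) < H := by exact_mod_cast hH
    have : (b : ℝ) ≤ H := by exact_mod_cast hb
    rw [div_le_iff₀ (by assumption)]; linarith
  have h4 := h2.mono hu (L := 15) (by norm_num) (by norm_num) h3
  rw [twiddle_re, twiddle_im]
  exact ⟨(h4.cos hu).mono hu (by norm_num) (by norm_num) le_rfl,
    (h4.sin hu).mono hu (by norm_num) (by norm_num) le_rfl⟩

theorem blockStart_le (S i : ℕ) : blockStart S i ≤ i := Nat.mul_div_le i S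

/-- Vector `x` has its real part in array `20 + x` and its imaginary part in `30 + x`; `40 + x` and
`50 + x` are temporaries. Registers `1`, `2`, `3` and `4` hold the total length `2 H`, half of it,
the number `S` of interleaved vectors, and the current stride. -/
def ldRe (x : ℕ) (i : NExpr) : RExpr := .load (20 + x) i
def ldIm (x : ℕ) (i : NExpr) : RExpr := .load (30 + x) i

def fwdStores (x : ℕ) : List Store :=
  let i : NExpr := .reg 5
  let i' : NExpr := .add (.reg 5) (.reg 2)
  [⟨40 + x, i.dbl, .add (ldRe x i) (ldRe x i')⟩,
   ⟨50 + x, i.dbl, .add (ldIm x i) (ldIm x i')⟩,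
   ⟨40 + x, .add i.dbl (.lit 1), .sub (.mul (.cos angleExpr) (.sub (ldRe x i) (ldRe x i')))
      (.mul (.sin angleExpr) (.sub (ldIm x i) (ldIm x i')))⟩,
   ⟨50 + x, .add i.dbl (.lit 1), .add (.mul (.cos angleExpr) (.sub (ldIm x i) (ldIm x i')))
      (.mul (.sin angleExpr) (.sub (ldRe x i) (ldRe x i')))⟩]

def invStores (x : ℕ) : List Store :=
  let i : NExpr := .reg 5
  let i' : NExpr := .add (.reg 5) (.reg 2)
  let j : NExpr := i.dbl
  let j' : NExpr := .add i.dbl (.lit 1)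
  let re : RExpr := .add (.mul (.cos angleExpr) (ldRe x j')) (.mul (.sin angleExpr) (ldIm x j'))
  let im : RExpr := .sub (.mul (.cos angleExpr) (ldIm x j')) (.mul (.sin angleExpr) (ldRe x j'))
  [⟨40 + x, i, .div (.add (ldRe x j) re) (.ofNat (.lit 2))⟩,
   ⟨50 + x, i, .div (.add (ldIm x j) im) (.ofNat (.lit 2))⟩,
   ⟨40 + x, i', .div (.sub (ldRe x j) re) (.ofNat (.lit 2))⟩,
   ⟨50 + x, i', .div (.sub (ldIm x j) im) (.ofNat (.lit 2))⟩]

def copyStores (x : ℕ) : List Store :=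
  [⟨20 + x, .reg 5, .load (40 + x) (.reg 5)⟩, ⟨30 + x, .reg 5, .load (50 + x) (.reg 5)⟩]

/-- The given stores, for each of the `m` vectors. -/
def batch (m : ℕ) (l : ℕ → List Store) : List Store := (List.range m).flatMap l

/-- Compute into the temporary arrays, for `i < reg nr`, then copy. -/
def stageProg (nr : ℕ) (L : List Store) : Prog := .seq (pass nr L) (pass 1 (batch 8 copyStores))

/-- Registers `0` to `3` and the arrays below `k` are the same. -/
def Frame (k : ℕ) (s s' : State) : Prop :=
  (∀ r < 4, s'.reg r = s.reg r) ∧ ∀ a < k, s'.mem a = s.mem a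

theorem Frame.trans {k : ℕ} {s s' s'' : State} (h : Frame k s s') (h' : Frame k s' s'') :
    Frame k s s'' :=
  ⟨fun r hr => (h'.1 r hr).trans (h.1 r hr), fun a ha => (h'.2 a ha).trans (h.2 a ha)⟩

theorem Frame.mono {k k' : ℕ} {s s' : State} (h : Frame k s s') (hk : k' ≤ k) : Frame k' s s' :=
  ⟨h.1, fun a ha => h.2 a (by omega)⟩

theorem Frame.refl (k : ℕ) (s : State) : Frame k s s := ⟨fun _ _ => rfl, fun _ _ => rfl⟩

/-- The complex vector `x` in memory approximates `y`. -/
def CAp (u K B : ℝ) (N : ℕ) (s : State) (x : ℕ) (y : ℕ → ℂ) : Prop :=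
  ∀ i < N, Ap u K B (s.mem (20 + x) i) (y i).re ∧ Ap u K B (s.mem (30 + x) i) (y i).im

theorem separate_copy : Separate (batch 8 copyStores) := by
  refine Separate.of_pred (fun a => a < 40) (fun st hst => ?_) fun st hst a ha => ?_
  · simp only [batch, List.mem_flatMap, List.mem_range, copyStores, List.mem_cons,
      List.not_mem_nil, or_false] at hst
    obtain ⟨x, hx, rfl | rfl⟩ := hst <;> simp only <;> omega
  · simp only [batch, List.mem_flatMap, List.mem_range, copyStores, List.mem_cons,
      List.not_mem_nil, or_false] at hst
    obtain ⟨x, hx, rfl | rfl⟩ := hst <;> simp [RExpr.arrays] at ha <;> omega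

theorem injective_copy (s : State) (n : ℕ) : Injective (batch 8 copyStores) s n := by
  intro st hst st' hst' i hi i' hi' ha he
  simp only [batch, List.mem_flatMap, List.mem_range, copyStores, List.mem_cons,
      List.not_mem_nil, or_false] at hst hst'
  obtain ⟨x, hx, rfl | rfl⟩ := hst <;> obtain ⟨x', hx', rfl | rfl⟩ := hst' <;>
    simp [NExpr.eval, atIter_reg] at ha he <;> first | omega | (subst ha; subst he; simp)

theorem ends_copy {u : ℝ} (A : Arith u) {s : State} (hS : 0 < s.reg 4) :
    Ends A (pass 1 (batch 8 copyStores)) s (s.reg 1 * 200 + 20) fun s' =>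
      Frame 20 s s' ∧ s'.reg 4 = s.reg 4 ∧ ∀ x < 8, ∀ i < s.reg 1,
        s'.mem (20 + x) i = s.mem (40 + x) i ∧ s'.mem (30 + x) i = s.mem (50 + x) i := by
  refine (ends_pass_of_injective (by norm_num) (by norm_num) separate_copy hS
    (injective_copy s _)).mono ?_ fun s' h => ⟨⟨fun r hr => h.1 r (by omega) (by omega),
      fun a ha => ?_⟩, h.1 4 (by norm_num) (by norm_num), fun x hx i hi => ⟨?_, ?_⟩⟩
  · have : storesCost (batch 8 copyStores) + 20 ≤ 200 := by decide
    gcongr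
  · funext p
    refine h.2.2 a p fun i hi st hst e => ?_
    simp only [batch, List.mem_flatMap, List.mem_range, copyStores, List.mem_cons,
      List.not_mem_nil, or_false] at hst
    obtain ⟨x, hx, rfl | rfl⟩ := hst <;> simp only at e <;> omega
  · have := h.2.1 i hi ⟨20 + x, .reg 5, .load (40 + x) (.reg 5)⟩ (by
      simp only [batch, List.mem_flatMap, List.mem_range]; exact ⟨x, hx, by simp [copyStores]⟩)
    simpa [NExpr.eval, RExpr.eval, atIter_reg] using this
  · have := h.2.1 i hi ⟨30 + x, .reg 5, .load (50 + x) (.reg 5)⟩ (by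
      simp only [batch, List.mem_flatMap, List.mem_range]; exact ⟨x, hx, by simp [copyStores]⟩)
    simpa [NExpr.eval, RExpr.eval, atIter_reg] using this

theorem separate_fwd : Separate (batch 8 fwdStores) := by
  refine Separate.of_pred (fun a => 40 ≤ a) (fun st hst => ?_) fun st hst a ha => ?_
  · simp only [batch, List.mem_flatMap, List.mem_range, fwdStores, List.mem_cons,
      List.not_mem_nil, or_false] at hst
    obtain ⟨x, hx, rfl | rfl | rfl | rfl⟩ := hst <;> simp only <;> omega
  · simp only [batch, List.mem_flatMap, List.mem_range, fwdStores, List.mem_cons,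
      List.not_mem_nil, or_false] at hst
    obtain ⟨x, hx, rfl | rfl | rfl | rfl⟩ := hst <;>
      simp [RExpr.arrays, ldRe, ldIm, angleExpr] at ha <;> omega

theorem injective_fwd (s : State) (n : ℕ) : Injective (batch 8 fwdStores) s n := by
  intro st hst st' hst' i hi i' hi' ha he
  simp only [batch, List.mem_flatMap, List.mem_range, fwdStores, List.mem_cons,
      List.not_mem_nil, or_false] at hst hst'
  obtain ⟨x, hx, rfl | rfl | rfl | rfl⟩ := hst <;>
    obtain ⟨x', hx', rfl | rfl | rfl | rfl⟩ := hst' <;>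
    simp only [NExpr.dbl, NExpr.eval, atIter_reg] at ha he <;>
    first
    | (exfalso; simp at he; omega)
    | (obtain rfl : x = x' := by omega
       obtain rfl : i = i' := by simp at he; omega
       exact ⟨rfl, rfl⟩)

theorem separate_inv : Separate (batch 4 invStores) := by
  refine Separate.of_pred (fun a => 40 ≤ a) (fun st hst => ?_) fun st hst a ha => ?_
  · simp only [batch, List.mem_flatMap, List.mem_range, invStores, List.mem_cons,
      List.not_mem_nil, or_false] at hst
    obtain ⟨x, hx, rfl | rfl | rfl | rfl⟩ := hst <;> simp only <;> omega
  · simp only [batch, List.mem_flatMap, List.mem_range, invStores, List.mem_cons,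
      List.not_mem_nil, or_false] at hst
    obtain ⟨x, hx, rfl | rfl | rfl | rfl⟩ := hst <;>
      simp [RExpr.arrays, ldRe, ldIm, angleExpr] at ha <;> omega

theorem injective_inv (s : State) : Injective (batch 4 invStores) s (s.reg 2) := by
  intro st hst st' hst' i hi i' hi' ha he
  simp only [batch, List.mem_flatMap, List.mem_range, invStores, List.mem_cons,
      List.not_mem_nil, or_false] at hst hst'
  obtain ⟨x, hx, rfl | rfl | rfl | rfl⟩ := hst <;>
    obtain ⟨x', hx', rfl | rfl | rfl | rfl⟩ := hst' <;>
    simp only [NExpr.eval, atIter_reg] at ha he <;>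
    first
    | (exfalso; simp at he; omega)
    | (obtain rfl : x = x' := by omega
       obtain rfl : i = i' := by simp at he; omega
       exact ⟨rfl, rfl⟩)

theorem mem_batch {m x : ℕ} (hx : x < m) {l : ℕ → List Store} {st : Store} (h : st ∈ l x) :
    st ∈ batch m l := by
  simp only [batch, List.mem_flatMap, List.mem_range]; exact ⟨x, hx, h⟩

theorem frame_of_pass {n : ℕ} {L : List Store} {s s' : State} (hL : ∀ st ∈ L, 20 ≤ st.arr)
    (h1 : ∀ r, r ≠ 5 → r ≠ 6 → s'.reg r = s.reg r)
    (h2 : ∀ a p, (∀ i < n, ∀ st ∈ L, st.arr = a → st.idx.eval (atIter s i) ≠ p) →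
        s'.mem a p = s.mem a p) : Frame 20 s s' := by
  refine ⟨fun r hr => h1 r (by omega) (by omega), fun a ha => funext fun p => h2 a p ?_⟩
  intro i _ st hst e
  have := hL st hst
  omega

theorem le_arr_of_fwd : ∀ st ∈ batch 8 fwdStores, 20 ≤ st.arr := by
  intro st hst
  simp only [batch, List.mem_flatMap, List.mem_range, fwdStores, List.mem_cons,
    List.not_mem_nil, or_false] at hst
  obtain ⟨x, hx, rfl | rfl | rfl | rfl⟩ := hst <;> simp only <;> omega

theorem le_arr_of_inv : ∀ st ∈ batch 4 invStores, 20 ≤ st.arr := by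
  intro st hst
  simp only [batch, List.mem_flatMap, List.mem_range, invStores, List.mem_cons,
    List.not_mem_nil, or_false] at hst
  obtain ⟨x, hx, rfl | rfl | rfl | rfl⟩ := hst <;> simp only <;> omega

section stages

variable {u K B : ℝ} {A : Arith u} {H S : ℕ} {s : State} {y : ℕ → ℕ → ℂ}

/-- Combine a pass into the temporary arrays with the copy pass. -/
theorem ends_stageProg {nr T m : ℕ} {L : List Store} {Q : ℕ → ℕ → ℝ → ℝ → Prop} (hm : m ≤ 8)
    (h : Ends A (pass nr L) s T fun s' => Frame 20 s s' ∧ s'.reg 4 = s.reg 4 ∧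
      ∀ x < m, ∀ p < s.reg 1, Q x p (s'.mem (40 + x) p) (s'.mem (50 + x) p))
    (hS : 0 < s.reg 4) :
    Ends A (stageProg nr L) s (T + (s.reg 1 * 200 + 20)) fun s' => Frame 20 s s' ∧
      s'.reg 4 = s.reg 4 ∧
      ∀ x < m, ∀ p < s.reg 1, Q x p (s'.mem (20 + x) p) (s'.mem (30 + x) p) := by
  refine h.seq fun s₁ ⟨f1, f2, f3⟩ => ?_
  have hr : s₁.reg 1 = s.reg 1 := f1.1 1 (by norm_num)
  refine (ends_copy A (s := s₁) (by omega)).mono (by rw [hr]) fun s₂ ⟨g1, g2, g3⟩ =>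
    ⟨f1.trans g1, g2.trans f2, fun x hx p hp => ?_⟩
  rw [hr] at g3
  rw [(g3 x (by omega) p hp).1, (g3 x (by omega) p hp).2]
  exact f3 x hx p hp

/-- A difference doubles the bound and the complex product with the twiddle factor doubles it again.
The constant rises by `2` for the difference, `126` for the multiplication (`2 * 61 + 4`) and `2`
for the last addition, rounded up to `140`. -/
theorem ends_fwdStage (hu : 0 ≤ u) (hK : 0 ≤ K) (hKu : (K + 140) * u ≤ 1) (h1 : s.reg 1 = 2 * H)
    (h2 : s.reg 2 = H) (h4 : s.reg 4 = S) (hS : 0 < S)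
    (hy : ∀ x < 8, CAp u K B (2 * H) s x (y x)) :
    Ends A (stageProg 2 (batch 8 fwdStores)) s (H * 3000 + 40) fun s' => Frame 20 s s' ∧
      s'.reg 4 = S ∧ ∀ x < 8, CAp u (K + 140) (4 * B) (2 * H) s' x (fwdStage H S (y x)) := by
  have hc : ∀ c ≤ 140, (K + c) * u ≤ 1 := fun c hc =>
    (mul_le_mul_of_nonneg_right (by linarith) hu).trans hKu
  have hu1 : 100 * u ≤ 1 := by
    have := hc 140 le_rfl
    nlinarith
  have hpass : Ends A (pass 2 (batch 8 fwdStores)) s (H * 2000 + 20) fun s' => Frame 20 s s' ∧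
      s'.reg 4 = s.reg 4 ∧ ∀ x < 8, ∀ p < s.reg 1,
        Ap u (K + 140) (4 * B) (s'.mem (40 + x) p) (fwdStage H S (y x) p).re ∧
        Ap u (K + 140) (4 * B) (s'.mem (50 + x) p) (fwdStage H S (y x) p).im := by
    refine (ends_pass_of_injective (by norm_num) (by norm_num) separate_fwd (by omega)
      (injective_fwd s _)).mono ?_ fun s' h => ⟨frame_of_pass le_arr_of_fwd h.1 h.2.2,
        h.1 4 (by norm_num) (by norm_num), fun x hx p hp => ?_⟩
    · have : storesCost (batch 8 fwdStores) + 20 ≤ 2000 := by decide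
      rw [h2]; gcongr
    · have hi : p / 2 < s.reg 2 := by omega
      have hB : 0 ≤ B := (hy x hx p (by omega)).1.bound_nonneg
      obtain ⟨a1, a2⟩ := hy x hx (p / 2) (by omega)
      obtain ⟨b1, b2⟩ := hy x hx (p / 2 + H) (by omega)
      have hK0 : K * u ≤ 1 := by simpa using hc 0 (by norm_num)
      rcases Nat.mod_two_eq_zero_or_one p with hp2 | hp2
      · have m1 := h.2.1 _ hi _ (mem_batch hx (l := fwdStores) (List.mem_cons_self ..))
        have m2 := h.2.1 _ hi _ (mem_batch hx (l := fwdStores)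
          (List.mem_cons_of_mem _ (List.mem_cons_self ..)))
        simp only [NExpr.dbl, NExpr.eval, RExpr.eval, ldRe, ldIm, atIter_reg, atIter_mem] at m1 m2
        norm_num [h2] at m1 m2
        rw [show p / 2 + p / 2 = p by omega] at m1 m2
        rw [m1, m2, fwdStage, if_pos hp2, Complex.add_re, Complex.add_im]
        exact ⟨(a1.add hu b1 hK0).mono hu (by linarith) (by linarith) (by linarith),
          (a2.add hu b2 hK0).mono hu (by linarith) (by linarith) (by linarith)⟩
      · have m1 := h.2.1 _ hi _ (mem_batch hx (l := fwdStores)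
          (List.mem_cons_of_mem _ (List.mem_cons_of_mem _ (List.mem_cons_self ..))))
        have m2 := h.2.1 _ hi _ (mem_batch hx (l := fwdStores)
          (List.mem_cons_of_mem _ (List.mem_cons_of_mem _ (List.mem_cons_of_mem _
            (List.mem_cons_self ..)))))
        simp only [NExpr.dbl, NExpr.eval, RExpr.eval, ldRe, ldIm, angleExpr, atIter_reg,
          atIter_mem] at m1 m2
        norm_num [h2, h4] at m1 m2
        rw [show p / 2 + p / 2 + 1 = p by omega] at m1 m2
        obtain ⟨t1, t2⟩ := ap_angle hu hu1 A (b := blockStart S (p / 2)) (H := H) (by omega)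
          ((blockStart_le _ _).trans (by omega))
        have d1 := a1.sub (A := A) hu b1 hK0
        have d2 := a2.sub (A := A) hu b2 hK0
        have k2 := hc 2 (by norm_num)
        have k128 := hc 128 (by norm_num)
        have up : ∀ {v w : ℝ}, Ap u (2 * 61 + (K + 2) + 4) (1 * (B + B)) v w →
            Ap u (K + 128) (2 * B) v w := fun h =>
          h.mono hu (by linarith) (by linarith) (by linarith)
        have r1 := up (t1.mul (A := A) hu d1 (by linarith) k2)
        have r2 := up (t2.mul (A := A) hu d2 (by linarith) k2)
        have i1 := up (t1.mul (A := A) hu d2 (by linarith) k2)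
        have i2 := up (t2.mul (A := A) hu d1 (by linarith) k2)
        rw [m1, m2, fwdStage, if_neg (by omega), Complex.mul_re, Complex.mul_im, Complex.sub_re,
          Complex.sub_im]
        exact ⟨(r1.sub hu r2 k128).mono hu (by linarith) (by linarith) (by linarith),
          (i1.add hu i2 k128).mono hu (by linarith) (by linarith) (by linarith)⟩
  refine (ends_stageProg (Q := fun x p v w => Ap u (K + 140) (4 * B) v (fwdStage H S (y x) p).re ∧
    Ap u (K + 140) (4 * B) w (fwdStage H S (y x) p).im) le_rfl hpass (by omega)).mono ?_ fun s' ⟨f1, f2, f3⟩ =>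
    ⟨f1, f2.trans h4, fun x hx p hp => f3 x hx p (by omega)⟩
  rw [h1]; omega

theorem ends_invStage (hu : 0 ≤ u) (hK : 0 ≤ K) (hKu : (K + 140) * u ≤ 1) (h1 : s.reg 1 = 2 * H)
    (h2 : s.reg 2 = H) (h4 : s.reg 4 = S) (hS : 0 < S)
    (hy : ∀ x < 4, CAp u K B (2 * H) s x (y x)) :
    Ends A (stageProg 2 (batch 4 invStores)) s (H * 3000 + 40) fun s' => Frame 20 s s' ∧
      s'.reg 4 = S ∧ ∀ x < 4, CAp u (K + 140) (4 * B) (2 * H) s' x (invStage H S (y x)) := by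
  have hc : ∀ c ≤ 140, (K + c) * u ≤ 1 := fun c hc =>
    (mul_le_mul_of_nonneg_right (by linarith) hu).trans hKu
  have hu1 : 100 * u ≤ 1 := by
    have := hc 140 le_rfl
    nlinarith
  have hpass : Ends A (pass 2 (batch 4 invStores)) s (H * 2000 + 20) fun s' => Frame 20 s s' ∧
      s'.reg 4 = s.reg 4 ∧ ∀ x < 4, ∀ p < s.reg 1,
        Ap u (K + 140) (4 * B) (s'.mem (40 + x) p) (invStage H S (y x) p).re ∧
        Ap u (K + 140) (4 * B) (s'.mem (50 + x) p) (invStage H S (y x) p).im := by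
    refine (ends_pass_of_injective (by norm_num) (by norm_num) separate_inv (by omega)
      (injective_inv s)).mono ?_ fun s' h => ⟨frame_of_pass le_arr_of_inv h.1 h.2.2,
        h.1 4 (by norm_num) (by norm_num), fun x hx p hp => ?_⟩
    · have : storesCost (batch 4 invStores) + 20 ≤ 2000 := by decide
      rw [h2]; gcongr
    · obtain ⟨i, hi, hpi⟩ : ∃ i < s.reg 2, p = i ∨ p = i + H := by
        by_cases hpH : p < H
        · exact ⟨p, by omega, .inl rfl⟩
        · exact ⟨p - H, by omega, .inr (by omega)⟩
      have hiH : i < H := by omega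
      have hB : 0 ≤ B := (hy x hx p (by omega)).1.bound_nonneg
      obtain ⟨a1, a2⟩ := hy x hx (2 * i) (by omega)
      obtain ⟨b1, b2⟩ := hy x hx (2 * i + 1) (by omega)
      have hK0 : K * u ≤ 1 := by simpa using hc 0 (by norm_num)
      have k126 := hc 126 (by norm_num)
      have k128 := hc 128 (by norm_num)
      have k130 := hc 130 (by norm_num)
      obtain ⟨t1, t2⟩ := ap_angle hu hu1 A (b := blockStart S i) (H := H) (by omega)
        ((blockStart_le _ _).trans (by omega))
      have up : ∀ {v w : ℝ}, Ap u (2 * 61 + K + 4) (1 * B) v w → Ap u (K + 126) B v w :=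
        fun h => h.mono hu (by linarith) (by linarith) (by linarith)
      have q1 := up (t1.mul (A := A) hu b1 (by linarith) hK0)
      have q2 := up (t2.mul (A := A) hu b2 (by linarith) hK0)
      have q3 := up (t1.mul (A := A) hu b2 (by linarith) hK0)
      have q4 := up (t2.mul (A := A) hu b1 (by linarith) hK0)
      have up2 : ∀ {v w : ℝ}, Ap u (K + 126 + 2) (B + B) v w → Ap u (K + 128) (2 * B) v w :=
        fun h => h.mono hu (by linarith) (by linarith) (by linarith)
      have r1 := up2 (q1.add (A := A) hu q2 k126)
      have r2 := up2 (q3.sub (A := A) hu q4 k126)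
      have a1' := a1.mono hu (L := K + 128) (by linarith) (by linarith) le_rfl
      have a2' := a2.mono hu (L := K + 128) (by linarith) (by linarith) le_rfl
      have fin : ∀ {v w : ℝ}, Ap u (K + 128 + 2) (B + 2 * B) v w →
          Ap u (K + 140) (4 * B) (A.div v (A.ofNat 2)) (w / 2) := fun h => by
        have h' := (h.mono hu (L := K + 130) (by linarith) (by linarith) le_rfl).div_nat (A := A)
          hu (by linarith) k130 (n := 2) (by norm_num)
        push_cast at h'
        exact h'.mono hu (by linarith) (by linarith) (by linarith)
      rcases hpi with rfl | rfl
      · have m1 := h.2.1 _ hi _ (mem_batch hx (l := invStores) (List.mem_cons_self ..))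
        have m2 := h.2.1 _ hi _ (mem_batch hx (l := invStores)
          (List.mem_cons_of_mem _ (List.mem_cons_self ..)))
        simp only [NExpr.dbl, NExpr.eval, RExpr.eval, ldRe, ldIm, angleExpr, atIter_reg,
          atIter_mem] at m1 m2
        norm_num [h2, h4, ← two_mul] at m1 m2
        have e1 : (invStage H S (y x) p).re = ((y x (2 * p)).re +
            ((twiddle H (blockStart S p)).re * (y x (2 * p + 1)).re +
              (twiddle H (blockStart S p)).im * (y x (2 * p + 1)).im)) / 2 := by
          rw [invStage, if_pos hiH]; simp
        have e2 : (invStage H S (y x) p).im = ((y x (2 * p)).im +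
            ((twiddle H (blockStart S p)).re * (y x (2 * p + 1)).im -
              (twiddle H (blockStart S p)).im * (y x (2 * p + 1)).re)) / 2 := by
          rw [invStage, if_pos hiH]; simp; ring
        rw [m1, m2, e1, e2]
        exact ⟨fin (a1'.add hu r1 k128), fin (a2'.add hu r2 k128)⟩
      · have m1 := h.2.1 _ hi _ (mem_batch hx (l := invStores)
          (List.mem_cons_of_mem _ (List.mem_cons_of_mem _ (List.mem_cons_self ..))))
        have m2 := h.2.1 _ hi _ (mem_batch hx (l := invStores)
          (List.mem_cons_of_mem _ (List.mem_cons_of_mem _ (List.mem_cons_of_mem _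
            (List.mem_cons_self ..)))))
        simp only [NExpr.dbl, NExpr.eval, RExpr.eval, ldRe, ldIm, angleExpr, atIter_reg,
          atIter_mem] at m1 m2
        norm_num [h2, h4, ← two_mul] at m1 m2
        have e1 : (invStage H S (y x) (i + H)).re = ((y x (2 * i)).re -
            ((twiddle H (blockStart S i)).re * (y x (2 * i + 1)).re +
              (twiddle H (blockStart S i)).im * (y x (2 * i + 1)).im)) / 2 := by
          rw [invStage, if_neg (by omega)]; simp
        have e2 : (invStage H S (y x) (i + H)).im = ((y x (2 * i)).im -
            ((twiddle H (blockStart S i)).re * (y x (2 * i + 1)).im -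
              (twiddle H (blockStart S i)).im * (y x (2 * i + 1)).re)) / 2 := by
          rw [invStage, if_neg (by omega)]; simp; ring
        rw [m1, m2, e1, e2]
        exact ⟨fin (a1'.sub hu r1 k128), fin (a2'.sub hu r2 k128)⟩
  refine (ends_stageProg (Q := fun x p v w => Ap u (K + 140) (4 * B) v (invStage H S (y x) p).re ∧
    Ap u (K + 140) (4 * B) w (invStage H S (y x) p).im) (by norm_num) hpass (by omega)).mono ?_ fun s' ⟨f1, f2, f3⟩ =>
    ⟨f1, f2.trans h4, fun x hx p hp => f3 x hx p (by omega)⟩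
  rw [h1]; omega

/-- The forward transforms of the eight vectors. -/
def fwdProg : Prog :=
  .seq (.setReg 4 (.reg 3)) (.while (.nlt (.reg 4) (.reg 1))
    (.seq (stageProg 2 (batch 8 fwdStores)) (.setReg 4 (NExpr.dbl (.reg 4)))))

/-- The inverse transforms of the first four vectors. -/
def invProg : Prog :=
  .seq (.setReg 4 (.reg 1)) (.while (.nlt (.reg 3) (.reg 4))
    (.seq (.setReg 4 (.half (.reg 4))) (stageProg 2 (batch 4 invStores))))

theorem frame_setReg4 (s : State) (n : ℕ) : Frame 20 s (s.setReg 4 n) :=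
  ⟨fun r hr => by simp [State.setReg, hr.ne], fun _ _ => rfl⟩

theorem CAp.setReg {N x r n : ℕ} {z : ℕ → ℂ} (h : CAp u K B N s x z) :
    CAp u K B N (s.setReg r n) x z := h

theorem ends_fwdProg {t : ℕ} (hu : 0 ≤ u) (hK : 0 ≤ K) (hKu : (K + 140 * t) * u ≤ 1)
    (h1 : s.reg 1 = 2 * H) (h2 : s.reg 2 = H) (h3 : s.reg 3 = S) (hS : 0 < S)
    (hN : 2 ^ t * S = 2 * H) (hy : ∀ x < 8, CAp u K B (2 * H) s x (y x)) :
    Ends A fwdProg s (t * (H * 3000 + 50) + 5) fun s' => Frame 20 s s' ∧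
      ∀ x < 8, CAp u (K + 140 * t) (4 ^ t * B) (2 * H) s' x (fwdIter H S t (y x)) := by
  let I : ℕ → State → Prop := fun k s' => Frame 20 s s' ∧ s'.reg 4 = 2 ^ k * S ∧
    ∀ x < 8, CAp u (K + 140 * k) (4 ^ k * B) (2 * H) s' x (fwdIter H S k (y x))
  have hloop := Ends.while_count (A := A) (b := .nlt (.reg 4) (.reg 1))
    (P := .seq (stageProg 2 (batch 8 fwdStores)) (.setReg 4 (NExpr.dbl (.reg 4))))
    (T := H * 3000 + 44) (s := s.setReg 4 S) t I
    ⟨frame_setReg4 s S, by simp [State.setReg], fun x hx => by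
      simpa [fwdIter] using (hy x hx).setReg⟩
    (fun k hk s₁ ⟨f1, f2, f3⟩ => ?_) fun s₁ ⟨f1, f2, f3⟩ => ?_
  · refine Ends.mono (T := 2 + (t * (3 + (H * 3000 + 44)) + 3)) (Ends.seq (R := I t) (Ends.setReg (e := .reg 3)
      (Q := fun s' => s' = s.setReg 4 S) (by simp [NExpr.eval, h3])) fun s' hs' => ?_) ?_
      fun s' h => ⟨h.1, h.2.2⟩
    · rw [hs']; exact hloop
    · nlinarith
  · have r1 : s₁.reg 1 = 2 * H := (f1.1 1 (by norm_num)).trans h1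
    have r2 : s₁.reg 2 = H := (f1.1 2 (by norm_num)).trans h2
    have hlt : 2 ^ k * S < 2 * H := by
      rw [← hN]; exact Nat.mul_lt_mul_of_pos_right (Nat.pow_lt_pow_right (by norm_num) hk) hS
    refine ⟨by simpa [Test.holds, NExpr.eval, f2, r1] using hlt, ?_⟩
    have hk' : (k : ℝ) + 1 ≤ t := by exact_mod_cast hk
    have hKk : (K + 140 * k + 140) * u ≤ 1 :=
      (mul_le_mul_of_nonneg_right (by linarith) hu).trans hKu
    refine ((ends_fwdStage hu (by positivity) hKk r1 r2 f2 (by positivity) f3).seq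
      (R := I (k + 1)) (T' := 4) ?_).mono (by omega) fun _ h => h
    rintro s₂ ⟨g1, g2, g3⟩
    refine Ends.setReg (e := NExpr.dbl (.reg 4)) ⟨f1.trans (g1.trans (frame_setReg4 s₂ _)), ?_,
      fun x hx => ?_⟩
    · simp [State.setReg, NExpr.dbl, NExpr.eval, g2]; ring
    · have := (g3 x hx).setReg (r := 4) (n := (NExpr.dbl (.reg 4)).eval s₂)
      convert this using 1
      · push_cast; ring
      · rw [pow_succ]; ring
      · rfl
  · have r1 : s₁.reg 1 = 2 * H := (f1.1 1 (by norm_num)).trans h1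
    simp [Test.holds, NExpr.eval, f2, r1, hN]

theorem ends_invProg {t : ℕ} (hu : 0 ≤ u) (hK : 0 ≤ K) (hKu : (K + 140 * t) * u ≤ 1)
    (h1 : s.reg 1 = 2 * H) (h2 : s.reg 2 = H) (h3 : s.reg 3 = S) (hS : 0 < S)
    (hN : 2 ^ t * S = 2 * H) (hy : ∀ x < 4, CAp u K B (2 * H) s x (y x)) :
    Ends A invProg s (t * (H * 3000 + 50) + 5) fun s' => Frame 20 s s' ∧
      ∀ x < 4, CAp u (K + 140 * t) (4 ^ t * B) (2 * H) s' x (invIter H t (y x)) := by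
  let I : ℕ → State → Prop := fun k s' => Frame 20 s s' ∧ s'.reg 4 = 2 * H / 2 ^ k ∧
    ∀ x < 4, CAp u (K + 140 * k) (4 ^ k * B) (2 * H) s' x (invIter H k (y x))
  have hdiv : ∀ k ≤ t, 2 * H / 2 ^ k = 2 ^ (t - k) * S := by
    intro k hk
    rw [← hN]
    refine Nat.div_eq_of_eq_mul_right (by positivity) ?_
    rw [← mul_assoc, ← pow_add]
    congr 2; omega
  have hloop := Ends.while_count (A := A) (b := .nlt (.reg 3) (.reg 4))
    (P := .seq (.setReg 4 (.half (.reg 4))) (stageProg 2 (batch 4 invStores)))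
    (T := H * 3000 + 43) (s := s.setReg 4 (2 * H)) t I
    ⟨frame_setReg4 s _, by simp [State.setReg], fun x hx => by
      simpa [invIter] using (hy x hx).setReg⟩
    (fun k hk s₁ ⟨f1, f2, f3⟩ => ?_) fun s₁ ⟨f1, f2, f3⟩ => ?_
  · refine Ends.mono (T := 2 + (t * (3 + (H * 3000 + 43)) + 3)) (Ends.seq (R := I t) (Ends.setReg (e := .reg 1)
      (Q := fun s' => s' = s.setReg 4 (2 * H)) (by simp [NExpr.eval, h1])) fun s' hs' => ?_) ?_
      fun s' h => ⟨h.1, h.2.2⟩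
    · rw [hs']; exact hloop
    · nlinarith
  · have r1 : s₁.reg 1 = 2 * H := (f1.1 1 (by norm_num)).trans h1
    have r2 : s₁.reg 2 = H := (f1.1 2 (by norm_num)).trans h2
    have r3 : s₁.reg 3 = S := (f1.1 3 (by norm_num)).trans h3
    have hlt : S < 2 ^ (t - k) * S := by
      have : 1 < 2 ^ (t - k) := Nat.one_lt_two_pow (by omega)
      nlinarith
    refine ⟨by simpa [Test.holds, NExpr.eval, f2, r3, hdiv k hk.le] using hlt, ?_⟩
    have hk' : (k : ℝ) + 1 ≤ t := by exact_mod_cast hk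
    have hKk : (K + 140 * k + 140) * u ≤ 1 :=
      (mul_le_mul_of_nonneg_right (by linarith) hu).trans hKu
    refine Ends.mono (T := 3 + (H * 3000 + 40)) (Ends.seq (R := I (k + 1)) (Ends.setReg (e := .half (.reg 4))
      (Q := fun s' => s' = s₁.setReg 4 (2 * H / 2 ^ (k + 1))) ?_) fun s₂ hs₂ => ?_) (by omega)
      fun _ h => h
    · simp only [NExpr.eval, f2, Nat.div_div_eq_div_mul, pow_succ]
    · have g := frame_setReg4 s₁ (2 * H / 2 ^ (k + 1))
      rw [← hs₂] at g
      have hf : ∀ x < 4, CAp u (K + 140 * k) (4 ^ k * B) (2 * H) s₂ x (invIter H k (y x)) := by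
        rw [hs₂]; exact f3
      refine (ends_invStage hu (by positivity) hKk ((g.1 1 (by norm_num)).trans r1)
        ((g.1 2 (by norm_num)).trans r2) (by rw [hs₂]; simp [State.setReg])
        (by rw [hdiv _ hk]; positivity) hf).mono le_rfl fun s₃ ⟨g1, g2, g3⟩ =>
          ⟨f1.trans (g.trans g1), g2, fun x hx => ?_⟩
      convert g3 x hx using 1
      · push_cast; ring
      · rw [pow_succ]; ring
      · rfl
  · have r3 : s₁.reg 3 = S := (f1.1 3 (by norm_num)).trans h3
    simp [Test.holds, NExpr.eval, f2, r3, hdiv t le_rfl]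

end stages

/-! ### One level of the product tree -/

def zeroStores (x : ℕ) : List Store :=
  [⟨20 + x, .reg 5, .ofNat (.lit 0)⟩, ⟨30 + x, .reg 5, .ofNat (.lit 0)⟩]

def gatherStores : List Store :=
  batch 4 (fun e => [⟨20 + e, .reg 5, .load (10 + e) (NExpr.dbl (.reg 5))⟩]) ++
  batch 2 (fun c => [⟨24 + c, .reg 5, .load (10 + c) (.add (NExpr.dbl (.reg 5)) (.lit 1))⟩,
    ⟨26 + c, .add (.reg 5) (.reg 4), .load (12 + c) (.add (NExpr.dbl (.reg 5)) (.lit 1))⟩])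

/-- The real part of a product of entries. -/
def mulRe (a b : ℕ) : RExpr :=
  .sub (.mul (ldRe a (.reg 5)) (ldRe b (.reg 5))) (.mul (ldIm a (.reg 5)) (ldIm b (.reg 5)))

/-- The imaginary part of a product of entries. -/
def mulIm (a b : ℕ) : RExpr :=
  .add (.mul (ldRe a (.reg 5)) (ldIm b (.reg 5))) (.mul (ldIm a (.reg 5)) (ldRe b (.reg 5)))

/-- Entry `e` stands for row `e / 2` and column `e % 2`. Vectors `0` to `3` are the left factors,
`4` and `5` the first row of the right factors, `6` and `7` the second row already multiplied by
`X`. -/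
def prodStores (e : ℕ) : List Store :=
  [⟨40 + e, .reg 5,
      .add (mulRe (2 * (e / 2)) (4 + e % 2)) (mulRe (2 * (e / 2) + 1) (6 + e % 2))⟩,
   ⟨50 + e, .reg 5,
      .add (mulIm (2 * (e / 2)) (4 + e % 2)) (mulIm (2 * (e / 2) + 1) (6 + e % 2))⟩]

def writeStores (e : ℕ) : List Store := [⟨10 + e, .reg 5, .load (20 + e) (.reg 5)⟩]

def levelProg : Prog :=
  .seq (.setReg 4 (.reg 3)) (.seq (pass 1 (batch 8 zeroStores)) (.seq (pass 2 gatherStores)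
    (.seq fwdProg (.seq (.setReg 4 (.reg 3)) (.seq (stageProg 1 (batch 4 prodStores))
      (.seq invProg (.seq (.setReg 4 (.reg 3)) (pass 1 (batch 4 writeStores)))))))))

/-- The entries of the matrices of the current level. -/
def memM (s : State) (r c : Fin 2) : ℕ → ℝ := s.mem (10 + (2 * (r : ℕ) + c))

/-- The contents of the eight vectors before the transforms. -/
def gatherVec (H S : ℕ) (s : State) (x : ℕ) : ℕ → ℝ :=
  if x < 4 then gatherL H (s.mem (10 + x)) else if x < 6 then gatherR H (s.mem (6 + x))
  else gatherX H S (s.mem (6 + x))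

section level

variable {u K B : ℝ} {A : Arith u} {H S : ℕ} {s : State}

theorem ends_zero (h1 : s.reg 1 = 2 * H) (hS : 0 < s.reg 4) :
    Ends A (pass 1 (batch 8 zeroStores)) s (H * 400 + 20) fun s' => Frame 20 s s' ∧
      s'.reg 4 = s.reg 4 ∧ ∀ x < 8, ∀ i < 2 * H, s'.mem (20 + x) i = 0 ∧ s'.mem (30 + x) i = 0 := by
  have hm : ∀ st ∈ batch 8 zeroStores, 20 ≤ st.arr ∧ st.val = .ofNat (.lit 0) := by
    intro st hst
    simp only [batch, List.mem_flatMap, List.mem_range, zeroStores, List.mem_cons,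
      List.not_mem_nil, or_false] at hst
    obtain ⟨x, hx, rfl | rfl⟩ := hst <;> simp only [and_true] <;> omega
  have hsep : Separate (batch 8 zeroStores) :=
    Separate.of_pred (fun _ => True) (fun _ _ => trivial) fun st hst a ha => by
      rw [(hm st hst).2] at ha; simp [RExpr.arrays] at ha
  refine (ends_pass (by norm_num) (by norm_num) hsep hS (fun _ _ => 0) fun i _ st hst => ?_).mono ?_
    fun s' h => ⟨frame_of_pass (fun st hst => (hm st hst).1) h.1 h.2.2,
      h.1 4 (by norm_num) (by norm_num), fun x hx i hi => ⟨?_, ?_⟩⟩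
  · rw [(hm st hst).2]; simp [RExpr.eval, NExpr.eval, A.ofNat_zero]
  · have : storesCost (batch 8 zeroStores) + 20 ≤ 200 := by decide
    have := Nat.mul_le_mul_left (2 * H) this
    rw [h1]; omega
  · have := h.2.1 i (by omega) _ (mem_batch hx (l := zeroStores) (List.mem_cons_self ..))
    simpa [NExpr.eval, atIter_reg] using this
  · have := h.2.1 i (by omega) _ (mem_batch hx (l := zeroStores)
      (List.mem_cons_of_mem _ (List.mem_cons_self ..)))
    simpa [NExpr.eval, atIter_reg] using this

theorem mem_gatherStores {st : Store} : st ∈ gatherStores ↔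
    (∃ e < 4, st = ⟨20 + e, .reg 5, .load (10 + e) (NExpr.dbl (.reg 5))⟩) ∨
    (∃ c < 2, st = ⟨24 + c, .reg 5, .load (10 + c) (.add (NExpr.dbl (.reg 5)) (.lit 1))⟩) ∨
    (∃ c < 2, st = ⟨26 + c, .add (.reg 5) (.reg 4),
      .load (12 + c) (.add (NExpr.dbl (.reg 5)) (.lit 1))⟩) := by
  simp only [gatherStores, batch, List.mem_append, List.mem_flatMap, List.mem_range, List.mem_cons,
    List.not_mem_nil, or_false]
  constructor
  · rintro (⟨e, he, h⟩ | ⟨c, hc, h | h⟩)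
    · exact .inl ⟨e, he, h⟩
    · exact .inr (.inl ⟨c, hc, h⟩)
    · exact .inr (.inr ⟨c, hc, h⟩)
  · rintro (⟨e, he, h⟩ | ⟨c, hc, h⟩ | ⟨c, hc, h⟩)
    · exact .inl ⟨e, he, h⟩
    · exact .inr ⟨c, hc, .inl h⟩
    · exact .inr ⟨c, hc, .inr h⟩

/-- Only half of each vector is written, which is why the arrays are zeroed first; the last two
vectors are shifted by `S`, a multiplication by `X`. -/
theorem ends_gather (h2 : s.reg 2 = H) (h4 : s.reg 4 = S) (hS : 0 < S)
    (h0 : ∀ x < 8, ∀ i < 2 * H, s.mem (20 + x) i = 0 ∧ s.mem (30 + x) i = 0) :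
    Ends A (pass 2 gatherStores) s (H * 200 + 20) fun s' => Frame 20 s s' ∧
      ∀ x < 8, ∀ i < 2 * H, s'.mem (20 + x) i = gatherVec H S s x i ∧ s'.mem (30 + x) i = 0 := by
  have hsep : Separate gatherStores := by
    refine Separate.of_pred (fun a => 20 ≤ a) (fun st hst => ?_) fun st hst a ha => ?_
    · obtain ⟨e, he, rfl⟩ | ⟨c, hc, rfl⟩ | ⟨c, hc, rfl⟩ := mem_gatherStores.1 hst <;>
        simp only <;> omega
    · obtain ⟨e, he, rfl⟩ | ⟨c, hc, rfl⟩ | ⟨c, hc, rfl⟩ := mem_gatherStores.1 hst <;>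
        simp [RExpr.arrays] at ha <;> omega
  have hinj : Injective gatherStores s (s.reg 2) := by
    intro st hst st' hst' i hi i' hi' ha he
    obtain ⟨e, he1, rfl⟩ | ⟨c, hc, rfl⟩ | ⟨c, hc, rfl⟩ := mem_gatherStores.1 hst <;>
    obtain ⟨e', he2, rfl⟩ | ⟨c', hc', rfl⟩ | ⟨c', hc', rfl⟩ := mem_gatherStores.1 hst' <;>
      simp [NExpr.eval, atIter_reg] at ha he <;> first | omega | (subst ha; subst he; simp)
  refine (ends_pass_of_injective (by norm_num) (by norm_num) hsep (by omega) hinj).mono ?_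
    fun s' h => ⟨frame_of_pass (fun st hst => ?_) h.1 h.2.2, fun x hx i hi => ⟨?_, ?_⟩⟩
  · have : storesCost gatherStores + 20 ≤ 200 := by decide
    rw [h2]; gcongr
  · obtain ⟨e, he, rfl⟩ | ⟨c, hc, rfl⟩ | ⟨c, hc, rfl⟩ := mem_gatherStores.1 hst <;>
      simp only <;> omega
  · rw [h2] at h
    have hunt : (∀ j < H, ∀ st ∈ gatherStores, st.arr = 20 + x →
        st.idx.eval (atIter s j) ≠ i) → s'.mem (20 + x) i = 0 := fun hh => by
      rw [h.2.2 _ _ hh, (h0 x hx i hi).1]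
    unfold gatherVec
    split_ifs with hx4 hx6
    · rw [gatherL]
      split_ifs with hiH
      · have := h.2.1 i hiH _ (mem_gatherStores.2 (.inl ⟨x, hx4, rfl⟩))
        simpa [NExpr.eval, RExpr.eval, NExpr.dbl, atIter_reg, ← two_mul] using this
      · refine hunt fun j hj st hst e => ?_
        obtain ⟨e', he, rfl⟩ | ⟨c, hc, rfl⟩ | ⟨c, hc, rfl⟩ := mem_gatherStores.1 hst <;>
          simp [NExpr.eval, atIter_reg] at e ⊢ <;> omega
    · rw [gatherR]
      split_ifs with hiH
      · have := h.2.1 i hiH _ (mem_gatherStores.2 (.inr (.inl ⟨x - 4, by omega, rfl⟩)))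
        simp [NExpr.eval, RExpr.eval, NExpr.dbl, atIter_reg, ← two_mul] at this
        rw [show 24 + (x - 4) = 20 + x by omega, show 10 + (x - 4) = 6 + x by omega] at this
        exact this
      · refine hunt fun j hj st hst e => ?_
        obtain ⟨e', he, rfl⟩ | ⟨c, hc, rfl⟩ | ⟨c, hc, rfl⟩ := mem_gatherStores.1 hst <;>
          simp [NExpr.eval, atIter_reg] at e ⊢ <;> omega
    · rw [gatherX]
      split_ifs with hiH
      · have := h.2.1 (i - S) (by omega) _
          (mem_gatherStores.2 (.inr (.inr ⟨x - 6, by omega, rfl⟩)))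
        simp [NExpr.eval, RExpr.eval, NExpr.dbl, atIter_reg, ← two_mul] at this
        rw [show 26 + (x - 6) = 20 + x by omega, show 12 + (x - 6) = 6 + x by omega, h4,
          show i - S + S = i by omega] at this
        exact this
      · refine hunt fun j hj st hst e => ?_
        obtain ⟨e', he, rfl⟩ | ⟨c, hc, rfl⟩ | ⟨c, hc, rfl⟩ := mem_gatherStores.1 hst <;>
          simp [NExpr.eval, atIter_reg] at e ⊢ <;> omega
  · rw [h.2.2 _ _ fun j hj st hst e => ?_, (h0 x hx i hi).2]
    obtain ⟨e', he, rfl⟩ | ⟨c, hc, rfl⟩ | ⟨c, hc, rfl⟩ := mem_gatherStores.1 hst <;>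
      simp only at e <;> omega

theorem ends_prod {y : ℕ → ℕ → ℂ} (hu : 0 ≤ u) (hK : 0 ≤ K) (hKu : (3 * K + 8) * u ≤ 1)
    (h1 : s.reg 1 = 2 * H) (hS : 0 < s.reg 4) (hy : ∀ x < 8, CAp u K B (2 * H) s x (y x)) :
    Ends A (stageProg 1 (batch 4 prodStores)) s (H * 2000 + 40) fun s' => Frame 20 s s' ∧
      ∀ x < 4, CAp u (3 * K + 8) (4 * (B * B)) (2 * H) s' x fun p =>
        y (2 * (x / 2)) p * y (4 + x % 2) p + y (2 * (x / 2) + 1) p * y (6 + x % 2) p := by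
  have hmem : ∀ {st}, st ∈ batch 4 prodStores → ∃ e < 4, st ∈ prodStores e := by
    intro st hst
    simpa only [batch, List.mem_flatMap, List.mem_range] using hst
  have harr : ∀ st ∈ batch 4 prodStores, 40 ≤ st.arr := by
    intro st hst
    obtain ⟨e, he, h⟩ := hmem hst
    simp only [prodStores, List.mem_cons, List.not_mem_nil, or_false] at h
    obtain rfl | rfl := h <;> simp only <;> omega
  have hsep : Separate (batch 4 prodStores) := by
    refine Separate.of_pred (fun a => 40 ≤ a) harr fun st hst a ha => ?_
    obtain ⟨e, he, h⟩ := hmem hst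
    simp only [prodStores, List.mem_cons, List.not_mem_nil, or_false] at h
    obtain rfl | rfl := h <;> simp [RExpr.arrays, mulRe, mulIm, ldRe, ldIm] at ha <;> omega
  have hinj : Injective (batch 4 prodStores) s (s.reg 1) := by
    intro st hst st' hst' i hi i' hi' ha he
    obtain ⟨e, he, h⟩ := hmem hst
    obtain ⟨e', he', h'⟩ := hmem hst'
    simp only [prodStores, List.mem_cons, List.not_mem_nil, or_false] at h h'
    obtain rfl | rfl := h <;> obtain rfl | rfl := h' <;> simp [NExpr.eval, atIter_reg] at ha he <;>
      first | omega | (subst ha; subst he; simp)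
  have hc : ∀ L, L ≤ 3 * K + 8 → L * u ≤ 1 := fun c hc =>
    (mul_le_mul_of_nonneg_right hc hu).trans hKu
  have hpass : Ends A (pass 1 (batch 4 prodStores)) s (2 * H * 500 + 20) fun s' => Frame 20 s s' ∧
      s'.reg 4 = s.reg 4 ∧ ∀ x < 4, ∀ p < s.reg 1,
        Ap u (3 * K + 8) (4 * (B * B)) (s'.mem (40 + x) p) (y (2 * (x / 2)) p * y (4 + x % 2) p +
          y (2 * (x / 2) + 1) p * y (6 + x % 2) p).re ∧
        Ap u (3 * K + 8) (4 * (B * B)) (s'.mem (50 + x) p) (y (2 * (x / 2)) p * y (4 + x % 2) p +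
          y (2 * (x / 2) + 1) p * y (6 + x % 2) p).im := by
    refine (ends_pass_of_injective (by norm_num) (by norm_num) hsep hS hinj).mono ?_
      fun s' h => ⟨frame_of_pass (fun st hst => by have := harr st hst; omega) h.1 h.2.2,
        h.1 4 (by norm_num) (by norm_num), fun x hx p hp => ?_⟩
    · have : storesCost (batch 4 prodStores) + 20 ≤ 500 := by decide
      rw [h1]; gcongr
    · have m1 := h.2.1 p hp _ (mem_batch hx (l := prodStores) (List.mem_cons_self ..))
      have m2 := h.2.1 p hp _ (mem_batch hx (l := prodStores)
        (List.mem_cons_of_mem _ (List.mem_cons_self ..)))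
      simp only [NExpr.eval, RExpr.eval, mulRe, mulIm, ldRe, ldIm, atIter_reg, atIter_mem] at m1 m2
      norm_num at m1 m2
      have ap : ∀ x < 8, _ := fun x hx => hy x hx p (by omega)
      have kK := hc K (by linarith)
      have k4 := hc (2 * K + K + 4) (by linarith)
      have k6 := hc (2 * K + K + 4 + 2) (by linarith)
      have cm : ∀ a < 8, ∀ b < 8,
          Ap u (2 * K + K + 4 + 2) (B * B + B * B)
            (A.sub (A.mul (s.mem (20 + a) p) (s.mem (20 + b) p))
              (A.mul (s.mem (30 + a) p) (s.mem (30 + b) p))) (y a p * y b p).re ∧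
          Ap u (2 * K + K + 4 + 2) (B * B + B * B)
            (A.add (A.mul (s.mem (20 + a) p) (s.mem (30 + b) p))
              (A.mul (s.mem (30 + a) p) (s.mem (20 + b) p))) (y a p * y b p).im := by
        intro a ha b hb
        rw [Complex.mul_re, Complex.mul_im]
        exact ⟨((ap a ha).1.mul hu (ap b hb).1 kK kK).sub hu ((ap a ha).2.mul hu (ap b hb).2 kK kK) k4,
          ((ap a ha).1.mul hu (ap b hb).2 kK kK).add hu ((ap a ha).2.mul hu (ap b hb).1 kK kK) k4⟩
      have c1 := cm (2 * (x / 2)) (by omega) (4 + x % 2) (by omega)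
      have c2 := cm (2 * (x / 2) + 1) (by omega) (6 + x % 2) (by omega)
      rw [m1, m2, Complex.add_re, Complex.add_im]
      exact ⟨(c1.1.add hu c2.1 k6).mono hu (by linarith) (by linarith) (by linarith),
        (c1.2.add hu c2.2 k6).mono hu (by linarith) (by linarith) (by linarith)⟩
  refine (ends_stageProg (Q := fun x p v w => Ap u (3 * K + 8) (4 * (B * B)) v
      (y (2 * (x / 2)) p * y (4 + x % 2) p + y (2 * (x / 2) + 1) p * y (6 + x % 2) p).re ∧
    Ap u (3 * K + 8) (4 * (B * B)) w
      (y (2 * (x / 2)) p * y (4 + x % 2) p + y (2 * (x / 2) + 1) p * y (6 + x % 2) p).im)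
    (by norm_num) hpass hS).mono ?_ fun s' ⟨f1, f2, f3⟩ =>
    ⟨f1, fun x hx p hp => f3 x hx p (by omega)⟩
  rw [h1]; omega

theorem ends_write (h1 : s.reg 1 = 2 * H) (hS : 0 < s.reg 4) :
    Ends A (pass 1 (batch 4 writeStores)) s (H * 200 + 20) fun s' => Frame 10 s s' ∧
      ∀ e < 4, ∀ i < 2 * H, s'.mem (10 + e) i = s.mem (20 + e) i := by
  have hmem : ∀ {st}, st ∈ batch 4 writeStores →
      ∃ e < 4, st = ⟨10 + e, .reg 5, .load (20 + e) (.reg 5)⟩ := by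
    intro st hst
    simpa only [batch, List.mem_flatMap, List.mem_range, writeStores, List.mem_singleton] using hst
  have hsep : Separate (batch 4 writeStores) := by
    refine Separate.of_pred (fun a => a < 20) (fun st hst => ?_) fun st hst a ha => ?_
    · obtain ⟨e, he, rfl⟩ := hmem hst
      simp only; omega
    · obtain ⟨e, he, rfl⟩ := hmem hst
      simp [RExpr.arrays] at ha; omega
  have hinj : Injective (batch 4 writeStores) s (s.reg 1) := by
    intro st hst st' hst' i hi i' hi' ha he
    obtain ⟨e, he1, rfl⟩ := hmem hst
    obtain ⟨e', he2, rfl⟩ := hmem hst'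
    simp [NExpr.eval, atIter_reg] at ha he
    subst ha; subst he; simp
  refine (ends_pass_of_injective (by norm_num) (by norm_num) hsep hS hinj).mono ?_
    fun s' h => ⟨⟨fun r hr => h.1 r (by omega) (by omega), fun a ha => funext fun p =>
      h.2.2 a p fun i _ st hst e => ?_⟩, fun e he i hi => ?_⟩
  · have : storesCost (batch 4 writeStores) + 20 ≤ 100 := by decide
    have := Nat.mul_le_mul_left (2 * H) this
    rw [h1]; omega
  · obtain ⟨e', he, rfl⟩ := hmem hst
    simp only at e; omega
  · have := h.2.1 i (by omega) _ (mem_batch he (l := writeStores) (List.mem_cons_self ..))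
    simpa [NExpr.eval, RExpr.eval, atIter_reg] using this

theorem abs_gatherVec_le {c : ℝ} (hc : 0 ≤ c) (hM : ∀ e < 4, ∀ i < 2 * H, |s.mem (10 + e) i| ≤ c)
    {x : ℕ} (hx : x < 8) (i : ℕ) : |gatherVec H S s x i| ≤ c := by
  unfold gatherVec
  split_ifs with hx4 hx6
  · rw [gatherL]; split_ifs
    · exact hM x hx4 _ (by omega)
    · simpa using hc
  · rw [gatherR]; split_ifs
    · have := hM (x - 4) (by omega) (2 * i + 1) (by omega)
      rwa [show 10 + (x - 4) = 6 + x by omega] at this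
    · simpa using hc
  · rw [gatherX]; split_ifs
    · have := hM (x - 4) (by omega) (2 * (i - S) + 1) (by omega)
      rwa [show 10 + (x - 4) = 6 + x by omega] at this
    · simpa using hc

theorem freqProd_eq (t : ℕ) (r c : Fin 2) (p : ℕ) :
    freqProd H S t (memM s) r c p =
      fftReal H S t (gatherVec H S s (2 * ((2 * (r : ℕ) + c) / 2))) p *
        fftReal H S t (gatherVec H S s (4 + (2 * (r : ℕ) + c) % 2)) p +
      fftReal H S t (gatherVec H S s (2 * ((2 * (r : ℕ) + c) / 2) + 1)) p *
        fftReal H S t (gatherVec H S s (6 + (2 * (r : ℕ) + c) % 2)) p := by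
  fin_cases r <;> fin_cases c <;> rfl

/-- The pair `(K, B)` develops as `(0, 2)`, then `(140 t, 2 · 4^t)` after the forward transforms,
`(420 t + 8, 16 · 16^t)` after the products and `(560 t + 8, 16 · 64^t)` after the inverse
transforms. -/
theorem ends_level {n t : ℕ} (hu : 0 ≤ u) (hS : 0 < S) (hn : 0 < n) (hH : H = n * S)
    (ht : 2 ^ t = 2 * n) (hKu : (560 * t + 8) * u ≤ 1) (h1 : s.reg 1 = 2 * H) (h2 : s.reg 2 = H)
    (h3 : s.reg 3 = S) (hM : ∀ r c, ∀ i < 2 * H, |memM s r c i| ≤ 2) :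
    Ends A levelProg s (t * (H * 6000 + 100) + H * 3000 + 200) fun s' => Frame 10 s s' ∧
      ∀ r c, ∀ i < 2 * H, |memM s' r c i - convArr S n (memM s) r c i| ≤
        (560 * t + 8) * u * (16 * 64 ^ t) := by
  have hN : 2 ^ t * S = 2 * H := by rw [ht, hH]; ring
  have ht0 : (0 : ℝ) ≤ t := Nat.cast_nonneg t
  have hc : ∀ L, L ≤ 560 * (t : ℝ) + 8 → L * u ≤ 1 := fun c hc =>
    (mul_le_mul_of_nonneg_right hc hu).trans hKu
  have hset : ∀ s₁ : State, Frame 20 s s₁ → Ends A (.setReg 4 (.reg 3)) s₁ 2 fun s' =>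
      s' = s₁.setReg 4 S ∧ Frame 20 s s' ∧ s'.reg 4 = S := by
    intro s₁ f
    have e : (NExpr.reg 3).eval s₁ = S := (f.1 3 (by norm_num)).trans h3
    refine Ends.setReg (e := .reg 3) ?_
    rw [e]
    exact ⟨rfl, f.trans (frame_setReg4 s₁ S), by simp [State.setReg]⟩
  have hM4 : ∀ e < 4, ∀ i < 2 * H, |s.mem (10 + e) i| ≤ 2 := by
    intro e he i hi
    have := hM ⟨e / 2, by omega⟩ ⟨e % 2, by omega⟩ i hi
    simp only [memM, Nat.div_add_mod] at this
    exact this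
  refine Ends.mono (T := 2 + ((H * 400 + 20) + ((H * 200 + 20) + ((t * (H * 3000 + 50) + 5) +
    (2 + ((H * 2000 + 40) + ((t * (H * 3000 + 50) + 5) + (2 + (H * 200 + 20)))))))))
    (Q := fun s' => Frame 10 s s' ∧
      ∀ r c, ∀ i < 2 * H, |memM s' r c i - convArr S n (memM s) r c i| ≤
        (560 * t + 8) * u * (16 * 64 ^ t)) ?_ (by linarith [Nat.zero_le H]) fun _ h => h
  refine (hset s (Frame.refl _ _)).seq fun s₁ ⟨_, f1, r1⟩ => ?_
  refine (ends_zero (H := H) ((f1.1 1 (by norm_num)).trans h1) (by omega)).seq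
    fun s₂ ⟨f2, r2, z2⟩ => ?_
  replace f2 := f1.trans f2
  refine (ends_gather ((f2.1 2 (by norm_num)).trans h2) (r2.trans r1) hS z2).seq
    fun s₃ ⟨f3, z3⟩ => ?_
  replace f3 := f2.trans f3
  have hgv : ∀ x < 8, gatherVec H S s₂ x = gatherVec H S s x := by
    intro x hx
    unfold gatherVec
    split_ifs
    · rw [f2.2 (10 + x) (by omega)]
    · rw [f2.2 (6 + x) (by omega)]
    · rw [f2.2 (6 + x) (by omega)]
  have c3 : ∀ x < 8, CAp u 0 2 (2 * H) s₃ x fun i => (gatherVec H S s x i : ℂ) := by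
    intro x hx i hi
    rw [(z3 x hx i hi).1, (z3 x hx i hi).2, hgv x hx]
    exact ⟨Ap.exact hu le_rfl (abs_gatherVec_le (by norm_num) hM4 hx i),
      Ap.exact hu le_rfl (by simp)⟩
  refine (ends_fwdProg (t := t) hu le_rfl (hc _ (by linarith)) ((f3.1 1 (by norm_num)).trans h1)
    ((f3.1 2 (by norm_num)).trans h2) ((f3.1 3 (by norm_num)).trans h3) hS hN c3).seq
    fun s₄ ⟨f4, c4⟩ => ?_
  replace f4 := f3.trans f4
  refine (hset s₄ f4).seq fun s₅ ⟨e5, f5, r5⟩ => ?_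
  have c5 : ∀ x < 8, CAp u (0 + 140 * t) (4 ^ t * 2) (2 * H) s₅ x
      (fftReal H S t (gatherVec H S s x)) := by rw [e5]; exact c4
  refine (ends_prod hu (by positivity) (hc _ (by linarith)) ((f5.1 1 (by norm_num)).trans h1)
    (by omega) c5).seq fun s₆ ⟨f6, c6⟩ => ?_
  replace f6 := f5.trans f6
  refine (ends_invProg (t := t) hu (by positivity) (hc _ (by linarith))
    ((f6.1 1 (by norm_num)).trans h1) ((f6.1 2 (by norm_num)).trans h2)
    ((f6.1 3 (by norm_num)).trans h3) hS hN (y := fun x p =>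
      fftReal H S t (gatherVec H S s (2 * (x / 2))) p *
        fftReal H S t (gatherVec H S s (4 + x % 2)) p +
      fftReal H S t (gatherVec H S s (2 * (x / 2) + 1)) p *
        fftReal H S t (gatherVec H S s (6 + x % 2)) p) c6).seq fun s₇ ⟨f7, c7⟩ => ?_
  replace f7 := f6.trans f7
  refine (hset s₇ f7).seq fun s₈ ⟨e8, f8, r8⟩ => ?_
  refine (ends_write (H := H) ((f8.1 1 (by norm_num)).trans h1) (by omega)).mono le_rfl
    fun s₉ ⟨f9, w9⟩ => ⟨(f8.mono (by norm_num)).trans f9, fun r c i hi => ?_⟩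
  have he : 2 * (r : ℕ) + c < 4 := by omega
  have key := (c7 _ he i hi).1
  have hfr : (fun p => fftReal H S t (gatherVec H S s (2 * ((2 * (r : ℕ) + c) / 2))) p *
        fftReal H S t (gatherVec H S s (4 + (2 * (r : ℕ) + c) % 2)) p +
      fftReal H S t (gatherVec H S s (2 * ((2 * (r : ℕ) + c) / 2) + 1)) p *
        fftReal H S t (gatherVec H S s (6 + (2 * (r : ℕ) + c) % 2)) p) =
      freqProd H S t (memM s) r c := funext fun p => (freqProd_eq t r c p).symm
  rw [hfr, invIter_freqProd hS hn hH ht _ _ _ hi, Complex.ofReal_re] at key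
  have hw : memM s₉ r c i = s₇.mem (20 + (2 * (r : ℕ) + c)) i := by
    rw [memM, w9 _ he i hi, e8]; rfl
  rw [hw]
  refine key.2.trans (le_of_eq ?_)
  have : (64 : ℝ) ^ t = 4 ^ t * (4 ^ t * 4 ^ t) := by
    rw [← mul_pow, ← mul_pow]; norm_num
  rw [this]; ring

end level

/-! ### The evaluation of `F` -/

/-- The length of the arrays: the least power of two that is at least `2` and `2 d + 1`. -/
def arrLen (d : ℕ) : ℕ := 2 ^ (Nat.size d + 1)

def sizeProg : Prog :=
  .seq (.setReg 1 (.lit 2)) (.while (.nlt (.reg 1) (.add (NExpr.dbl (.reg 0)) (.lit 1)))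
    (.setReg 1 (NExpr.dbl (.reg 1))))

/-- The phase of the matrix number `reg 5`. -/
def phaseExpr (a : ℕ) : RExpr :=
  .load a (.add (.sub (.reg 5) (.reg 0)) (.sub (.reg 0) (.reg 5)))

def initStores (a : ℕ) : List Store :=
  [⟨10, .reg 5, .cos (phaseExpr a)⟩, ⟨11, .reg 5, .sub (.ofNat (.lit 0)) (.sin (phaseExpr a))⟩,
   ⟨12, .reg 5, .sin (phaseExpr a)⟩, ⟨13, .reg 5, .cos (phaseExpr a)⟩]

/-- For index `0` this doubles the middle coefficient; that entry is overwritten after the loop. -/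
def outStores (o : ℕ) : List Store :=
  [⟨o, .reg 5, .add (.load 12 (.sub (.reg 0) (.reg 5))) (.load 12 (.add (.reg 0) (.reg 5)))⟩]

def treeProg : Prog :=
  .while (.nlt (.lit 0) (.reg 3)) (.seq levelProg (.setReg 3 (.half (.reg 3))))

/-- Evaluate `F` at the contents of array `a`, with output in array `o`. -/
def evalProg (a o : ℕ) : Prog :=
  .seq sizeProg (.seq (.setReg 2 (.half (.reg 1))) (.seq (.setReg 4 (.lit 1))
    (.seq (pass 1 (initStores a)) (.seq (.setReg 3 (.reg 2)) (.seq treeProg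
      (.seq (.setReg 7 (.add (.reg 0) (.lit 1))) (.seq (.setReg 4 (.lit 1))
        (.seq (pass 7 (outStores o)) (.store o (.lit 0) (.load 12 (.reg 0)))))))))))

/-- The phases in the order of the factors. -/
def phaseSeq (d : ℕ) (x : ℕ → ℝ) (i : ℕ) : ℝ := x ((i - d) + (d - i))

theorem two_mul_add_one_le_arrLen (d : ℕ) : 2 * d + 1 ≤ arrLen d := by
  have := Nat.lt_size_self d
  rw [arrLen, pow_succ]; omega

/-- Beyond position `2 d` the index `|i - d|` exceeds `d`, where the array is zero, so the padding
comes for free. -/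
theorem map_phaseSeq {d N : ℕ} {x : ℕ → ℝ} {Ψ : Fin (d + 1) → ℝ} (hx : ∀ j : Fin (d + 1), x j = Ψ j)
    (hx0 : ∀ p, d < p → x p = 0) (hN : 2 * d + 1 ≤ N) :
    (List.range N).map (phaseSeq d x) =
      List.ofFn (full Ψ) ++ List.replicate (N - (2 * d + 1)) 0 := by
  refine List.ext_getElem (by simp; omega) fun i h1 h2 => ?_
  simp only [List.getElem_map, List.getElem_range, List.getElem_append, List.length_ofFn,
    List.getElem_ofFn, List.getElem_replicate, phaseSeq]
  split_ifs with h
  · rw [full, ← hx]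
    congr 1
    simp only
    omega
  · exact hx0 _ (by omega)

section evalProg

variable {u : ℝ} {A : Arith u} {s : State} {d : ℕ}

/-- Register `0` and the arrays below `10` are the same. -/
def Keep (s s' : State) : Prop := s'.reg 0 = s.reg 0 ∧ ∀ a < 10, s'.mem a = s.mem a

theorem Keep.trans {s s' s'' : State} (h : Keep s s') (h' : Keep s' s'') : Keep s s'' :=
  ⟨h'.1.trans h.1, fun a ha => (h'.2 a ha).trans (h.2 a ha)⟩

theorem Frame.keep {s s' : State} (h : Frame 10 s s') : Keep s s' := ⟨h.1 0 (by norm_num), h.2⟩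

theorem keep_setReg (s : State) {r : ℕ} (hr : r ≠ 0) (n : ℕ) : Keep s (s.setReg r n) :=
  ⟨by simp [State.setReg, hr.symm], fun _ _ => rfl⟩

theorem ends_sizeProg (h0 : s.reg 0 = d) :
    Ends A sizeProg s (Nat.size d * 12 + 10) fun s' => Keep s s' ∧ s'.reg 1 = arrLen d := by
  refine Ends.mono (T := 2 + (Nat.size d * (7 + 4) + 7)) (Ends.seq
    (R := fun s' => Keep s s' ∧ s'.reg 1 = 2 ^ (Nat.size d + 1))
    (Ends.setReg (e := .lit 2) (Q := fun s' => s' = s.setReg 1 2) rfl) ?_) (by omega) fun _ h => h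
  rintro _ rfl
  refine Ends.while_count (b := .nlt (.reg 1) (.add (NExpr.dbl (.reg 0)) (.lit 1)))
    (Nat.size d) (fun k s' => Keep s s' ∧ s'.reg 1 = 2 ^ (k + 1))
    ⟨keep_setReg s (r := 1) (by norm_num) 2, by simp [State.setReg]⟩ ?_ ?_
  · rintro k hk s₁ ⟨f1, f2⟩
    have hk' := Nat.lt_size.1 hk
    refine ⟨?_, Ends.setReg (e := NExpr.dbl (.reg 1)) ⟨f1.trans (keep_setReg s₁ (by norm_num) _), ?_⟩⟩
    · simp only [Test.holds, NExpr.eval, NExpr.dbl, f1.1, f2, h0, pow_succ]; omega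
    · simp [State.setReg, NExpr.eval, NExpr.dbl, f2, pow_succ]; ring
  · rintro s₁ ⟨f1, f2⟩
    have := Nat.lt_size_self d
    simp only [Test.holds, NExpr.eval, NExpr.dbl, f1.1, f2, h0, pow_succ]; omega

/-- The stored phases are read without rounding, so the errors of their sines and cosines do not
depend on their size. The constant `3` comes from forming `-sin` as `0 - sin`. -/
theorem ends_leaves {a N : ℕ} (hu : 0 ≤ u) (hu1 : u ≤ 1) (ha : a < 10) (h0 : s.reg 0 = d)
    (h1 : s.reg 1 = N) (h4 : s.reg 4 = 1) :
    Ends A (pass 1 (initStores a)) s (N * 100 + 20) fun s' => Frame 10 s s' ∧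
      TreeClose (phaseSeq d (s.mem a)) N 1 0 (memM s') (3 * u) := by
  have hmem : ∀ {st}, st ∈ initStores a → 10 ≤ st.arr ∧ st.idx = .reg 5 := by
    intro st hst
    simp only [initStores, List.mem_cons, List.not_mem_nil, or_false] at hst
    obtain rfl | rfl | rfl | rfl := hst <;> simp
  have hsep : Separate (initStores a) := by
    refine Separate.of_pred (fun a => 10 ≤ a) (fun st hst => (hmem hst).1) fun st hst a' ha' => ?_
    simp only [initStores, List.mem_cons, List.not_mem_nil, or_false] at hst
    obtain rfl | rfl | rfl | rfl := hst <;> simp [RExpr.arrays, phaseExpr] at ha' <;> omega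
  have hinj : Injective (initStores a) s (s.reg 1) := by
    intro st hst st' hst' i hi i' hi' ha he
    rw [(hmem hst).2, (hmem hst').2] at he
    simp [NExpr.eval, atIter_reg] at he
    refine ⟨?_, he⟩
    simp only [initStores, List.mem_cons, List.not_mem_nil, or_false] at hst hst'
    obtain rfl | rfl | rfl | rfl := hst <;> obtain rfl | rfl | rfl | rfl := hst' <;>
      first | rfl | (simp at ha)
  refine (ends_pass_of_injective (by norm_num) (by norm_num) hsep (by omega) hinj).mono ?_
    fun s' h => ⟨⟨fun r hr => h.1 r (by omega) (by omega), fun a' ha' => funext fun p =>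
      h.2.2 a' p fun i _ st hst e => ?_⟩, ?_⟩
  · have : storesCost (initStores a) + 20 ≤ 100 := by
      simp [storesCost, initStores, Store.cost, phaseExpr, NExpr.cost, RExpr.cost]
    rw [h1]; gcongr
  · have := (hmem hst).1
    omega
  · intro r c b hb ζ hζ
    have hb1 : b < s.reg 1 := by omega
    have m0 := h.2.1 b hb1 _ (List.mem_cons_self ..)
    have m1 := h.2.1 b hb1 _ (List.mem_cons_of_mem _ (List.mem_cons_self ..))
    have m2 := h.2.1 b hb1 _ (List.mem_cons_of_mem _ (List.mem_cons_of_mem _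
      (List.mem_cons_self ..)))
    have m3 := h.2.1 b hb1 _ (List.mem_cons_of_mem _ (List.mem_cons_of_mem _
      (List.mem_cons_of_mem _ (List.mem_cons_self ..))))
    simp only [NExpr.eval, RExpr.eval, phaseExpr, atIter_reg, atIter_mem] at m0 m1 m2 m3
    norm_num [h0] at m0 m1 m2 m3
    change s'.mem 10 b = A.cos (phaseSeq d (s.mem a) b) at m0
    change s'.mem 11 b = A.sub (A.ofNat 0) (A.sin (phaseSeq d (s.mem a) b)) at m1
    change s'.mem 12 b = A.sin (phaseSeq d (s.mem a) b) at m2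
    change s'.mem 13 b = A.cos (phaseSeq d (s.mem a) b) at m3
    set θ := phaseSeq d (s.mem a) b with hθ
    have hcos : |A.cos θ - Real.cos θ| ≤ 3 * u := by
      have h1 := A.cos_err θ
      have h2 := mul_le_mul_of_nonneg_left (Real.abs_cos_le_one θ) hu
      linarith
    have hsin : |A.sin θ - Real.sin θ| ≤ u := by
      have h1 := A.sin_err θ
      have h2 := mul_le_mul_of_nonneg_left (Real.abs_sin_le_one θ) hu
      linarith
    have hneg : |A.sub (A.ofNat 0) (A.sin θ) - -Real.sin θ| ≤ 3 * u := by
      rw [A.ofNat_zero]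
      have h1 := A.sub_err 0 (A.sin θ)
      have h2 : |0 - A.sin θ| ≤ 2 := by
        rw [zero_sub, abs_neg]
        have h3 := abs_add_le (A.sin θ - Real.sin θ) (Real.sin θ)
        rw [sub_add_cancel] at h3
        linarith [Real.abs_sin_le_one θ]
      have h3 := mul_le_mul_of_nonneg_left h2 hu
      have h4 := abs_add_le (A.sub 0 (A.sin θ) - (0 - A.sin θ)) (-(A.sin θ - Real.sin θ))
      rw [abs_neg] at h4
      have e : A.sub 0 (A.sin θ) - (0 - A.sin θ) + -(A.sin θ - Real.sin θ) =
          A.sub 0 (A.sin θ) - -Real.sin θ := by ring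
      rw [e] at h4
      linarith
    rw [aeval_arrPoly, Finset.sum_range_one, zero_mul, zero_add, pow_zero, mul_one, treeMat, ← hθ]
    have e : ∀ (v w : ℝ), |v - w| ≤ 3 * u → ‖(v : ℂ) - (w : ℂ)‖ ≤ 3 * u := by
      intro v w h
      rwa [← Complex.ofReal_sub, Complex.norm_real]
    fin_cases r <;> fin_cases c
    · have := e _ _ hcos; rw [← m0] at this; exact this
    · have := e _ _ hneg; rw [← m1, Complex.ofReal_neg] at this; exact this
    · have := e _ _ (hsin.trans (by linarith)); rw [← m2] at this; exact this
    · have := e _ _ hcos; rw [← m3] at this; exact this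

/-- The error after `k` levels is at most `7 ^ k * E`: a level multiplies the old error by `6` and
adds at most `E`. With `m + 1` levels, `7 ^ (m + 1) ≤ 8 ^ (m + 1) = N ^ 3`. -/
theorem ends_treeProg {m : ℕ} {φ : ℕ → ℝ} (hu : 0 ≤ u)
    (hsmall : 10 ^ 4 * (2 ^ (m + 1) : ℝ) ^ 11 * u ≤ 1)
    (h1 : s.reg 1 = 2 ^ (m + 1)) (h2 : s.reg 2 = 2 ^ m) (h3 : s.reg 3 = 2 ^ m)
    (hT : TreeClose φ (2 ^ (m + 1)) 1 0 (memM s) (3 * u)) :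
    Ends A treeProg s ((m + 1) * ((m + 1) * (2 ^ m * 6000 + 100) + 2 ^ m * 3000 + 210) + 10)
      fun s' => Keep s s' ∧ TreeClose φ 1 (2 ^ (m + 1)) (m + 1) (memM s')
        (10 ^ 4 * (2 ^ (m + 1) : ℝ) ^ 11 * u) := by
  set N : ℝ := 2 ^ (m + 1) with hNdef
  have hN1 : 1 ≤ N := one_le_pow₀ (by norm_num)
  -- A bound for the fresh error of any level, `N * (568 N u) * (16 N ^ 6)`: one factor `N` for the
  -- number of coefficients, one for the logarithm, `N ^ 6` for `64 ^ t`.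
  set E : ℝ := 10 ^ 4 * N ^ 8 * u with hE
  have hE0 : 0 ≤ E := by positivity
  have hEk : ∀ k ≤ m + 1, 7 ^ k * E ≤ 10 ^ 4 * N ^ 11 * u := by
    intro k hk
    have h7 : (7 : ℝ) ^ k ≤ N ^ 3 := by
      calc (7 : ℝ) ^ k ≤ 8 ^ k := by gcongr; norm_num
        _ ≤ 8 ^ (m + 1) := by gcongr; norm_num
        _ = N ^ 3 := by rw [hNdef, ← pow_mul, mul_comm, pow_mul]; norm_num
    calc 7 ^ k * E ≤ N ^ 3 * E := by gcongr
      _ = 10 ^ 4 * N ^ 11 * u := by rw [hE]; ring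
  have hmN : (m : ℝ) + 1 ≤ N := by
    have : m + 1 < 2 ^ (m + 1) := Nat.lt_two_pow_self
    rw [hNdef]; exact_mod_cast this.le
  let I : ℕ → State → Prop := fun k s' => Keep s s' ∧ s'.reg 1 = 2 ^ (m + 1) ∧ s'.reg 2 = 2 ^ m ∧
    s'.reg 3 = 2 ^ m / 2 ^ k ∧ TreeClose φ (2 ^ (m + 1 - k)) (2 ^ k) k (memM s') (7 ^ k * E)
  have h0 : I 0 s := by
    refine ⟨⟨rfl, fun _ _ => rfl⟩, h1, h2, by simpa using h3, fun r c b hb ζ hζ => ?_⟩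
    refine (hT r c b hb ζ hζ).trans ?_
    rw [pow_zero, one_mul, hE]
    have : (1 : ℝ) ≤ N ^ 8 := one_le_pow₀ hN1
    gcongr
    linarith
  refine Ends.mono (Ends.while_count (b := .nlt (.lit 0) (.reg 3)) (m + 1) I h0
    (T := (m + 1) * (2 ^ m * 6000 + 100) + 2 ^ m * 3000 + 205) ?_ ?_) ?_ ?_
  · rintro k hk s₁ ⟨f0, f1, f2, f3, f4⟩
    have hdiv : 2 ^ m / 2 ^ k = 2 ^ (m - k) := Nat.pow_div (by omega) (by norm_num)
    rw [hdiv] at f3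
    refine ⟨by simp [Test.holds, NExpr.eval, f3], ?_⟩
    have hmk : m + 1 - k = (m - k) + 1 := by omega
    have hB : 2 ^ (m + 1 - k) = 2 * 2 ^ (m - k) := by rw [hmk, pow_succ]; ring
    have hH : 2 ^ m = 2 ^ k * 2 ^ (m - k) := by rw [← pow_add]; congr 1; omega
    have hε : 7 ^ k * E ≤ 1 := (hEk k hk.le).trans hsmall
    rw [hB] at f4
    have hM : ∀ r c, ∀ i < 2 * 2 ^ m, |memM s₁ r c i| ≤ 2 := fun r c i hi =>
      f4.abs_le hε (by positivity) r c (by rw [hH] at hi; linarith)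
    have hk1 : ((k + 1 : ℕ) : ℝ) ≤ N := by
      push_cast
      have : (k : ℝ) ≤ m := by exact_mod_cast (by omega : k ≤ m)
      linarith
    have hcK : 560 * ((k + 1 : ℕ) : ℝ) + 8 ≤ 568 * N := by linarith
    have hKu : (560 * ((k + 1 : ℕ) : ℝ) + 8) * u ≤ 1 := by
      refine le_trans (mul_le_mul_of_nonneg_right (hcK.trans ?_) hu) hsmall
      have : N ≤ N ^ 11 := le_self_pow₀ hN1 (by norm_num)
      nlinarith
    have hlev := ends_level (A := A) (s := s₁) (H := 2 ^ m) (S := 2 ^ (m - k)) (n := 2 ^ k)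
      (t := k + 1) hu (by positivity) (by positivity) hH (by rw [pow_succ]; ring) hKu
      (by rw [f1, pow_succ]; ring) f2 f3 hM
    refine Ends.mono (T := (k + 1) * (2 ^ m * 6000 + 100) + 2 ^ m * 3000 + 200 + 3)
      (hlev.seq (R := I (k + 1)) ?_) ?_ fun _ h => h
    · rintro s₂ ⟨g1, g2⟩
      refine Ends.setReg (e := .half (.reg 3))
        ⟨f0.trans (g1.keep.trans (keep_setReg s₂ (by norm_num) _)), ?_, ?_, ?_, ?_⟩
      · simpa [State.setReg] using (g1.1 1 (by norm_num)).trans f1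
      · simpa [State.setReg] using (g1.1 2 (by norm_num)).trans f2
      · simp only [State.setReg, NExpr.eval, Function.update_self, g1.1 3 (by norm_num), f3, ← hdiv,
          Nat.div_div_eq_div_mul, pow_succ]
      · have hstep := f4.step (δ := (560 * ((k + 1 : ℕ) : ℝ) + 8) * u * (16 * 64 ^ (k + 1)))
          (M' := memM s₂) (by positivity) hε fun r c i hi => g2 r c i (by rw [hH]; linarith)
        rw [show m + 1 - (k + 1) = m - k by omega, show 2 ^ (k + 1) = 2 * 2 ^ k by rw [pow_succ]; ring]
        intro r c b hb ζ hζ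
        refine (hstep r c b hb ζ hζ).trans ?_
        have h64 : (64 : ℝ) ^ (k + 1) ≤ N ^ 6 := by
          calc (64 : ℝ) ^ (k + 1) ≤ 64 ^ (m + 1) := by
                refine pow_le_pow_right₀ (by norm_num) (by omega)
            _ = N ^ 6 := by rw [hNdef, ← pow_mul, mul_comm, pow_mul]; norm_num
        have h2k : 2 * ((2 ^ k : ℕ) : ℝ) ≤ N := by
          push_cast
          rw [hNdef, pow_succ, mul_comm]
          gcongr
          · norm_num
          · omega
        have hfin : 2 * ((2 ^ k : ℕ) : ℝ) *
            ((560 * ((k + 1 : ℕ) : ℝ) + 8) * u * (16 * 64 ^ (k + 1))) ≤ E := by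
          calc _ ≤ N * ((568 * N) * u * (16 * N ^ 6)) := by gcongr
            _ = 9088 * (N ^ 8 * u) := by ring
            _ ≤ 10 ^ 4 * (N ^ 8 * u) := by gcongr; norm_num
            _ = E := by rw [hE]; ring
        have h7 : E ≤ 7 ^ k * E := le_mul_of_one_le_left hE0 (one_le_pow₀ (by norm_num))
        rw [pow_succ (7 : ℝ)]
        linarith
    · have := Nat.mul_le_mul_right (2 ^ m * 6000 + 100) (show k + 1 ≤ m + 1 by omega)
      omega
  · rintro s₁ ⟨f0, f1, f2, f3, f4⟩
    have : 2 ^ m / 2 ^ (m + 1) = 0 := Nat.div_eq_of_lt (Nat.pow_lt_pow_right (by norm_num) (by omega))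
    simp [Test.holds, NExpr.eval, f3, this]
  · have e : (Test.nlt (.lit 0) (.reg 3)).cost = 3 := rfl
    rw [e]
    have := Nat.mul_le_mul_left (m + 1) (show
      3 + ((m + 1) * (2 ^ m * 6000 + 100) + 2 ^ m * 3000 + 205) ≤
      (m + 1) * (2 ^ m * 6000 + 100) + 2 ^ m * 3000 + 210 by omega)
    exact Nat.add_le_add this (by norm_num)
  · rintro s₁ ⟨f0, f1, f2, f3, f4⟩
    refine ⟨f0, fun r c b hb ζ hζ => ?_⟩
    rw [Nat.sub_self, pow_zero] at f4
    exact (f4 r c b hb ζ hζ).trans (hEk _ le_rfl)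

end evalProg

section evalProg

variable {u : ℝ} {A : Arith u} {s : State} {d : ℕ}

theorem abs_coeff_sub_le_of_treeClose {m : ℕ} {x : ℕ → ℝ} {Ψ : Fin (d + 1) → ℝ} {ε : ℝ}
    {M : Fin 2 → Fin 2 → ℕ → ℝ} (hx : ∀ j : Fin (d + 1), x j = Ψ j) (hx0 : ∀ p, d < p → x p = 0)
    (hN : 2 * d + 1 ≤ 2 ^ m) (h : TreeClose (phaseSeq d x) 1 (2 ^ m) m M ε) {k : ℕ}
    (hk : k < 2 ^ m) : |M 1 0 k - (colPoly (List.ofFn (full Ψ))).2.coeff k| ≤ ε := by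
  have h1 := abs_coeff_le_of_circle (c := ε)
    (P := arrPoly 1 (2 ^ m) (M 1 0) 0 - (colPoly (List.ofFn (full Ψ))).2) (fun ζ hζ => ?_) k
  · rwa [coeff_sub, coeff_arrPoly, if_pos hk, mul_one, add_zero] at h1
  · have h2 := h 1 0 0 (by norm_num) ζ hζ
    rwa [treeMat_col, map_phaseSeq hx hx0 hN, colPoly_append_zeros, ← map_sub] at h2

theorem ends_out {o : ℕ} (ho : o < 10) (h0 : s.reg 0 = d) (h7 : s.reg 7 = d + 1)
    (h4 : s.reg 4 = 1) :
    Ends A (.seq (pass 7 (outStores o)) (.store o (.lit 0) (.load 12 (.reg 0)))) s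
      ((d + 1) * 40 + 30) fun s' => s'.reg 0 = d ∧ (∀ a < 10, a ≠ o → s'.mem a = s.mem a) ∧
        (∀ p, d < p → s'.mem o p = s.mem o p) ∧ s'.mem o 0 = s.mem 12 d ∧
        ∀ j, 0 < j → j ≤ d → s'.mem o j = A.add (s.mem 12 (d - j)) (s.mem 12 (d + j)) := by
  have hsep : Separate (outStores o) := by
    refine Separate.of_pred (fun a => a < 10) (fun st hst => ?_) fun st hst a ha => ?_
    · simp only [outStores, List.mem_singleton] at hst
      subst hst; exact ho
    · simp only [outStores, List.mem_singleton] at hst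
      subst hst
      simp [RExpr.arrays] at ha; omega
  have hinj : Injective (outStores o) s (s.reg 7) := by
    intro st hst st' hst' i hi i' hi' ha he
    simp only [outStores, List.mem_singleton] at hst hst'
    subst hst; subst hst'
    simp [NExpr.eval, atIter_reg] at he
    exact ⟨rfl, he⟩
  have hpass := ends_pass_of_injective (A := A) (nr := 7) (by norm_num) (by norm_num) hsep
    (by omega) hinj
  have hcost : storesCost (outStores o) + 20 ≤ 40 := by
    simp [storesCost, outStores, Store.cost, NExpr.cost, RExpr.cost]
  refine (hpass.seq (R := fun s' => s'.reg 0 = d ∧ (∀ a < 10, a ≠ o → s'.mem a = s.mem a) ∧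
        (∀ p, d < p → s'.mem o p = s.mem o p) ∧ s'.mem o 0 = s.mem 12 d ∧
        ∀ j, 0 < j → j ≤ d → s'.mem o j = A.add (s.mem 12 (d - j)) (s.mem 12 (d + j)))
        (T' := 4) ?_).mono ?_ fun _ h => h
  · rintro s₁ ⟨f1, f2, f3⟩
    have r0 : s₁.reg 0 = d := (f1 0 (by norm_num) (by norm_num)).trans h0
    have hne : ∀ a, a ≠ o → s₁.mem a = s.mem a := fun a ha => funext fun p =>
      f3 a p fun i _ st hst e => by
        simp only [outStores, List.mem_singleton] at hst
        subst hst
        exact absurd e.symm ha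
    refine Ends.store (i := .lit 0) (e := .load 12 (.reg 0)) ⟨r0, fun a ha hao => ?_,
      fun p hp => ?_, ?_, fun j hj hjd => ?_⟩
    · simp only [State.store, Function.update_of_ne hao, hne a hao]
    · have hp0 : p ≠ (NExpr.lit 0).eval s₁ := by simp only [NExpr.eval]; omega
      simp only [State.store, Function.update_self, Function.update_of_ne hp0]
      refine f3 o p fun i hi st hst e => ?_
      simp only [outStores, List.mem_singleton] at hst
      subst hst
      simp [NExpr.eval, atIter_reg]; omega
    · simp only [State.store, Function.update_self, NExpr.eval, RExpr.eval, r0,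
        hne 12 (by omega)]
    · have hj0 : j ≠ (NExpr.lit 0).eval s₁ := by simp only [NExpr.eval]; omega
      simp only [State.store, Function.update_self, Function.update_of_ne hj0]
      have := f2 j (by omega) _ (List.mem_cons_self ..)
      simpa [NExpr.eval, RExpr.eval, atIter_reg, h0] using this
  · rw [h7]
    have := Nat.mul_le_mul_left (d + 1) hcost
    omega

/-- The bound for the cost of `evalProg`. -/
def evalCost (d : ℕ) : ℕ := 20000 * (Nat.size d + 1) ^ 2 * 2 ^ Nat.size d

theorem ends_evalProg {a o : ℕ} {Ψ : Fin (d + 1) → ℝ} (hu : 0 ≤ u)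
    (hsmall : 10 ^ 4 * (arrLen d : ℝ) ^ 11 * u ≤ 1) (ha : a < 10) (ho : o < 10) (h0 : s.reg 0 = d)
    (hx : ∀ j : Fin (d + 1), s.mem a j = Ψ j) (hx0 : ∀ p, d < p → s.mem a p = 0) :
    Ends A (evalProg a o) s (evalCost d) fun s' => s'.reg 0 = d ∧
      (∀ a' < 10, a' ≠ o → s'.mem a' = s.mem a') ∧ (∀ p, d < p → s'.mem o p = s.mem o p) ∧
      ∀ j : Fin (d + 1), |s'.mem o j - F Ψ j| ≤ 3 * (10 ^ 4 * (arrLen d : ℝ) ^ 11 * u) := by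
  set m := Nat.size d with hm
  have hNR : ((arrLen d : ℕ) : ℝ) = 2 ^ (m + 1) := by rw [arrLen]; push_cast; rfl
  have hN1 : (1 : ℝ) ≤ arrLen d := by rw [hNR]; exact one_le_pow₀ (by norm_num)
  set ε : ℝ := 10 ^ 4 * (arrLen d : ℝ) ^ 11 * u with hε
  -- Absorbs the rounding of the last addition, whose operands are at most `2`; with the errors of
  -- the two coefficients this makes `3 ε`.
  have huε : 4 * u ≤ ε := by
    have : (1 : ℝ) ≤ (arrLen d : ℝ) ^ 11 := one_le_pow₀ hN1
    rw [hε]; gcongr; linarith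
  have hNd := two_mul_add_one_le_arrLen d
  refine Ends.mono (T := (m * 12 + 10) + (3 + (2 + ((arrLen d * 100 + 20) + (2 +
    (((m + 1) * ((m + 1) * (2 ^ m * 6000 + 100) + 2 ^ m * 3000 + 210) + 10) + (4 + (2 +
      ((d + 1) * 40 + 30)))))))))
    (Q := fun s' => s'.reg 0 = d ∧
      (∀ a' < 10, a' ≠ o → s'.mem a' = s.mem a') ∧ (∀ p, d < p → s'.mem o p = s.mem o p) ∧
      ∀ j : Fin (d + 1), |s'.mem o j - F Ψ j| ≤ 3 * ε) ?_ ?_ fun _ h => h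
  · refine (ends_sizeProg h0).seq fun s₁ ⟨k1, r1⟩ => ?_
    have hhalf : arrLen d / 2 = 2 ^ m := by
      rw [arrLen, pow_succ]; exact Nat.mul_div_cancel _ (by norm_num)
    refine (Ends.setReg (e := .half (.reg 1)) (Q := fun s' => Keep s s' ∧ s'.reg 1 = arrLen d ∧
      s'.reg 2 = 2 ^ m) ⟨k1.trans (keep_setReg s₁ (by norm_num) _), by simpa [State.setReg] using r1,
        by simp [State.setReg, NExpr.eval, r1, hhalf]⟩).seq fun s₂ ⟨k2, r21, r22⟩ => ?_
    refine (Ends.setReg (e := .lit 1) (Q := fun s' => Keep s s' ∧ s'.reg 1 = arrLen d ∧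
      s'.reg 2 = 2 ^ m ∧ s'.reg 4 = 1) ⟨k2.trans (keep_setReg s₂ (by norm_num) _),
        by simpa [State.setReg] using r21, by simpa [State.setReg] using r22,
        by simp [State.setReg, NExpr.eval]⟩).seq fun s₃ ⟨k3, r31, r32, r34⟩ => ?_
    refine (ends_leaves (d := d) hu (by linarith) ha (k3.1.trans h0) r31 r34).seq
      fun s₄ ⟨f4, t4⟩ => ?_
    rw [k3.2 a ha] at t4
    have k4 := k3.trans f4.keep
    have r41 : s₄.reg 1 = arrLen d := (f4.1 1 (by norm_num)).trans r31
    have r42 : s₄.reg 2 = 2 ^ m := (f4.1 2 (by norm_num)).trans r32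
    refine (Ends.setReg (e := .reg 2) (Q := fun s' => Keep s s' ∧ s'.reg 1 = arrLen d ∧
      s'.reg 2 = 2 ^ m ∧ s'.reg 3 = 2 ^ m ∧
      TreeClose (phaseSeq d (s.mem a)) (2 ^ (m + 1)) 1 0 (memM s') (3 * u))
      ⟨k4.trans (keep_setReg s₄ (by norm_num) _), by simpa [State.setReg] using r41,
        by simpa [State.setReg] using r42, by simp [State.setReg, NExpr.eval, r42], t4⟩).seq
      fun s₅ ⟨k5, r51, r52, r53, t5⟩ => ?_
    rw [hNR] at hε
    refine (ends_treeProg hu (hε ▸ hsmall) r51 r52 r53 t5).seq fun s₆ ⟨k6, t6⟩ => ?_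
    replace k6 := k5.trans k6
    rw [← hε] at t6
    have hcoef : ∀ k < 2 ^ (m + 1),
        |s₆.mem 12 k - (colPoly (List.ofFn (full Ψ))).2.coeff k| ≤ ε := fun k hk =>
      abs_coeff_sub_le_of_treeClose hx hx0 hNd t6 hk
    have hbd : ∀ k < 2 ^ (m + 1), |s₆.mem 12 k| ≤ 2 := fun k hk =>
      t6.abs_le hsmall (by norm_num) 1 0 (by simpa using hk)
    refine (Ends.setReg (e := .add (.reg 0) (.lit 1)) (Q := fun s' => Keep s s' ∧
      s'.reg 7 = d + 1 ∧ s'.mem = s₆.mem) ⟨k6.trans (keep_setReg s₆ (by norm_num) _), by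
        simp [State.setReg, NExpr.eval, k6.1, h0], rfl⟩).seq fun s₇ ⟨k7, r7, e7⟩ => ?_
    refine (Ends.setReg (e := .lit 1) (Q := fun s' => Keep s s' ∧
      s'.reg 7 = d + 1 ∧ s'.reg 4 = 1 ∧ s'.mem = s₆.mem) ⟨k7.trans (keep_setReg s₇ (by norm_num) _),
        by simpa [State.setReg] using r7, by simp [State.setReg, NExpr.eval], e7⟩).seq
      fun s₈ ⟨k8, r87, r84, e8⟩ => ?_
    refine (ends_out ho (k8.1.trans h0) r87 r84).mono le_rfl fun s₉ ⟨g1, g2, g3, g4, g5⟩ =>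
      ⟨g1, fun a' ha' hne => (g2 a' ha' hne).trans (k8.2 a' ha'), fun p hp => by
        rw [g3 p hp, k8.2 o ho], fun j => ?_⟩
    rw [F_eq, foldCoeff]
    rw [e8] at g4 g5
    have hdN : 2 * d + 1 ≤ 2 ^ (m + 1) := hNd
    have hε0 : 0 ≤ ε := by linarith
    split_ifs with hj
    · rw [hj, g4]
      exact (hcoef d (by omega)).trans (by linarith)
    · have hj2 := j.2
      rw [g5 j (by omega) (by omega)]
      set c₁ := s₆.mem 12 (d - j)
      set c₂ := s₆.mem 12 (d + j)
      have b1 := hcoef (d - j) (by omega)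
      have b2 := hcoef (d + j) (by omega)
      have b3 := A.add_err c₁ c₂
      have b4 : |c₁ + c₂| ≤ 4 := (abs_add_le _ _).trans
        (by linarith [hbd (d - j) (by omega), hbd (d + j) (by omega)])
      have b5 := mul_le_mul_of_nonneg_left b4 hu
      set p₁ := (colPoly (List.ofFn (full Ψ))).2.coeff (d - j)
      set p₂ := (colPoly (List.ofFn (full Ψ))).2.coeff (d + j)
      have b6 := abs_add_three (A.add c₁ c₂ - (c₁ + c₂)) (c₁ - p₁) (c₂ - p₂)
      have e : A.add c₁ c₂ - (c₁ + c₂) + (c₁ - p₁) + (c₂ - p₂) = A.add c₁ c₂ - (p₁ + p₂) := by ring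
      rw [e] at b6
      linarith
  · have h1 : d + 1 ≤ 2 ^ m := Nat.lt_size_self d
    have h2 : arrLen d = 2 ^ m * 2 := by rw [arrLen, pow_succ]
    rw [h2, evalCost, ← hm]
    generalize 2 ^ m = H at h1
    have hH : 1 ≤ H := by omega
    nlinarith [Nat.zero_le m, Nat.mul_le_mul_left m hH, Nat.mul_le_mul_left (m ^ 2) hH]

end evalProg

/-! ### The iteration -/

/-- The new iterate goes to array `4` and is copied back afterwards, because a pass may not write an
array that it reads. -/
def updateStores : List Store :=
  [⟨4, .reg 5, .sub (.load 2 (.reg 5))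
    (.div (.sub (.load 3 (.reg 5)) (.load 0 (.reg 5))) (.ofNat (.lit 2)))⟩]

def moveStores : List Store := [⟨2, .reg 5, .load 4 (.reg 5)⟩]

/-- The growth factor of the loop counter. -/
def growthExpr : RExpr := .add (.ofNat (.lit 1)) (.div (.ofNat (.lit 1)) (.ofNat (.lit 200)))

def stepProg : Prog :=
  .seq (evalProg 2 3) (.seq (.setReg 7 (.add (.reg 0) (.lit 1))) (.seq (.setReg 4 (.lit 1))
    (.seq (pass 7 updateStores) (.seq (pass 7 moveStores)
      (.store 1 (.lit 0) (.mul (.load 1 (.lit 0)) growthExpr))))))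

def iterProg : Prog := .while (.rlt (.load 1 (.lit 0)) (.ofNat (.lit 1))) stepProg

/-- The loop counter. -/
def counter {u : ℝ} (A : Arith u) (ε : ℝ) : ℕ → ℝ
  | 0 => ε
  | k + 1 => A.mul (counter A ε k) (A.add (A.ofNat 1) (A.div (A.ofNat 1) (A.ofNat 200)))

section

variable {u : ℝ} {A : Arith u} {s : State} {d : ℕ}

theorem abs_growth_sub_le (hu : 0 ≤ u) (hu' : 10 ^ 5 * u ≤ 1) :
    |A.add (A.ofNat 1) (A.div (A.ofNat 1) (A.ofNat 200)) - 1.005| ≤ 0.0002 := by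
  have h1 := Ap.ofNat A 1
  have h2 := h1.div_nat (A := A) hu (by linarith) (by linarith) (n := 200) (by norm_num)
  have h3 := (h1.mono hu (L := 1 + 8) (by norm_num) (by norm_num) le_rfl).add (A := A) hu h2
    (by linarith)
  have h4 := h3.2
  norm_num at h4 ⊢
  linarith

/-- The ideal ratio is `1.005`; the roundings of the ratio and of the product change it by less than
`0.001`. -/
theorem counter_bounds {ε : ℝ} (hu : 0 ≤ u) (hu' : 10 ^ 5 * u ≤ 1) (hε : 0 < ε) (k : ℕ) :
    1.004 ^ k * ε ≤ counter A ε k ∧ counter A ε k ≤ 1.006 ^ k * ε := by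
  induction k with
  | zero => simp [counter]
  | succ k ih =>
    have hpos : 0 < counter A ε k := lt_of_lt_of_le (by positivity) ih.1
    have hr := abs_le.1 (abs_growth_sub_le (A := A) hu hu')
    have hm := A.mul_err (counter A ε k) (A.add (A.ofNat 1) (A.div (A.ofNat 1) (A.ofNat 200)))
    rw [counter, pow_succ, pow_succ]
    set x := counter A ε k
    set r := A.add (A.ofNat 1) (A.div (A.ofNat 1) (A.ofNat 200))
    have hr1 : 1.0048 ≤ r := by linarith [hr.1]
    have hr2 : r ≤ 1.0052 := by linarith [hr.2]
    rw [abs_of_nonneg (a := x * r) (by nlinarith)] at hm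
    have h1 : u * (x * r) ≤ 0.0001 * x := by
      have : u * r ≤ 0.0001 := by nlinarith
      nlinarith
    have h2 := abs_le.1 hm
    have h3 := mul_le_mul_of_nonneg_left hr1 hpos.le
    have h4 := mul_le_mul_of_nonneg_left hr2 hpos.le
    constructor
    · linarith [h2.1, ih.1]
    · linarith [h2.2, ih.2]

/-- The number of iterations: large enough for the accuracy `ε`, and of order `log (1 / ε)`. -/
theorem exists_iterations {ε : ℝ} (hu : 0 ≤ u) (hu' : 10 ^ 5 * u ≤ 1) (hε : 0 < ε)
    (hε' : ε ≤ 1 / 2) :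
    ∃ n : ℕ, (∀ k < n, counter A ε k < A.ofNat 1) ∧ ¬ counter A ε n < A.ofNat 1 ∧
      1.5 * 0.985 ^ n ≤ ε ∧ (n : ℝ) ≤ 300 * Real.log (1 / ε) := by
  classical
  have h1 : |A.ofNat 1 - 1| ≤ 0.01 := by
    have := A.ofNat_err 1
    norm_num at this
    linarith
  have h1' := abs_le.1 h1
  have hex : ∃ n, ¬ counter A ε n < A.ofNat 1 := by
    obtain ⟨n, hn⟩ := pow_unbounded_of_one_lt (1.01 / ε) (show (1 : ℝ) < 1.004 by norm_num)
    refine ⟨n, not_lt.2 ?_⟩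
    rw [div_lt_iff₀ hε] at hn
    linarith [(counter_bounds (A := A) hu hu' hε n).1, h1'.2]
  set n := Nat.find hex
  have hn : ¬ counter A ε n < A.ofNat 1 := Nat.find_spec hex
  have hlt : ∀ k < n, counter A ε k < A.ofNat 1 := fun k hk => not_not.1 (Nat.find_min hex hk)
  refine ⟨n, hlt, hn, ?_, ?_⟩
  · have h2 : 0.99 ≤ (1.006 : ℝ) ^ n * ε := by
      linarith [(counter_bounds (A := A) hu hu' hε n).2, not_lt.1 hn, h1'.1]
    set ρ : ℝ := 1.006 ^ n with hρ
    have hρ0 : 0 < ρ := by positivity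
    have hρ2 : 1.98 ≤ ρ := by nlinarith
    -- The counter grows slowly enough for the contraction: `1.006² * 0.985 < 1`, so the error
    -- decays at least like `ρ⁻²`. The spare factor `ρ⁻¹` pays for the constant `1.5`.
    have h3 : (0.985 : ℝ) ^ n * (ρ * ρ) ≤ 1 := by
      rw [hρ, ← mul_pow, ← mul_pow]
      exact pow_le_one₀ (by norm_num) (by norm_num)
    have h4 : 0 ≤ (0.985 : ℝ) ^ n := by positivity
    have h5 : 1.5 * 0.985 ^ n * (ρ * ρ) ≤ ε * (ρ * ρ) := by
      have : 0.99 * ρ ≤ ρ * ε * ρ := mul_le_mul_of_nonneg_right h2 hρ0.le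
      linarith
    exact le_of_mul_le_mul_right h5 (by positivity)
  · have hL : 0.69 ≤ Real.log (1 / ε) := by
      have h2 : Real.log 2 ≤ Real.log (1 / ε) := by
        refine Real.log_le_log (by norm_num) ?_
        rw [le_div_iff₀ hε]; linarith
      linarith [Real.log_two_gt_d9]
    have hlog : 0.0039 ≤ Real.log 1.004 := by
      have := Real.one_sub_inv_le_log_of_pos (show (0 : ℝ) < 1.004 by norm_num)
      norm_num at this ⊢
      linarith
    -- At index `n - 1` the counter is still below `A.ofNat 1 ≤ 1.01`; one further factor `1.004`
    -- keeps the bound below `1.02`.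
    have hbd : (1.004 : ℝ) ^ n ≤ 1.02 * (1 / ε) := by
      rcases Nat.eq_zero_or_pos n with h0 | h0
      · rw [h0, pow_zero, mul_one_div, le_div_iff₀ hε]; linarith
      · have h2 := hlt (n - 1) (by omega)
        have h3 := (counter_bounds (A := A) hu hu' hε (n - 1)).1
        rw [mul_one_div, le_div_iff₀ hε, show n = (n - 1) + 1 by omega, pow_succ]
        linarith [h1'.2]
    have h4 := Real.log_le_log (by positivity) hbd
    rw [Real.log_pow, Real.log_mul (by norm_num) (by positivity)] at h4
    have h5 := Real.log_le_sub_one_of_pos (show (0 : ℝ) < 1.02 by norm_num)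
    have h6 := mul_le_mul_of_nonneg_left hlog (Nat.cast_nonneg (α := ℝ) n)
    norm_num at h5 h6
    linarith

theorem ends_update (h0 : s.reg 0 = d) :
    Ends A (.seq (.setReg 7 (.add (.reg 0) (.lit 1))) (.seq (.setReg 4 (.lit 1))
      (.seq (pass 7 updateStores) (.seq (pass 7 moveStores)
        (.store 1 (.lit 0) (.mul (.load 1 (.lit 0)) growthExpr)))))) s
      ((d + 1) * 100 + 100) fun s' => s'.reg 0 = d ∧ s'.mem 0 = s.mem 0 ∧
        s'.mem 1 0 = A.mul (s.mem 1 0) (A.add (A.ofNat 1) (A.div (A.ofNat 1) (A.ofNat 200))) ∧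
        (∀ j ≤ d, s'.mem 2 j = A.sub (s.mem 2 j) (A.div (A.sub (s.mem 3 j) (s.mem 0 j))
          (A.ofNat 2))) ∧ ∀ p, d < p → s'.mem 2 p = s.mem 2 p := by
  have inj1 : ∀ s n, Injective updateStores s n := by
    intro s n st hst st' hst' i hi i' hi' ha he
    simp only [updateStores, List.mem_singleton] at hst hst'
    subst hst; subst hst'
    simp [NExpr.eval, atIter_reg] at he
    exact ⟨rfl, he⟩
  have inj2 : ∀ s n, Injective moveStores s n := by
    intro s n st hst st' hst' i hi i' hi' ha he
    simp only [moveStores, List.mem_singleton] at hst hst'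
    subst hst; subst hst'
    simp [NExpr.eval, atIter_reg] at he
    exact ⟨rfl, he⟩
  have sep1 : Separate updateStores := by
    intro st hst st' hst'
    simp only [updateStores, List.mem_singleton] at hst hst'
    subst hst; subst hst'
    simp [RExpr.arrays]
  have sep2 : Separate moveStores := by
    intro st hst st' hst'
    simp only [moveStores, List.mem_singleton] at hst hst'
    subst hst; subst hst'
    simp [RExpr.arrays]
  have c1 : storesCost updateStores + 20 ≤ 50 := by decide
  have c2 : storesCost moveStores + 20 ≤ 50 := by decide
  refine Ends.mono (T := 4 + (2 + (((d + 1) * (storesCost updateStores + 20) + 20) +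
    (((d + 1) * (storesCost moveStores + 20) + 20) + 13))))
    (Q := fun s' => s'.reg 0 = d ∧ s'.mem 0 = s.mem 0 ∧
        s'.mem 1 0 = A.mul (s.mem 1 0) (A.add (A.ofNat 1) (A.div (A.ofNat 1) (A.ofNat 200))) ∧
        (∀ j ≤ d, s'.mem 2 j = A.sub (s.mem 2 j) (A.div (A.sub (s.mem 3 j) (s.mem 0 j))
          (A.ofNat 2))) ∧ ∀ p, d < p → s'.mem 2 p = s.mem 2 p) ?_ ?_ fun _ h => h
  · refine (Ends.setReg (e := .add (.reg 0) (.lit 1)) (Q := fun s' => s'.reg 0 = d ∧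
      s'.reg 7 = d + 1 ∧ s'.mem = s.mem) ⟨by simpa [State.setReg] using h0, by
        simp [State.setReg, NExpr.eval, h0], rfl⟩).seq fun s₁ ⟨r10, r17, e1⟩ => ?_
    refine (Ends.setReg (e := .lit 1) (Q := fun s' => s'.reg 0 = d ∧
      s'.reg 7 = d + 1 ∧ s'.reg 4 = 1 ∧ s'.mem = s.mem) ⟨by simpa [State.setReg] using r10,
        by simpa [State.setReg] using r17, by simp [State.setReg, NExpr.eval], e1⟩).seq
      fun s₂ ⟨r20, r27, r24, e2⟩ => ?_
    have p1 := ends_pass_of_injective (A := A) (nr := 7) (by norm_num) (by norm_num) sep1 (s := s₂)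
      (by omega) (inj1 _ _)
    rw [r27] at p1
    refine p1.seq fun s₃ ⟨f1, f2, f3⟩ => ?_
    have r37 : s₃.reg 7 = d + 1 := (f1 7 (by norm_num) (by norm_num)).trans r27
    have r34 : s₃.reg 4 = 1 := (f1 4 (by norm_num) (by norm_num)).trans r24
    have r30 : s₃.reg 0 = d := (f1 0 (by norm_num) (by norm_num)).trans r20
    have e3 : ∀ a, a ≠ 4 → s₃.mem a = s.mem a := fun a ha => by
      rw [← e2]
      refine funext fun p => f3 a p fun i _ st hst e => ?_
      simp only [updateStores, List.mem_singleton] at hst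
      subst hst
      exact absurd e.symm ha
    have p2 := ends_pass_of_injective (A := A) (nr := 7) (by norm_num) (by norm_num) sep2 (s := s₃)
      (by omega) (inj2 _ _)
    rw [r37] at p2
    refine p2.seq fun s₄ ⟨g1, g2, g3⟩ => ?_
    have e4 : ∀ a, a ≠ 2 → s₄.mem a = s₃.mem a := fun a ha =>
      funext fun p => g3 a p fun i _ st hst e => by
        simp only [moveStores, List.mem_singleton] at hst
        subst hst
        exact absurd e.symm ha
    refine Ends.store (i := .lit 0) (e := .mul (.load 1 (.lit 0)) growthExpr)
      ⟨(g1 0 (by norm_num) (by norm_num)).trans r30, ?_, ?_, fun j hj => ?_, fun p hp => ?_⟩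
    · simp only [State.store]
      rw [Function.update_of_ne (by norm_num), e4 0 (by norm_num), e3 0 (by norm_num)]
    · simp only [State.store, Function.update_self, NExpr.eval, RExpr.eval, growthExpr]
      rw [e4 1 (by norm_num), e3 1 (by norm_num)]
    · simp only [State.store]
      rw [Function.update_of_ne (by norm_num)]
      have m1 := g2 j (by omega) _ (List.mem_cons_self ..)
      have m2 := f2 j (by omega) _ (List.mem_cons_self ..)
      simp [NExpr.eval, RExpr.eval, atIter_reg, e2] at m1 m2
      rw [m1, m2]
    · simp only [State.store]
      rw [Function.update_of_ne (by norm_num), g3 2 p, e3 2 (by norm_num)]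
      intro i hi st hst e
      simp only [moveStores, List.mem_singleton] at hst
      subst hst
      simp [NExpr.eval, atIter_reg]; omega
  · have := Nat.mul_le_mul_left (d + 1) c1
    have := Nat.mul_le_mul_left (d + 1) c2
    omega

/-- `F Ψ` is recovered from `Ψ`, the next iterate and the target, all of which are bounded on the
region. -/
theorem abs_F_le {fhat Ψ : Fin (d + 1) → ℝ} (hf : l1 fhat ≤ 0.861) (hΨ : Ψ ∈ region fhat)
    (j : Fin (d + 1)) : |F Ψ j| ≤ 7 := by
  have h1 : ∀ v : Fin (d + 1) → ℝ, |v j| ≤ l1 v := fun v =>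
    Finset.single_le_sum (f := fun j => |v j|) (fun _ _ => abs_nonneg _) (Finset.mem_univ j)
  have h2 := (h1 Ψ).trans (l1_le_of_mem_region hf hΨ)
  have h3 := (h1 _).trans (l1_le_of_mem_region hf
    (fpStep_mem_region (f' := fhat) hf (by norm_num [l1]) hΨ))
  have h4 := (h1 fhat).trans hf
  have e : F Ψ j = 2 * (Ψ j - fpStep fhat Ψ j) + fhat j := by
    simp [fpStep]
  rw [e]
  rw [abs_le] at *
  constructor <;> linarith [h2.1, h2.2, h3.1, h3.2, h4.1, h4.2]

theorem ends_stepProg {fhat Ψ : Fin (d + 1) → ℝ} (hu : 0 ≤ u)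
    (hsmall : 10 ^ 9 * (arrLen d : ℝ) ^ 12 * u ≤ 1) (hf : l1 fhat ≤ 0.861) (hΨ : Ψ ∈ region fhat)
    (h0 : s.reg 0 = d) (hx : ∀ j : Fin (d + 1), s.mem 2 j = Ψ j)
    (hx0 : ∀ p, d < p → s.mem 2 p = 0) (hfx : ∀ j : Fin (d + 1), s.mem 0 j = fhat j) :
    Ends A stepProg s (evalCost d + ((d + 1) * 100 + 100)) fun s' => s'.reg 0 = d ∧
      s'.mem 0 = s.mem 0 ∧
      s'.mem 1 0 = A.mul (s.mem 1 0) (A.add (A.ofNat 1) (A.div (A.ofNat 1) (A.ofNat 200))) ∧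
      (∀ p, d < p → s'.mem 2 p = 0) ∧
      l1 ((fun j : Fin (d + 1) => s'.mem 2 j) - fpStep fhat Ψ) ≤
        2 * 10 ^ 5 * (arrLen d : ℝ) ^ 12 * u := by
  have hN1 : (1 : ℝ) ≤ arrLen d := by
    have := two_mul_add_one_le_arrLen d
    exact_mod_cast (by omega : 1 ≤ arrLen d)
  set N : ℝ := ((arrLen d : ℕ) : ℝ) with hN
  have hN11 : (1 : ℝ) ≤ N ^ 11 := one_le_pow₀ hN1
  have h1211 : N ^ 11 ≤ N ^ 12 := pow_le_pow_right₀ hN1 (by norm_num)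
  set K : ℝ := 3 * 10 ^ 4 * N ^ 11 with hK
  have hK0 : 0 ≤ K := by positivity
  have hKu : (K + 12) * u ≤ 1 := by
    refine le_trans (mul_le_mul_of_nonneg_right ?_ hu) hsmall
    rw [hK]; linarith
  have hc : ∀ L, L ≤ K + 12 → L * u ≤ 1 := fun L hL =>
    (mul_le_mul_of_nonneg_right hL hu).trans hKu
  have hs11 : 10 ^ 4 * N ^ 11 * u ≤ 1 := by
    refine le_trans (mul_le_mul_of_nonneg_right ?_ hu) hsmall
    linarith
  refine (ends_evalProg (a := 2) (o := 3) hu hs11 (by norm_num) (by norm_num) h0 hx hx0).seq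
    fun s₁ ⟨r1, f1, f2, f3⟩ => (ends_update (A := A) r1).mono le_rfl
    fun s₂ ⟨r2, g0, g1, g2, g3⟩ => ⟨r2, ?_, ?_, fun p hp => ?_, ?_⟩
  · rw [g0, f1 0 (by norm_num) (by norm_num)]
  · rw [g1, f1 1 (by norm_num) (by norm_num)]
  · rw [g3 p hp, f1 2 (by norm_num) (by norm_num), hx0 p hp]
  -- Here `5.5 = 1.5 + (7 + 1) / 2` bounds the operands `Ψ j` and `(F Ψ j - fhat j) / 2`.
  · have hj : ∀ j : Fin (d + 1), |s₂.mem 2 j - fpStep fhat Ψ j| ≤ (K + 12) * u * 5.5 := by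
      intro j
      have hj' : ∀ v : Fin (d + 1) → ℝ, |v j| ≤ l1 v := fun v =>
        Finset.single_le_sum (f := fun j => |v j|) (fun _ _ => abs_nonneg _) (Finset.mem_univ j)
      rw [g2 j (by omega), f1 2 (by norm_num) (by norm_num), f1 0 (by norm_num) (by norm_num), hx,
        hfx]
      have a1 : Ap u K 7 (s₁.mem 3 j) (F Ψ j) := by
        refine ⟨abs_F_le hf hΨ j, (f3 j).trans ?_⟩
        have : 0 ≤ K * u := by positivity
        have e : 3 * (10 ^ 4 * N ^ 11 * u) = K * u := by rw [hK]; ring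
        rw [e]; linarith
      have a2 : Ap u K 1 (fhat j) (fhat j) :=
        Ap.exact hu hK0 ((hj' fhat).trans (hf.trans (by norm_num)))
      have a3 := (a1.sub (A := A) hu a2 (hc _ (by linarith))).div_nat (A := A) hu
        (by have := hc 2 (by linarith); linarith) (hc _ (by linarith)) (n := 2) (by norm_num)
      have a4 : Ap u (K + 2 + 8) 1.5 (Ψ j) (Ψ j) :=
        Ap.exact hu (by linarith) ((hj' Ψ).trans (l1_le_of_mem_region hf hΨ))
      have a5 := (a4.sub (A := A) hu a3 (hc _ (by linarith))).2
      have e : fpStep fhat Ψ j = Ψ j - (F Ψ j - fhat j) / (2 : ℕ) := by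
        simp [fpStep]; ring
      rw [e]
      refine a5.trans (le_of_eq ?_)
      push_cast; ring
    have hd : ((d + 1 : ℕ) : ℝ) ≤ N := by
      have := two_mul_add_one_le_arrLen d
      rw [hN]
      exact_mod_cast (show d + 1 ≤ arrLen d by omega)
    calc l1 ((fun j : Fin (d + 1) => s₂.mem 2 j) - fpStep fhat Ψ)
        ≤ ∑ _j : Fin (d + 1), (K + 12) * u * 5.5 := Finset.sum_le_sum fun j _ => hj j
      _ = ((d + 1 : ℕ) : ℝ) * ((K + 12) * u * 5.5) := by
          rw [Finset.sum_const, Finset.card_univ, Fintype.card_fin, nsmul_eq_mul]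
      _ ≤ N * ((3.1 * 10 ^ 4 * N ^ 11) * u * 5.5) := by
          gcongr
          rw [hK]; linarith
      _ = 170500 * (N ^ 12 * u) := by ring
      _ ≤ 2 * 10 ^ 5 * (N ^ 12 * u) := by gcongr; norm_num
      _ = 2 * 10 ^ 5 * N ^ 12 * u := by ring

theorem ends_iterProg {fhat : Fin (d + 1) → ℝ} {ε : ℝ} {n : ℕ} (hu : 0 ≤ u)
    (hsmall : 10 ^ 9 * (arrLen d : ℝ) ^ 12 * u ≤ 1) (hf : l1 fhat ≤ 0.861)
    (hlt : ∀ k < n, counter A ε k < A.ofNat 1) (hn : ¬ counter A ε n < A.ofNat 1) :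
    Ends A iterProg (input fhat ε) (n * (evalCost d + ((d + 1) * 100 + 105)) + 5) fun s' =>
      l1 (output d s' - fpi fhat n) ≤ (2 * 10 ^ 5 * (arrLen d : ℝ) ^ 12 * u) / 0.015 := by
  set δ : ℝ := 2 * 10 ^ 5 * (arrLen d : ℝ) ^ 12 * u with hδ
  have hδ0 : 0 ≤ δ := by positivity
  have hδ1 : δ ≤ 0.00025 := by
    have : δ = 0.0002 * (10 ^ 9 * (arrLen d : ℝ) ^ 12 * u) := by rw [hδ]; ring
    rw [this]; linarith
  -- Membership in the region and the distance to the exact iterate are carried together by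
  -- `perturbed_step`. The zeros beyond index `d` are needed for the padding in every evaluation.
  let I : ℕ → State → Prop := fun k s' => s'.reg 0 = d ∧ s'.mem 0 = (input fhat ε).mem 0 ∧
    s'.mem 1 0 = counter A ε k ∧ (∀ p, d < p → s'.mem 2 p = 0) ∧
    (fun j : Fin (d + 1) => s'.mem 2 j) ∈ region fhat ∧
    l1 ((fun j : Fin (d + 1) => s'.mem 2 j) - fpi fhat k) ≤ δ / 0.015
  have h0 : I 0 (input fhat ε) := by
    have e : (fun j : Fin (d + 1) => (input fhat ε).mem 2 j) = 0 := by funext j; simp [input]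
    refine ⟨by simp [input], rfl, by simp [input, counter], fun p _ => by simp [input], ?_, ?_⟩
    · rw [e]; exact zero_mem_region hf
    · rw [e, fpi, sub_zero]
      have : l1 (0 : Fin (d + 1) → ℝ) = 0 := by simp [l1]
      rw [this]; positivity
  refine (Ends.while_count (A := A) (b := .rlt (.load 1 (.lit 0)) (.ofNat (.lit 1))) n I h0
    (T := evalCost d + ((d + 1) * 100 + 100)) ?_ ?_).mono ?_ fun s' h => h.2.2.2.2.2
  · rintro k hk s₁ ⟨r0, m0, m1, m2, hreg, hl⟩
    refine ⟨by simpa [Test.holds, RExpr.eval, NExpr.eval, m1] using hlt k hk, ?_⟩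
    refine (ends_stepProg hu hsmall hf hreg r0 (fun _ => rfl) m2 (fun j => by
      rw [m0]; simp [input]; omega)).mono le_rfl fun s₂ ⟨q0, q1, q2, q3, q4⟩ =>
        ⟨q0, q1.trans m0, by rw [q2, m1]; rfl, q3, ?_⟩
    exact perturbed_step hf hδ1 (fpi_mem_region hf k) hreg hl q4
  · rintro s₁ ⟨r0, m0, m1, m2, hreg, hl⟩
    simpa [Test.holds, RExpr.eval, NExpr.eval, m1] using hn
  · have e : (Test.rlt (.load 1 (.lit 0)) (.ofNat (.lit 1))).cost = 5 := rfl
    rw [e]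
    have := Nat.mul_le_mul_left n (show 5 + (evalCost d + ((d + 1) * 100 + 100)) ≤
      evalCost d + ((d + 1) * 100 + 105) by omega)
    omega

end

/-! ### The bounds in terms of `size d` -/

theorem two_pow_size_le (d : ℕ) : ((2 ^ Nat.size d : ℕ) : ℝ) ≤ 2 * size d := by
  rcases Nat.eq_zero_or_pos d with rfl | hd
  · norm_num [size]
  · have h1 : 2 ^ (Nat.size d - 1) ≤ d :=
      Nat.lt_size.1 (Nat.sub_lt (Nat.size_pos.2 hd) one_pos)
    have h2 : 2 ^ Nat.size d = 2 ^ (Nat.size d - 1) * 2 := by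
      rw [← pow_succ]; congr 1; have := Nat.size_pos.2 hd; omega
    have h3 : (2 ^ Nat.size d : ℕ) ≤ 2 * d := by omega
    have h4 : (d : ℝ) ≤ size d := le_max_left _ _
    calc ((2 ^ Nat.size d : ℕ) : ℝ) ≤ ((2 * d : ℕ) : ℝ) := by exact_mod_cast h3
      _ ≤ 2 * size d := by push_cast; linarith

theorem arrLen_le (d : ℕ) : (arrLen d : ℝ) ≤ 4 * size d := by
  have := two_pow_size_le d
  rw [arrLen, pow_succ]; push_cast at this ⊢; linarith

/-- With `D = size d` one has `2 ^ (Nat.size d + 1) ≤ 4 D ≤ D ^ 3`, so the number of levels is at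
most a multiple of `log D`; this uses `D ≥ 2`. -/
theorem evalCost_le (d : ℕ) :
    (evalCost d : ℝ) ≤ 10 ^ 6 * (size d * Real.log (size d) ^ 2) := by
  have hD : 2 ≤ size d := le_max_right _ _
  have h1 := two_pow_size_le d
  have hlog2 := Real.log_two_gt_d9
  have hlD : Real.log 2 ≤ Real.log (size d) := Real.log_le_log (by norm_num) hD
  have h2 : ((Nat.size d + 1 : ℕ) : ℝ) * Real.log 2 ≤ 3 * Real.log (size d) := by
    rw [← Real.log_pow]
    have h3 : (2 : ℝ) ^ (Nat.size d + 1) ≤ 2 ^ 2 * size d := by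
      rw [pow_succ]; push_cast at h1; linarith
    refine (Real.log_le_log (by positivity) h3).trans ?_
    rw [Real.log_mul (by norm_num) (by linarith), Real.log_pow]
    push_cast; linarith
  have h4 : ((Nat.size d + 1 : ℕ) : ℝ) ≤ 4.5 * Real.log (size d) := by
    have h5 : (0 : ℝ) ≤ ((Nat.size d + 1 : ℕ) : ℝ) := Nat.cast_nonneg _
    nlinarith
  have e : (evalCost d : ℝ) = 20000 * ((Nat.size d + 1 : ℕ) : ℝ) ^ 2 * ((2 ^ Nat.size d : ℕ) : ℝ) := by
    rw [evalCost]; push_cast; ring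
  rw [e]
  calc 20000 * ((Nat.size d + 1 : ℕ) : ℝ) ^ 2 * ((2 ^ Nat.size d : ℕ) : ℝ)
      ≤ 20000 * (4.5 * Real.log (size d)) ^ 2 * (2 * size d) := by gcongr
    _ = 810000 * (size d * Real.log (size d) ^ 2) := by ring
    _ ≤ 10 ^ 6 * (size d * Real.log (size d) ^ 2) := by
        have : 0 ≤ size d * Real.log (size d) ^ 2 := by positivity
        gcongr; norm_num

end QSP

end

/-! ### The two programs and their constants. -/

theorem theorem2 :
    ∃ (evalF ffpi : QSP.Prog) (C : ℝ) (p : ℕ), 0 < C ∧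
      -- evaluation of `F` in `O(d log² d)`, stably
      (∀ (d : ℕ) (Ψ : Fin (d + 1) → ℝ) (u : ℝ), 0 ≤ u → C * QSP.size d ^ p * u ≤ 1 →
        ∀ A : QSP.Arith u, ∃ (s : QSP.State) (t : ℕ),
          QSP.Exec A evalF (QSP.input Ψ 0) s t ∧
          (t : ℝ) ≤ C * (QSP.size d * Real.log (QSP.size d) ^ 2) ∧
          QSP.l1 (QSP.output d s - QSP.F Ψ) ≤ C * QSP.size d ^ p * u) ∧
      -- the fast fixed-point iteration
      (∀ (d : ℕ) (f : Polynomial ℝ) (fhat : Fin (d + 1) → ℝ),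
        f = ∑ j : Fin (d + 1),
          Polynomial.C (fhat j) * Polynomial.Chebyshev.T ℝ (2 * (j : ℤ)) →
        ∑ j, |fhat j| < 0.861 →
        ∃ Ψ : Fin (d + 1) → ℝ,
          QSP.IsMaximalSolution f Ψ ∧
          (∀ Ψ' : Fin (d + 1) → ℝ, QSP.IsMaximalSolution f Ψ' → Ψ' = Ψ) ∧
          ∀ ε : ℝ, 0 < ε → ε ≤ 1 / 2 →
          ∀ u : ℝ, 0 ≤ u → C * QSP.size d ^ p * u ≤ 1 →
          ∀ A : QSP.Arith u, ∃ (k : ℕ) (s : QSP.State) (t : ℕ),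
            (k : ℝ) ≤ C * Real.log (1 / ε) ∧
            QSP.l1 (QSP.fpi fhat k - Ψ) ≤ ε ∧
            QSP.Exec A ffpi (QSP.input fhat ε) s t ∧
            (t : ℝ) ≤ C * (QSP.size d * Real.log (QSP.size d) ^ 2 * Real.log (1 / ε)) ∧
            QSP.l1 (QSP.output d s - QSP.fpi fhat k) ≤ C * QSP.size d ^ p * u) := by
  have hsmall : ∀ (d : ℕ) (u : ℝ), 0 ≤ u → 10 ^ 17 * QSP.size d ^ 12 * u ≤ 1 →
      10 ^ 9 * (QSP.arrLen d : ℝ) ^ 12 * u ≤ 1 := by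
    intro d u hu h
    have h1 : (QSP.arrLen d : ℝ) ^ 12 ≤ (4 * QSP.size d) ^ 12 :=
      pow_le_pow_left₀ (Nat.cast_nonneg _) (QSP.arrLen_le d) 12
    have hD : 0 ≤ QSP.size d := le_trans (by norm_num) (le_max_right _ _)
    refine le_trans (mul_le_mul_of_nonneg_right ?_ hu) h
    rw [mul_pow] at h1
    have : 0 ≤ QSP.size d ^ 12 := by positivity
    linarith
  have hN1 : ∀ d : ℕ, (1 : ℝ) ≤ QSP.arrLen d := fun d => by
    have := QSP.two_mul_add_one_le_arrLen d
    exact_mod_cast (by omega : 1 ≤ QSP.arrLen d)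
  -- As `arrLen d ≤ 4 * size d`, the constant has to exceed `10 ^ 9 * 4 ^ 12` for the smallness
  -- condition `hsmall`; the other requirements are weaker. The exponent `12` is `11` from the tree
  -- and one from summing the entries.
  refine ⟨QSP.evalProg 0 2, QSP.iterProg, 10 ^ 17, 12, by norm_num, ?_, ?_⟩
  · intro d Ψ u hu hC A
    have hD : 2 ≤ QSP.size d := le_max_right _ _
    have hs := hsmall d u hu hC
    have hs11 : 10 ^ 4 * (QSP.arrLen d : ℝ) ^ 11 * u ≤ 1 := by
      refine le_trans (mul_le_mul_of_nonneg_right ?_ hu) hs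
      have h1 := pow_le_pow_right₀ (hN1 d) (show 11 ≤ 12 by norm_num)
      have h2 : (1 : ℝ) ≤ (QSP.arrLen d : ℝ) ^ 11 := one_le_pow₀ (hN1 d)
      linarith
    obtain ⟨s, t, h1, h2, -, -, -, h3⟩ := QSP.ends_evalProg (A := A) (a := 0) (o := 2)
      (s := QSP.input Ψ 0) (Ψ := Ψ) hu hs11 (by norm_num) (by norm_num) (by simp [QSP.input])
      (fun j => by simp [QSP.input]; omega)
      (fun p hp => by simp [QSP.input]; omega)
    refine ⟨s, t, h1, ?_, ?_⟩
    · have h4 : (t : ℝ) ≤ QSP.evalCost d := by exact_mod_cast h2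
      refine h4.trans ((QSP.evalCost_le d).trans ?_)
      have : 0 ≤ QSP.size d * Real.log (QSP.size d) ^ 2 := by positivity
      gcongr <;> norm_num
    · have hd : ((d + 1 : ℕ) : ℝ) ≤ QSP.arrLen d := by
        have := QSP.two_mul_add_one_le_arrLen d
        exact_mod_cast (show d + 1 ≤ QSP.arrLen d by omega)
      calc QSP.l1 (QSP.output d s - QSP.F Ψ)
          ≤ ∑ _j : Fin (d + 1), 3 * (10 ^ 4 * (QSP.arrLen d : ℝ) ^ 11 * u) :=
            Finset.sum_le_sum fun j _ => h3 j
        _ = ((d + 1 : ℕ) : ℝ) * (3 * (10 ^ 4 * (QSP.arrLen d : ℝ) ^ 11 * u)) := by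
            rw [Finset.sum_const, Finset.card_univ, Fintype.card_fin, nsmul_eq_mul]
        _ ≤ QSP.arrLen d * (3 * (10 ^ 4 * (QSP.arrLen d : ℝ) ^ 11 * u)) := by gcongr
        _ = 3 * 10 ^ 4 * ((QSP.arrLen d : ℝ) ^ 12 * u) := by ring
        _ ≤ 3 * 10 ^ 4 * ((4 * QSP.size d) ^ 12 * u) := by
            gcongr; exact QSP.arrLen_le d
        _ = 3 * 10 ^ 4 * 4 ^ 12 * (QSP.size d ^ 12 * u) := by ring
        _ ≤ 10 ^ 17 * (QSP.size d ^ 12 * u) := by gcongr; norm_num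
        _ = 10 ^ 17 * QSP.size d ^ 12 * u := by ring
  · intro d f fhat hf hfl
    have hf' : QSP.l1 fhat ≤ 0.861 := hfl.le
    have hfc : f = QSP.chebSum fhat := hf
    obtain ⟨Ψ, hΨ, hfix⟩ := QSP.exists_fixedPoint hf'
    have hmax := QSP.isMaximalSolution_of_fixedPoint hf' hΨ hfix
    rw [hfc]
    refine ⟨Ψ, hmax, fun Ψ' h' => QSP.isMaximalSolution_unique (hfl.trans (by norm_num)) hmax h',
      fun ε hε hε' u hu hC A => ?_⟩
    have hD : 2 ≤ QSP.size d := le_max_right _ _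
    have hs := hsmall d u hu hC
    have hu5 : 10 ^ 5 * u ≤ 1 := by
      refine le_trans (mul_le_mul_of_nonneg_right ?_ hu) hs
      have h2 : (1 : ℝ) ≤ (QSP.arrLen d : ℝ) ^ 12 := one_le_pow₀ (hN1 d)
      linarith
    obtain ⟨n, hlt, hn, hn1, hn2⟩ := QSP.exists_iterations (A := A) hu hu5 hε hε'
    obtain ⟨s, t, h1, h2, h3⟩ := QSP.ends_iterProg (A := A) hu hs hf' hlt hn
    -- As `ε ≤ 1/2`, the logarithm stays away from zero, so the additive `1` in `n + 1` is at most
    -- `2 * log (1 / ε)`.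
    have hL : 0.69 ≤ Real.log (1 / ε) := by
      have h2 : Real.log 2 ≤ Real.log (1 / ε) := by
        refine Real.log_le_log (by norm_num) ?_
        rw [le_div_iff₀ hε]; linarith
      linarith [Real.log_two_gt_d9]
    refine ⟨n, s, t, hn2.trans ?_, (QSP.l1_fpi_sub_le hf' hΨ hfix n).trans hn1, h1, ?_, ?_⟩
    · linarith
    · have hd : d + 1 ≤ 2 ^ Nat.size d := Nat.lt_size_self d
      have he : (d + 1) * 100 + 105 ≤ QSP.evalCost d := by
        rw [QSP.evalCost]
        have : 1 ≤ (Nat.size d + 1) ^ 2 := Nat.one_le_pow _ _ (by omega)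
        nlinarith
      have h4 : t ≤ (n + 1) * (2 * QSP.evalCost d) := by nlinarith
      have h5 : (t : ℝ) ≤ ((n : ℝ) + 1) * (2 * QSP.evalCost d) := by exact_mod_cast h4
      have h6 := QSP.evalCost_le d
      have h7 : 0 ≤ QSP.size d * Real.log (QSP.size d) ^ 2 := by positivity
      calc (t : ℝ) ≤ ((n : ℝ) + 1) * (2 * QSP.evalCost d) := h5
        _ ≤ (302 * Real.log (1 / ε)) *
            (2 * (10 ^ 6 * (QSP.size d * Real.log (QSP.size d) ^ 2))) := by
            gcongr; linarith
        _ = 604000000 * (QSP.size d * Real.log (QSP.size d) ^ 2 * Real.log (1 / ε)) := by ring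
        _ ≤ 10 ^ 17 * (QSP.size d * Real.log (QSP.size d) ^ 2 * Real.log (1 / ε)) := by
            gcongr; norm_num
    · calc QSP.l1 (QSP.output d s - QSP.fpi fhat n)
          ≤ 2 * 10 ^ 5 * (QSP.arrLen d : ℝ) ^ 12 * u / 0.015 := h3
        _ ≤ 2 * 10 ^ 5 * (4 * QSP.size d) ^ 12 * u / 0.015 := by
            gcongr; exact QSP.arrLen_le d
        _ = 2 * 10 ^ 5 * 4 ^ 12 / 0.015 * (QSP.size d ^ 12 * u) := by ring
        _ ≤ 10 ^ 17 * (QSP.size d ^ 12 * u) := by gcongr; norm_num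
        _ = 10 ^ 17 * QSP.size d ^ 12 * u := by ring
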